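/- Let $\mathbf{k}$ be a commutative unitary ring; algebras are associative, unitary $\mathbf{k}$-algebras. An operated algebra is an algebra $R$ with a $\mathbf{k}$-linear map $P:R\to R$; morphisms are algebra homomorphisms commuting with the operators. For a set $Z$, let $\mathfrak{M}(Z)$ be the free operated monoid on $Z$, whose elements (bracketed words) are finite products of letters $z\in Z$ and brackets $\lfloor w\rfloor$ of bracketed words $w$, and let $\mathbf{k}\langle\!\langle Z\rangle\!\rangle$ be the free operated algebra with $\mathbf{k}$-basis $\mathfrak{M}(Z)$ and operator $\lfloor\ \rfloor$. For $q\in\mathfrak{M}^\star(Z)$, i.e. a bracketed word on $Z\cup\{\star\}$ with exactly one occurrence of $\star$, write $q|_u$ for the result of replacing $\star$ by $u$, extended linearly in $u$. A bracketed word is in Rota-Baxter normal form (RBNF) if it is not of the form $q|_{\lfloor u\rfloor\lfloor v\rfloor}$; let $\mathfrak{R}(Z)$ be the set of bracketed words in RBNF. Let $B(x,y)\in\mathbf{k}\langle\!\langle x,y\rangle\!\rangle$ and $\phi=\lfloor x\rfloor\lfloor y\rfloor-\lfloor B(x,y)\rfloor$. For $f,g\in\mathbf{k}\langle\!\langle Z\rangle\!\rangle$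 write $f\to_\phi g$ if $g$ arises from $f$ by replacing, for one monomial $q|_{\lfloor u\rfloor\lfloor v\rfloor}$ ($u,v\in\mathfrak{M}(Z)$) that occurs in $f$ with coefficient $c\neq0$, the term $c\,q|_{\lfloor u\rfloor\lfloor v\rfloor}$ by $c\,q|_{\lfloor B(u,v)\rfloor}$; $f$ is $\phi$-reducible to $g$ if $g$ is reached from $f$ in finitely many (possibly zero) steps. $\phi$ is of Rota-Baxter type if: (1) each of $x,y$ occurs exactly once in every monomial of $B$; (2) all monomials of $B$ are in RBNF; (3) for every set $Z$ there is no infinite chain $f_0\to_\phi f_1\to_\phi\cdots$ in $\mathbf{k}\langle\!\langle Z\rangle\!\rangle$; (4) for every set $Z$ and all $u,v,w\in\mathfrak{M}(Z)$, the element $B(B(u,v),w)-B(u,B(v,w))$ is $\phi$-reducible to $0$. A monomial order on $\mathfrak{M}(Z)$ is a well order such that $u<v$ implies $q|_u<q|_v$ for all $q\in\mathfrak{M}^\star(Z)$; $\phi$ is compatible with it if, for all $u,v\in\mathfrak{M}(Z)$, every monomial of $\lfloor B(u,v)\rfloor\in\mathbf{k}\langle\!\langle Z\rangle\!\rangle$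 (equivalently, its leading monomial, if it is non-zero) is smaller than $\lfloor u\rfloor\lfloor v\rfloor$. A $\phi$-algebra is an operated algebra $(R,P)$ with $P(a)P(b)=P(B_{(R,P)}(a,b))$ for all $a,b\in R$. Let $\mathbf{k}_\phi\langle\!\langle Z\rangle\!\rangle$ be the quotient of $\mathbf{k}\langle\!\langle Z\rangle\!\rangle$ by the smallest operated ideal containing all $\phi(f,g)$, $f,g\in\mathbf{k}\langle\!\langle Z\rangle\!\rangle$, with quotient map $\eta$; it is the free $\phi$-algebra on $Z$. Let $\mathbf{k}\mathfrak{R}(Z)$ be the free $\mathbf{k}$-module with basis $\mathfrak{R}(Z)$, let $\iota:\mathbf{k}\mathfrak{R}(Z)\to\mathbf{k}\langle\!\langle Z\rangle\!\rangle$ be the inclusion, and let $P_r$ be the linear extension of $w\mapsto\lfloor w\rfloor$ to $\mathbf{k}\mathfrak{R}(Z)$. **Theorem.** Let $\phi$ be of Rota-Baxter type, let $Z$ be a set, and suppose that $\phi$ is compatible with a monomial order on $\mathfrak{M}(Z)$. Then: (a) $\eta\circ\iota:\mathbf{k}\mathfrak{R}(Z)\to\mathbf{k}_\phi\langle\!\langle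 Z\rangle\!\rangle$ is an isomorphism of $\mathbf{k}$-modules, and the images of the elements of $\mathfrak{R}(Z)$ form a $\mathbf{k}$-basis of $\mathbf{k}_\phi\langle\!\langle Z\rangle\!\rangle$. (b) Let $\mathrm{Red}=(\eta\circ\iota)^{-1}\circ\eta:\mathbf{k}\langle\!\langle Z\rangle\!\rangle\to\mathbf{k}\mathfrak{R}(Z)$, and let $\diamond$ be the bilinear product on $\mathbf{k}\mathfrak{R}(Z)$ defined for $u,v\in\mathfrak{R}(Z)$ as follows: if $u=u'\lfloor u^*\rfloor$ ends with a bracket and $v=\lfloor v^*\rfloor v'$ begins with a bracket, then $u\diamond v=u'\,\lfloor \mathrm{Red}(B(u^*,v^*))\rfloor\,v'$ (concatenation, extended linearly); otherwise $u\diamond v=uv$. Then $\diamond$ is associative with unit the empty word, and $(\mathbf{k}\mathfrak{R}(Z),\diamond,P_r)$, with the map sending $z\in Z$ to the word $z$, is a free $\phi$-algebra on $Z$: for every $\phi$-algebra $(R,P)$ and every map $f:Z\to R$ there is a unique morphism of operated algebras $\mathbf{k}\mathfrak{R}(Z)\to R$ extending $f$. -/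

import Mathlib

universe uZ uk uR

/-! ### Bracketed words: the free operated monoid `𝔐(Z)` -/

/-- The bracketed words on `Z`: a word is empty, or a letter `z` followed by a word (`z·w`), or a
bracketed word `⌊u⌋` followed by a word (`⌊u⌋·w`).  Equivalently, a bracketed word is a finite
sequence of factors, each of which is a letter or a bracket `⌊u⌋` of a bracketed word. -/
inductive BWord.{u} (Z : Type u) : Type u
  | nil : BWord Z
  | letter (z : Z) (w : BWord Z) : BWord Z
  | bracket (u w : BWord Z) : BWord Z

namespace BWord

variable {Z : Type*}

/-- Concatenation of bracketed words. -/
def append : BWord Z → BWord Z → BWord Z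
  | nil, v => v
  | letter z w, v => letter z (append w v)
  | bracket u w, v => bracket u (append w v)

instance : Monoid (BWord Z) where
  one := nil
  mul := append
  one_mul _ := rfl
  mul_one u := by
    change append u nil = u
    induction u with
    | nil => rfl
    | letter z w ih => simp only [append, ih]
    | bracket u w _ ih => simp only [append, ih]
  mul_assoc a b c := by
    change append (append a b) c = append a (append b c)
    induction a with
    | nil => rfl
    | letter z w ih => simp only [append, ih]
    | bracket u w _ ih => simp only [append, ih]

theorem nil_eq_one : (nil : BWord Z) = 1 := rfl
theorem nil_mul (v : BWord Z) : nil * v = v := rfl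
theorem letter_mul (z : Z) (w v : BWord Z) : letter z w * v = letter z (w * v) := rfl
theorem bracket_mul (u w v : BWord Z) : bracket u w * v = bracket u (w * v) := rfl

/-- The one-letter word `z`. -/
def of (z : Z) : BWord Z := letter z nil

/-- The operator `w ↦ ⌊w⌋` on bracketed words. -/
def br (w : BWord Z) : BWord Z := bracket w nil

open Classical in
/-- The number of occurrences of the letter `a` in a bracketed word. -/
noncomputable def count (a : Z) : BWord Z → ℕ
  | nil => 0
  | letter z w => (if z = a then 1 else 0) + count a w
  | bracket u w => count a u + count a w

/-- The value of a bracketed word in a monoid `M` with a self-map `P` at a point `r : Z → M`. -/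
def evalFun {M : Type*} [Monoid M] (P : M → M) (r : Z → M) : BWord Z → M
  | nil => 1
  | letter z w => r z * evalFun P r w
  | bracket u w => P (evalFun P r u) * evalFun P r w

/-- The morphism of operated monoids `𝔐(Z) → (M, P)` that extends `r : Z → M`. -/
def eval {M : Type*} [Monoid M] (P : M → M) (r : Z → M) : BWord Z →* M where
  toFun := evalFun P r
  map_one' := rfl
  map_mul' a b := by
    induction a with
    | nil => simp only [nil_mul, evalFun, one_mul]
    | letter z w ih => simp only [letter_mul, evalFun, ih, mul_assoc]
    | bracket u w _ ih => simp only [bracket_mul, evalFun, ih, mul_assoc]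

end BWord

/-- The `⋆`-bracketed words on `Z`, i.e. the bracketed words on `Z ∪ {⋆}` with exactly one
occurrence of `⋆`.  Such a word is uniquely of the form `l ⋆ r` or `l ⌊q⌋ r` with bracketed words
`l, r` on `Z` and a `⋆`-bracketed word `q`. -/
inductive StarWord.{u} (Z : Type u) : Type u
  | star (l r : BWord Z) : StarWord Z
  | inside (l : BWord Z) (q : StarWord Z) (r : BWord Z) : StarWord Z

/-- The word `q|_u`, obtained by replacing `⋆` in `q` by `u`. -/
def StarWord.subst {Z : Type*} : StarWord Z → BWord Z → BWord Z
  | .star l r, u => l * u * r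
  | .inside l q r, u => l * BWord.br (q.subst u) * r

/-- A bracketed word is in Rota-Baxter normal form if it has no subword `⌊u⌋⌊v⌋`. -/
def IsRBNF {Z : Type*} (w : BWord Z) : Prop :=
  ¬ ∃ (q : StarWord Z) (u v : BWord Z), w = q.subst (BWord.br u * BWord.br v)

/-- The set `ℜ(Z)` of bracketed words in Rota-Baxter normal form. -/
abbrev RBWord.{u} (Z : Type u) : Type u := {w : BWord Z // IsRBNF w}

/-! ### Some elementary facts about normal forms, needed to define the structure on `k·ℜ(Z)` -/

section NormalForms

variable {Z : Type*}

theorem isRBNF_nil : IsRBNF (BWord.nil : BWord Z) := by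
  rintro ⟨q, u, v, h⟩
  cases q with
  | star l r => cases l <;> cases h
  | inside l q r => cases l <;> cases h

theorem isRBNF_letter {z : Z} {w : BWord Z} : IsRBNF (BWord.letter z w) ↔ IsRBNF w := by
  constructor
  · rintro hw ⟨q, u, v, rfl⟩
    apply hw
    cases q with
    | star l r => exact ⟨.star (.letter z l) r, u, v, rfl⟩
    | inside l q r => exact ⟨.inside (.letter z l) q r, u, v, rfl⟩
  · rintro hw ⟨q, u, v, h⟩
    apply hw
    cases q with
    | star l r =>
      cases l with
      | nil => cases h
      | letter z' l => cases h; exact ⟨.star l r, u, v, rfl⟩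
      | bracket p l => cases h
    | inside l q r =>
      cases l with
      | nil => cases h
      | letter z' l => cases h; exact ⟨.inside l q r, u, v, rfl⟩
      | bracket p l => cases h

theorem isRBNF_bracket {p w : BWord Z} :
    IsRBNF (BWord.bracket p w) ↔
      IsRBNF p ∧ IsRBNF w ∧ ∀ p' w', w ≠ BWord.bracket p' w' := by
  constructor
  · intro hw
    refine ⟨?_, ?_, ?_⟩
    · rintro ⟨q, u, v, rfl⟩
      exact hw ⟨.inside .nil q w, u, v, rfl⟩
    · rintro ⟨q, u, v, rfl⟩
      apply hw
      cases q with
      | star l r => exact ⟨.star (.bracket p l) r, u, v, rfl⟩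
      | inside l q r => exact ⟨.inside (.bracket p l) q r, u, v, rfl⟩
    · rintro p' w' rfl
      exact hw ⟨.star .nil w', p, p', rfl⟩
  · rintro ⟨hp, hw, hne⟩ ⟨q, u, v, h⟩
    cases q with
    | star l r =>
      cases l with
      | nil => cases h; exact hne _ _ rfl
      | letter z' l => cases h
      | bracket p' l => cases h; exact hw ⟨.star l r, u, v, rfl⟩
    | inside l q r =>
      cases l with
      | nil => cases h; exact hp ⟨q, u, v, rfl⟩
      | letter z' l => cases h
      | bracket p' l => cases h; exact hw ⟨.inside l q r, u, v, rfl⟩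

theorem isRBNF_br {w : BWord Z} (hw : IsRBNF w) : IsRBNF (BWord.br w) :=
  isRBNF_bracket.2 ⟨hw, isRBNF_nil, by rintro _ _ ⟨⟩⟩

end NormalForms

/-- The empty word, as an element of `ℜ(Z)`. -/
def RBWord.one (Z : Type*) : RBWord Z := ⟨1, isRBNF_nil⟩

/-- The letter `z`, as an element of `ℜ(Z)`. -/
def RBWord.of {Z : Type*} (z : Z) : RBWord Z := ⟨BWord.of z, isRBNF_letter.2 isRBNF_nil⟩

/-- The bracket `⌊w⌋` of a normal form `w`, as an element of `ℜ(Z)`. -/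
def RBWord.br {Z : Type*} (w : RBWord Z) : RBWord Z := ⟨BWord.br w.1, isRBNF_br w.2⟩

/-! ### Bracketed polynomials and operated algebras -/

noncomputable section

/-- The algebra `k⟪Z⟫` of bracketed polynomials: the monoid algebra of `𝔐(Z)` over `k`. -/
abbrev BPoly.{v, u} (k : Type v) [CommRing k] (Z : Type u) : Type (max u v) :=
  MonoidAlgebra k (BWord Z)

namespace BPoly

variable {k : Type*} [CommRing k] {Z : Type*}

/-- The bracketed polynomial consisting of the single monomial `w`. -/
def mono (w : BWord Z) : BPoly k Z := MonoidAlgebra.of k (BWord Z) w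

/-- The operator of `k⟪Z⟫`: the `k`-linear extension of `w ↦ ⌊w⌋`. -/
def br : BPoly k Z →ₗ[k] BPoly k Z := MonoidAlgebra.mapDomainLinearMap k k BWord.br

/-- The bracketed polynomial `q|_f`: the `k`-linear extension of `u ↦ q|_u`. -/
def subst (q : StarWord Z) : BPoly k Z →ₗ[k] BPoly k Z :=
  MonoidAlgebra.mapDomainLinearMap k k q.subst

/-- The monomials that appear in `f` (with a non-zero coefficient). -/
def supp (f : BPoly k Z) : Finset (BWord Z) := f.coeff.support

/-- The evaluation of bracketed polynomials in an operated algebra `(R, P)` at a point `r`: the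
morphism of operated algebras `k⟪Z⟫ → R` that extends `r : Z → R`. -/
def eval {R : Type*} [Ring R] [Algebra k R] (P : R →ₗ[k] R) (r : Z → R) : BPoly k Z →ₐ[k] R :=
  MonoidAlgebra.lift k R (BWord Z) (BWord.eval P r)

/-- `B(a, b)`, for `B ∈ k⟪x, y⟫` and two elements `a, b` of an operated algebra `(R, P)`. -/
def eval₂ {R : Type*} [Ring R] [Algebra k R] (B : BPoly k (Fin 2)) (P : R →ₗ[k] R) (a b : R) : R :=
  eval P ![a, b] B

/-- The bracketed polynomial `φ = ⌊x⌋⌊y⌋ - ⌊B(x, y)⌋`. -/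
def phi (B : BPoly k (Fin 2)) : BPoly k (Fin 2) :=
  br (mono (BWord.of 0)) * br (mono (BWord.of 1)) - br B

/-- `B` is totally linear: each variable appears exactly once in each monomial of `B`. -/
def IsTotallyLinear (B : BPoly k Z) : Prop :=
  ∀ m ∈ supp B, ∀ z : Z, m.count z = 1

/-- One-step rewriting `f →_φ g`, for `φ = ⌊x⌋⌊y⌋ - ⌊B(x, y)⌋`: for some monomial
`q|_{⌊u⌋⌊v⌋}` of `f`, with coefficient `c`, the term `c q|_{⌊u⌋⌊v⌋}` is replaced by
`c q|_{⌊B(u, v)⌋}`. -/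
def Rewrites (B : BPoly k (Fin 2)) (f g : BPoly k Z) : Prop :=
  ∃ (q : StarWord Z) (u v : BWord Z),
    q.subst (BWord.br u * BWord.br v) ∈ supp f ∧
    g = f - f.coeff (q.subst (BWord.br u * BWord.br v)) •
              (mono (q.subst (BWord.br u * BWord.br v)) : BPoly k Z)
          + f.coeff (q.subst (BWord.br u * BWord.br v)) •
              subst q (br (eval₂ B br (mono u) (mono v)))

/-- `f` reduces to `g` in finitely many (possibly zero) steps. -/
def Reduces (B : BPoly k (Fin 2)) : BPoly k Z → BPoly k Z → Prop :=
  Relation.ReflTransGen (Rewrites B)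

/-- The expression `φ = ⌊x⌋⌊y⌋ - ⌊B(x, y)⌋` is of Rota-Baxter type. -/
structure IsRotaBaxterType.{u, v} {k : Type v} [CommRing k] (B : BPoly k (Fin 2)) : Prop where
  totallyLinear : IsTotallyLinear B
  rbnf : ∀ m ∈ supp B, IsRBNF m
  terminating : ∀ Z : Type u,
    ¬ ∃ f : ℕ → BPoly k Z, ∀ n, Rewrites B (f n) (f (n + 1))
  assoc : ∀ (Z : Type u) (u v w : BWord Z),
    Reduces B
      (eval₂ B br (eval₂ B br (mono u) (mono v)) (mono w)
        - eval₂ B br (mono u) (eval₂ B br (mono v) (mono w)) : BPoly k Z) 0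

/-- The strict part `lt` of a monomial order on `𝔐(Z)`: a well order with
`u < v → q|_u < q|_v`. -/
structure IsMonomialOrder (lt : BWord Z → BWord Z → Prop) : Prop where
  isWellOrder : IsWellOrder (BWord Z) lt
  subst_lt : ∀ (q : StarWord Z) (u v : BWord Z), lt u v → lt (q.subst u) (q.subst v)

/-- `φ = ⌊x⌋⌊y⌋ - ⌊B(x, y)⌋` is compatible with the order: for all bracketed words `u, v`, the
leading monomial of `⌊B(u, v)⌋`, hence each of its monomials, is smaller than `⌊u⌋⌊v⌋`. -/
def IsCompatible (B : BPoly k (Fin 2)) (lt : BWord Z → BWord Z → Prop) : Prop :=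
  ∀ u v : BWord Z, ∀ m ∈ supp (br (eval₂ B br (mono u) (mono v)) : BPoly k Z),
    lt m (BWord.br u * BWord.br v)

end BPoly

/-! ### `φ`-algebras and free `φ`-algebras -/

section PhiAlgebra

variable {k : Type*} [CommRing k]

/-- The operated algebra `(R, P)` is a `φ`-algebra, for `φ ∈ k⟪X⟫`. -/
def IsPhiAlgebra {X : Type*} (φ : BPoly k X) (R : Type*) [Ring R] [Algebra k R]
    (P : R →ₗ[k] R) : Prop :=
  ∀ r : X → R, BPoly.eval P r φ = 0

/-- The operated algebra `(A, P)` with the map `i : Z → A` is a free `φ`-algebra on `Z` (with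
respect to `φ`-algebras in the universe `w`). -/
def IsFreePhiAlgebra.{w, v, x, z, a} {k : Type v} [CommRing k] {X : Type x} {Z : Type z}
    (φ : BPoly k X) (A : Type a) [Ring A] [Algebra k A] (P : A →ₗ[k] A) (i : Z → A) : Prop :=
  IsPhiAlgebra φ A P ∧
  ∀ (R : Type w) [Ring R] [Algebra k R] (Q : R →ₗ[k] R), IsPhiAlgebra φ R Q →
    ∀ f : Z → R, ∃! g : A →ₐ[k] R, (∀ a, g (P a) = Q (g a)) ∧ ∀ z, g (i z) = f z

/-- A bilinear multiplication `mul` on a `k`-module `V` is associative with unit `e`. -/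
structure IsUnitalAssoc {V : Type*} [AddCommGroup V] [Module k V] (mul : V →ₗ[k] V →ₗ[k] V)
    (e : V) : Prop where
  assoc : ∀ a b c, mul (mul a b) c = mul a (mul b c)
  one_mul : ∀ a, mul e a = a
  mul_one : ∀ a, mul a e = a

/-- The ring structure on `V` whose addition is that of `V` and whose multiplication is `mul`. -/
abbrev IsUnitalAssoc.toRing {V : Type*} [AddCommGroup V] [Module k V]
    {mul : V →ₗ[k] V →ₗ[k] V} {e : V} (h : IsUnitalAssoc mul e) : Ring V :=
  { (inferInstance : AddCommGroup V) with
    mul := fun a b => mul a b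
    one := e
    mul_assoc := h.assoc
    one_mul := h.one_mul
    mul_one := h.mul_one
    left_distrib := fun a b c => (mul a).map_add b c
    right_distrib := fun a b c => mul.map_add₂ a b c
    zero_mul := fun a => mul.map_zero₂ a
    mul_zero := fun a => (mul a).map_zero }

/-- The `k`-algebra structure on `V` whose scalar multiplication is that of `V` and whose
multiplication is `mul`. -/
abbrev IsUnitalAssoc.toAlgebra {V : Type*} [AddCommGroup V] [inst : Module k V]
    {mul : V →ₗ[k] V →ₗ[k] V} {e : V} (h : IsUnitalAssoc mul e) :
    letI := h.toRing
    Algebra k V :=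
  letI := h.toRing
  letI : Module k V := inst
  Algebra.ofModule (fun r a b => mul.map_smul₂ r a b) (fun r a b => (mul a).map_smul r b)

/-- The module `V`, with the bilinear multiplication `mul`, the unit `e` and the operator `P`, is a
(unital associative) `k`-algebra, and it is a free `φ`-algebra on `Z` via `i : Z → V`. -/
def IsFreePhiAlgebraStructure.{w, v, x, z, a} {k : Type v} [CommRing k] {X : Type x}
    {Z : Type z} (φ : BPoly k X) {V : Type a} [AddCommGroup V] [Module k V]
    (mul : V →ₗ[k] V →ₗ[k] V) (e : V) (P : V →ₗ[k] V) (i : Z → V) : Prop :=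
  ∃ h : IsUnitalAssoc mul e,
    letI := h.toRing
    letI := h.toAlgebra
    IsFreePhiAlgebra.{w, v, x, z, a} φ V P i

end PhiAlgebra

/-! ### The quotient `k_φ⟪Z⟫ = k⟪Z⟫ / I_φ(Z)` -/

section Quotient

variable {k : Type*} [CommRing k] {X : Type*}

/-- The operated ideal generated by `S`: the smallest two-sided ideal that contains `S` and is
closed under the operator. -/
def operatedIdeal {Z : Type*} (S : Set (BPoly k Z)) : Ideal (BPoly k Z) :=
  sInf {I | I.IsTwoSided ∧ (∀ f ∈ I, BPoly.br f ∈ I) ∧ S ⊆ I}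

instance {Z : Type*} (S : Set (BPoly k Z)) : (operatedIdeal S).IsTwoSided := by
  refine ⟨fun b ha => ?_⟩
  simp only [operatedIdeal, Submodule.mem_sInf] at ha ⊢
  intro I hI
  have := hI.1
  exact Ideal.mul_mem_right b I (ha I hI)

/-- The set `S_φ(Z)` of all values of `φ` in `k⟪Z⟫`. -/
def phiValues (φ : BPoly k X) (Z : Type*) : Set (BPoly k Z) :=
  Set.range fun r : X → BPoly k Z => BPoly.eval BPoly.br r φ

/-- `k_φ⟪Z⟫`, the quotient of `k⟪Z⟫` by the operated ideal `I_φ(Z)` generated by `S_φ(Z)`. -/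
abbrev PhiQuotient (φ : BPoly k X) (Z : Type*) : Type _ :=
  BPoly k Z ⧸ operatedIdeal (phiValues φ Z)

/-- The quotient map `η : k⟪Z⟫ → k_φ⟪Z⟫`. -/
def PhiQuotient.eta (φ : BPoly k X) (Z : Type*) : BPoly k Z →ₐ[k] PhiQuotient φ Z :=
  Ideal.Quotient.mkₐ k (operatedIdeal (phiValues φ Z))

end Quotient

/-! ### The module `k·ℜ(Z)`, its operator and the product `⋄` -/

section RBModule

variable {k : Type*} [CommRing k] {Z : Type*}

/-- The free `k`-module `k·ℜ(Z)` with basis `ℜ(Z)`. -/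
abbrev RBModule.{v, u} (k : Type v) [CommRing k] (Z : Type u) : Type (max u v) := RBWord Z →₀ k

/-- The natural `k`-linear map `ι : k·ℜ(Z) → k⟪Z⟫`. -/
def RBModule.iota : RBModule k Z →ₗ[k] BPoly k Z :=
  Finsupp.linearCombination k fun w : RBWord Z => BPoly.mono w.1

/-- The operator `P_r` of `k·ℜ(Z)`: the `k`-linear extension of `w ↦ ⌊w⌋`. -/
def RBModule.op : RBModule k Z →ₗ[k] RBModule k Z := Finsupp.lmapDomain k k RBWord.br

/-- The product `u ⋄ v` of bracketed words, with values in `k⟪Z⟫`, for `Red : k⟪Z⟫ → k·ℜ(Z)`.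
If `u = u'⌊p⌋` ends with a bracket and `v = ⌊q⌋v'` begins with a bracket, then
`u ⋄ v = u' ⌊Red(B(p, q))⌋ v'`; otherwise `u ⋄ v = uv`. -/
def diamondWord (B : BPoly k (Fin 2)) (Red : BPoly k Z →ₗ[k] RBModule k Z) :
    BWord Z → BWord Z → BPoly k Z
  | .nil, v => BPoly.mono v
  | .letter z u, v => BPoly.mono (BWord.of z) * diamondWord B Red u v
  | .bracket p .nil, .bracket q v' =>
      RBModule.iota
          (RBModule.op (Red (BPoly.eval₂ B BPoly.br (BPoly.mono p) (BPoly.mono q))))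
        * BPoly.mono v'
  | .bracket p .nil, v => BPoly.mono (BWord.br p * v)
  | .bracket p (.letter z u), v =>
      BPoly.mono (BWord.br p) * diamondWord B Red (.letter z u) v
  | .bracket p (.bracket p' u), v =>
      BPoly.mono (BWord.br p) * diamondWord B Red (.bracket p' u) v

/-- The product `u ⋄ v` of two words in normal form, as an element of `k·ℜ(Z)`.  No monomial is
lost in the restriction to `ℜ(Z)`: see `iota_diamondBasis`. -/
def diamondBasis (B : BPoly k (Fin 2)) (Red : BPoly k Z →ₗ[k] RBModule k Z) (u v : RBWord Z) :
    RBModule k Z :=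
  Finsupp.subtypeDomain IsRBNF (diamondWord B Red u.1 v.1).coeff

theorem RBModule.coeff_iota (f : RBModule k Z) :
    (RBModule.iota f).coeff = f.mapDomain Subtype.val := by
  induction f using Finsupp.induction_linear with
  | zero => simp
  | add f g hf hg => rw [map_add, MonoidAlgebra.coeff_add, hf, hg, Finsupp.mapDomain_add]
  | single w c => simp [RBModule.iota, BPoly.mono, Finsupp.mapDomain_single]

theorem RBModule.isRBNF_of_mem_iota (f : RBModule k Z) {m : BWord Z}
    (hm : m ∈ BPoly.supp (RBModule.iota f)) : ∃ w ∈ f.support, w.1 = m := by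
  classical
  rw [BPoly.supp, RBModule.coeff_iota] at hm
  simpa using Finsupp.mapDomain_support hm

theorem BPoly.mem_supp_mono {w m : BWord Z} (hm : m ∈ BPoly.supp (BPoly.mono w : BPoly k Z)) :
    m = w := by
  simpa using Finsupp.support_single_subset hm

theorem BPoly.mem_supp_mono_mul {w m : BWord Z} {f : BPoly k Z}
    (hm : m ∈ BPoly.supp (BPoly.mono w * f)) : ∃ n ∈ BPoly.supp f, m = w * n := by
  classical
  have h := MonoidAlgebra.support_coeff_single_mul_subset f 1 w hm
  obtain ⟨n, hn, rfl⟩ := Finset.mem_image.1 h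
  exact ⟨n, hn, rfl⟩

theorem BPoly.mem_supp_mul_mono {w m : BWord Z} {f : BPoly k Z}
    (hm : m ∈ BPoly.supp (f * BPoly.mono w)) : ∃ n ∈ BPoly.supp f, m = n * w := by
  classical
  have h := MonoidAlgebra.support_coeff_mul_single_subset f 1 w hm
  obtain ⟨n, hn, rfl⟩ := Finset.mem_image.1 h
  exact ⟨n, hn, rfl⟩

theorem isRBNF_of_mem_diamondWord (B : BPoly k (Fin 2)) (Red : BPoly k Z →ₗ[k] RBModule k Z)
    {v : BWord Z} (hv : IsRBNF v) : ∀ {u : BWord Z}, IsRBNF u →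
      ∀ m ∈ BPoly.supp (diamondWord B Red u v), IsRBNF m
  | .nil, _, m, hm => by
    rw [diamondWord] at hm
    rwa [BPoly.mem_supp_mono hm]
  | .letter z u, hu, m, hm => by
    rw [diamondWord] at hm
    obtain ⟨n, hn, rfl⟩ := BPoly.mem_supp_mono_mul hm
    exact isRBNF_letter.2 (isRBNF_of_mem_diamondWord B Red hv (isRBNF_letter.1 hu) n hn)
  | .bracket p .nil, hu, m, hm => by
    have hp := (isRBNF_bracket.1 hu).1
    match v, hv with
    | .nil, _ =>
      rw [diamondWord] at hm
      · rw [BPoly.mem_supp_mono hm]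
        exact hu
      · rintro _ _ ⟨⟩
    | .letter z v', hv =>
      rw [diamondWord] at hm
      · rw [BPoly.mem_supp_mono hm]
        exact isRBNF_bracket.2 ⟨hp, hv, by rintro _ _ ⟨⟩⟩
      · rintro _ _ ⟨⟩
    | .bracket q v', hv =>
      rw [diamondWord] at hm
      obtain ⟨n, hn, rfl⟩ := BPoly.mem_supp_mul_mono hm
      obtain ⟨w, hw, rfl⟩ := RBModule.isRBNF_of_mem_iota _ hn
      classical
      obtain ⟨w', -, rfl⟩ := Finset.mem_image.1 (Finsupp.mapDomain_support hw)
      obtain ⟨-, hv', hne⟩ := isRBNF_bracket.1 hv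
      exact isRBNF_bracket.2 ⟨w'.2, hv', hne⟩
  | .bracket p (.letter z u), hu, m, hm => by
    rw [diamondWord] at hm
    obtain ⟨n, hn, rfl⟩ := BPoly.mem_supp_mono_mul hm
    obtain ⟨hp, hzu, -⟩ := isRBNF_bracket.1 hu
    have hn' := isRBNF_of_mem_diamondWord B Red hv hzu n hn
    rw [diamondWord] at hn
    obtain ⟨n', -, rfl⟩ := BPoly.mem_supp_mono_mul hn
    exact isRBNF_bracket.2 ⟨hp, hn', by rintro _ _ ⟨⟩⟩
  | .bracket p (.bracket p' u), hu, m, hm => ((isRBNF_bracket.1 hu).2.2 p' u rfl).elim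

theorem iota_diamondBasis (B : BPoly k (Fin 2)) (Red : BPoly k Z →ₗ[k] RBModule k Z)
    (u v : RBWord Z) : RBModule.iota (diamondBasis B Red u v) = diamondWord B Red u.1 v.1 := by
  have h := isRBNF_of_mem_diamondWord B Red v.2 u.2
  apply MonoidAlgebra.coeff_injective
  rw [RBModule.coeff_iota]
  ext m
  by_cases hm : IsRBNF m
  · exact Finsupp.mapDomain_apply Subtype.val_injective _ (⟨m, hm⟩ : RBWord Z)
  · rw [Finsupp.mapDomain_of_notMem_range]
    · by_contra hne
      exact hm (h m (Finsupp.mem_support_iff.2 (Ne.symm hne)))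
    · rintro ⟨w, rfl⟩
      exact hm w.2

/-- The product `⋄` on `k·ℜ(Z)`: the bilinear extension of `u ⋄ v`. -/
def diamond (B : BPoly k (Fin 2)) (Red : BPoly k Z →ₗ[k] RBModule k Z) :
    RBModule k Z →ₗ[k] RBModule k Z →ₗ[k] RBModule k Z :=
  Finsupp.linearCombination k fun u => Finsupp.linearCombination k fun v => diamondBasis B Red u v

end RBModule

end

/-! The rules q|_{⌊s⌋⌊t⌋} → q|_{⌊B(s,t)⌋} lower words in the monomial order. Following one chosen
rule at each word that is not normal therefore defines a linear map N : k⟪Z⟫ → k·ℜ(Z) that fixes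
normal forms and changes f only by an element of `phiSpan`, the span of all q|_{φ(s,t)}
(`exists_normalForm`). By multilinearity `phiSpan` is the operated ideal of φ. Once N is known to
kill it, N is `Red`, the product is a ⋄ b = N(ιa · ιb), and associativity and the universal property
descend from k⟪Z⟫.

That N(Q|_{φ(s,t)}) = 0 is proved by induction on the word w = Q|_{⌊s⌋⌊t⌋}, by comparing two redexes
of the same word (`criticalPair_of_subst_eq`, `map_criticalPair_iff`). Disjoint redexes commute, and
an overlap ⌊a⌋⌊b⌋⌊c⌋ is settled by condition (4). The hard case is a redex ⌊a⌋⌊b⌋ nested in an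
argument, as in ⌊q|_{⌊a⌋⌊b⌋}⌋⌊c⌋: N has to kill Q|_{⌊B(q|_{φ(a,b)}, c)⌋}. The inner value is a sum ∑
cᵢ qᵢ|_{φ(a,b)} over contexts, but compatibility bounds only the monomials that survive in such a
sum. Different monomials of B can take the same value and cancel, as xy and yx do at u = v, so a
single word Q|_{⌊qᵢ|_{⌊a⌋⌊b⌋}⌋} need not lie below w and induction does not apply term by term.

The remedy is `exists_phiAt_correction`: for fixed s, t there is a linear map Φ that vanishes on all
words that lie below w in the given context, and agrees with N on every q|_{φ(s,t)}. The sum is then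
evaluated through Φ, after cancellation, and gives 0. Φ is built from the rule for ⌊s⌋⌊t⌋ alone,
with prescribed defects, by a Newman-type argument (`exists_correction`). For s ≠ t this rule has no
overlaps. For s = t the overlap ⌊s⌋⌊s⌋⌊s⌋ produces the commutator of ⌊B(s,s)⌋ and ⌊s⌋. It is
adjoined as a second rule, condition (4) controls the value of N on it, and the new overlaps are
resolved by the identity `commAt_syzygy`.

Adjoining the commutator requires its leading coefficient to act invertibly on the module M of
ambiguities, the normal forms r with ιr in `phiSpan`. This is arranged by changing the ring. B is
defined over a finitely generated, hence Noetherian, subring. By Noetherian induction normal forms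
may be assumed modulo every nonzero ideal, so all coefficients of M lie in every nonzero ideal, and
every scalar acts on M as zero or invertibly (`HasNormalForm.of_reductions`). The resulting normal
form map is carried back to k by extension of scalars. -/

noncomputable section

/-! ### Combinatorics of bracketed words and contexts -/

namespace BWord

variable {Z : Type*}

/-- The number of symbols of a bracketed word. -/
def size : BWord Z → ℕ
  | nil => 0
  | letter _ w => size w + 1
  | bracket u w => size u + size w + 1

@[simp] theorem size_mul (u v : BWord Z) : size (u * v) = size u + size v := by
  induction u with
  | nil => simp [nil_mul, size]
  | letter z w ih => simp [letter_mul, size, ih]; omega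
  | bracket u w _ ih => simp [bracket_mul, size, ih]; omega

@[simp] theorem size_br (u : BWord Z) : size (br u) = size u + 1 := rfl

theorem br_mul (u w : BWord Z) : br u * w = bracket u w := rfl

theorem br_injective : Function.Injective (br : BWord Z → BWord Z) := fun _ _ h => by
  injection h

theorem br_mul_inj {u v w x : BWord Z} : br u * w = br v * x ↔ u = v ∧ w = x := by
  simp [br_mul]

theorem br_inj {u v : BWord Z} : br u = br v ↔ u = v := br_injective.eq_iff

instance : IsLeftCancelMul (BWord Z) where
  mul_left_cancel a b c h := by
    induction a with
    | nil => exact h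
    | letter z w ih => exact ih (by injection h)
    | bracket u w _ ih => exact ih (by injection h)

theorem eq_one_of_mul_eq_self {c y : BWord Z} (h : y = c * y) : c = 1 := by
  have := congrArg size h
  rw [size_mul] at this
  cases c with
  | nil => rfl
  | letter z w => simp [size] at this
  | bracket u w => simp [size] at this

/-- Levi's lemma: two factorizations of a word have a common refinement. -/
theorem levi {l₁ x l₂ y : BWord Z} (h : l₁ * x = l₂ * y) :
    (∃ c, l₂ = l₁ * c ∧ x = c * y) ∨ ∃ c, l₁ = l₂ * c ∧ y = c * x := by
  induction l₁ generalizing l₂ with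
  | nil => exact .inl ⟨l₂, rfl, h⟩
  | letter z w ih =>
    cases l₂ with
    | nil => exact .inr ⟨letter z w, rfl, h.symm⟩
    | letter z' w' =>
      injection h with h1 h2
      subst h1
      rcases ih h2 with ⟨c, rfl, hc⟩ | ⟨c, rfl, hc⟩
      exacts [.inl ⟨c, rfl, hc⟩, .inr ⟨c, rfl, hc⟩]
    | bracket u' w' => cases h
  | bracket u w _ ih =>
    cases l₂ with
    | nil => exact .inr ⟨bracket u w, rfl, h.symm⟩
    | letter z' w' => cases h
    | bracket u' w' =>
      injection h with h1 h2
      subst h1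
      rcases ih h2 with ⟨c, rfl, hc⟩ | ⟨c, rfl, hc⟩
      exacts [.inl ⟨c, rfl, hc⟩, .inr ⟨c, rfl, hc⟩]

/-- If a word beginning with a bracket is `c * y`, then `c` is empty or begins with it. -/
theorem br_mul_eq_mul {u w c y : BWord Z} (h : br u * w = c * y) :
    (c = 1 ∧ y = br u * w) ∨ ∃ c', c = br u * c' ∧ w = c' * y := by
  cases c with
  | nil => exact .inl ⟨rfl, h.symm⟩
  | letter z w => cases h
  | bracket u' w' =>
    injection h with h1 h2
    subst h1
    exact .inr ⟨w', rfl, h2⟩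

instance : IsRightCancelMul (BWord Z) where
  mul_right_cancel a b c h := by
    change b * a = c * a at h
    rcases levi h with ⟨d, h1, h2⟩ | ⟨d, h1, h2⟩
    all_goals rw [h1, eq_one_of_mul_eq_self h2, mul_one]

end BWord

namespace StarWord

open BWord

variable {Z : Type*}

/-- Composition of contexts: `(q.comp p).subst u = q.subst (p.subst u)`. -/
def comp : StarWord Z → StarWord Z → StarWord Z
  | star l r, star l' r' => star (l * l') (r' * r)
  | star l r, inside l' q r' => inside (l * l') q (r' * r)
  | inside l q r, p => inside l (comp q p) r

theorem subst_star (l r u : BWord Z) : (star l r).subst u = l * u * r := rfl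

theorem subst_inside (l r u : BWord Z) (q : StarWord Z) :
    (inside l q r).subst u = l * br (q.subst u) * r := rfl

theorem subst_comp (q p : StarWord Z) (u : BWord Z) :
    (q.comp p).subst u = q.subst (p.subst u) := by
  induction q with
  | star l r => cases p <;> simp [comp, subst, mul_assoc]
  | inside l q r ih => simp [comp, subst, ih]

theorem subst_injective (q : StarWord Z) : Function.Injective q.subst := by
  induction q with
  | star l r => exact fun u v h => mul_left_cancel (mul_right_cancel h)
  | inside l q r ih =>
    exact fun u v h => ih (br_injective (mul_left_cancel (mul_right_cancel h)))

theorem size_le_size_subst (q : StarWord Z) (u : BWord Z) : u.size ≤ (q.subst u).size := by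
  induction q with
  | star l r => simp [subst]; omega
  | inside l q r ih => simp [subst]; omega

/-- The context `q * r`. -/
def mulRight (q : StarWord Z) (r : BWord Z) : StarWord Z := (star 1 r).comp q

/-- The context `l * q`. -/
def mulLeft (l : BWord Z) (q : StarWord Z) : StarWord Z := (star l 1).comp q

theorem subst_mulRight (q : StarWord Z) (r u : BWord Z) :
    (q.mulRight r).subst u = q.subst u * r := by
  rw [mulRight, subst_comp, subst_star, one_mul]

theorem subst_mulLeft (q : StarWord Z) (l u : BWord Z) :
    (mulLeft l q).subst u = l * q.subst u := by
  rw [mulLeft, subst_comp, subst_star, mul_one]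

end StarWord

/-! ### Relative positions of two redexes in one word -/

open BWord StarWord in
/-- The possible relative positions of a subword `⌊a₁⌋⌊b₁⌋`, in the context `Q₁`, and of a subword
`⌊a₂⌋⌊b₂⌋`, in the context `Q₂`, of the same word, up to symmetry. -/
inductive CriticalPair {Z : Type*} :
    StarWord Z → BWord Z → BWord Z → StarWord Z → BWord Z → BWord Z → Prop
  | same (Q : StarWord Z) (a b : BWord Z) : CriticalPair Q a b Q a b
  | disjoint (L R : BWord Z → StarWord Z) (h : ∀ x y, (L y).subst x = (R x).subst y)
      (a₁ b₁ a₂ b₂ : BWord Z) :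
      CriticalPair (L (br a₂ * br b₂)) a₁ b₁ (R (br a₁ * br b₁)) a₂ b₂
  | overlap (Q : StarWord Z) (a b c : BWord Z) :
      CriticalPair (Q.comp (star 1 (br c))) a b (Q.comp (star (br a) 1)) b c
  | nestedLeft (Q q : StarWord Z) (b₁ a₂ b₂ : BWord Z) :
      CriticalPair Q (q.subst (br a₂ * br b₂)) b₁ (Q.comp (inside 1 q (br b₁))) a₂ b₂
  | nestedRight (Q q : StarWord Z) (a₁ a₂ b₂ : BWord Z) :
      CriticalPair Q a₁ (q.subst (br a₂ * br b₂)) (Q.comp (inside (br a₁) q 1)) a₂ b₂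

namespace CriticalPair

open BWord StarWord

variable {Z : Type*}

theorem inside {Q₁ Q₂ : StarWord Z} {a₁ b₁ a₂ b₂ : BWord Z}
    (h : CriticalPair Q₁ a₁ b₁ Q₂ a₂ b₂) (l r : BWord Z) :
    CriticalPair (.inside l Q₁ r) a₁ b₁ (.inside l Q₂ r) a₂ b₂ := by
  cases h with
  | same => exact .same _ _ _
  | disjoint L R h =>
    exact .disjoint (fun y => .inside l (L y) r) (fun x => .inside l (R x) r)
      (fun x y => by simp [subst_inside, h]) _ _ _ _
  | overlap Q => exact .overlap (.inside l Q r) _ _ _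
  | nestedLeft => exact .nestedLeft (.inside l Q₁ r) _ _ _ _
  | nestedRight => exact .nestedRight (.inside l Q₁ r) _ _ _ _

/-- Subwords at disjoint positions `p₁` and `p₂` of a product. -/
theorem disjoint_mul (p₁ p₂ : StarWord Z) (a₁ b₁ a₂ b₂ : BWord Z) :
    CriticalPair (p₁.mulRight (p₂.subst (br a₂ * br b₂))) a₁ b₁
      (mulLeft (p₁.subst (br a₁ * br b₁)) p₂) a₂ b₂ :=
  .disjoint (fun y => p₁.mulRight (p₂.subst y)) (fun x => mulLeft (p₁.subst x) p₂)
    (fun x y => by rw [subst_mulRight, subst_mulLeft]) _ _ _ _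

/-- The second redex starts c factors after the first. An empty c gives the same redex, one bracket
gives an overlap, and two or more brackets give disjoint redexes. -/
theorem of_star_star {l₁ r₁ c r₂ a₁ b₁ a₂ b₂ : BWord Z}
    (h : br a₁ * br b₁ * r₁ = c * (br a₂ * br b₂ * r₂)) :
    CriticalPair (star l₁ r₁) a₁ b₁ (star (l₁ * c) r₂) a₂ b₂ := by
  rw [mul_assoc] at h
  rcases br_mul_eq_mul h with ⟨rfl, h'⟩ | ⟨c, rfl, h'⟩ <;> clear h <;> rename' h' => h
  · rw [mul_assoc, br_mul_inj, br_mul_inj] at h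
    obtain ⟨rfl, rfl, rfl⟩ := h
    rw [mul_one]
    exact .same _ _ _
  rcases br_mul_eq_mul h with ⟨rfl, h'⟩ | ⟨c, rfl, h'⟩ <;> clear h <;> rename' h' => h
  · rw [mul_assoc, br_mul_inj] at h
    obtain ⟨rfl, rfl⟩ := h
    simpa [comp] using overlap (star l₁ r₂) a₁ a₂ b₂
  · subst h
    simpa [mulRight, mulLeft, comp, subst_star, mul_assoc] using
      disjoint_mul (star l₁ 1) (star c r₂) a₁ b₁ a₂ b₂

/-- The bracket that contains the second redex is the left bracket of the first, its right bracket,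
or lies to the right of both. -/
theorem of_star_inside {l₁ r₁ c r₂ a₁ b₁ a₂ b₂ : BWord Z} {q : StarWord Z}
    (h : br a₁ * br b₁ * r₁ = c * (br (q.subst (br a₂ * br b₂)) * r₂)) :
    CriticalPair (star l₁ r₁) a₁ b₁ (.inside (l₁ * c) q r₂) a₂ b₂ := by
  rw [mul_assoc] at h
  rcases br_mul_eq_mul h with ⟨rfl, h'⟩ | ⟨c, rfl, h'⟩ <;> clear h <;> rename' h' => h
  · rw [br_mul_inj] at h
    obtain ⟨rfl, rfl⟩ := h
    simpa [comp] using nestedLeft (star l₁ r₁) q b₁ a₂ b₂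
  rcases br_mul_eq_mul h with ⟨rfl, h'⟩ | ⟨c, rfl, h'⟩ <;> clear h <;> rename' h' => h
  · rw [br_mul_inj] at h
    obtain ⟨rfl, rfl⟩ := h
    simpa [comp] using nestedRight (star l₁ r₂) q a₁ a₂ b₂
  · subst h
    simpa [mulRight, mulLeft, comp, subst_star, subst_inside, mul_assoc] using
      disjoint_mul (star l₁ 1) (.inside c q r₂) a₁ b₁ a₂ b₂

theorem of_inside_star {l₂ r₁ c r₂ a₁ b₁ a₂ b₂ : BWord Z} {q : StarWord Z}
    (h : br (q.subst (br a₂ * br b₂)) * r₂ = c * (br a₁ * br b₁ * r₁)) :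
    CriticalPair (star (l₂ * c) r₁) a₁ b₁ (.inside l₂ q r₂) a₂ b₂ ∨
      CriticalPair (.inside l₂ q r₂) a₂ b₂ (star (l₂ * c) r₁) a₁ b₁ := by
  rcases br_mul_eq_mul h with ⟨rfl, h'⟩ | ⟨c, rfl, h'⟩ <;> clear h <;> rename' h' => h
  · rw [mul_one]
    left
    simpa using of_star_inside (l₁ := l₂) (c := 1) (h.trans (one_mul _).symm)
  · right
    subst h
    simpa [mulRight, mulLeft, comp, subst_star, subst_inside, mul_assoc] using
      disjoint_mul (.inside l₂ q 1) (star c r₁) a₂ b₂ a₁ b₁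

theorem of_inside_inside {l₁ r₁ c r₂ a₁ b₁ a₂ b₂ : BWord Z} {q₁ q₂ : StarWord Z}
    (ih : q₁.subst (br a₁ * br b₁) = q₂.subst (br a₂ * br b₂) →
      CriticalPair q₁ a₁ b₁ q₂ a₂ b₂ ∨ CriticalPair q₂ a₂ b₂ q₁ a₁ b₁)
    (h : br (q₁.subst (br a₁ * br b₁)) * r₁ = c * (br (q₂.subst (br a₂ * br b₂)) * r₂)) :
    CriticalPair (.inside l₁ q₁ r₁) a₁ b₁ (.inside (l₁ * c) q₂ r₂) a₂ b₂ ∨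
      CriticalPair (.inside (l₁ * c) q₂ r₂) a₂ b₂ (.inside l₁ q₁ r₁) a₁ b₁ := by
  rcases br_mul_eq_mul h with ⟨rfl, h'⟩ | ⟨c, rfl, h'⟩ <;> clear h <;> rename' h' => h
  · rw [br_mul_inj] at h
    obtain ⟨h, rfl⟩ := h
    rw [mul_one]
    exact (ih h.symm).imp (fun h => h.inside _ _) fun h => h.inside _ _
  · left
    subst h
    simpa [mulRight, mulLeft, comp, subst_star, subst_inside, mul_assoc] using
      disjoint_mul (.inside l₁ q₁ 1) (.inside c q₂ r₂) a₁ b₁ a₂ b₂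

end CriticalPair

-- Levi's lemma decides at the outermost level which redex, or which bracket containing it, begins
-- first. If both sit in the same bracket, induction continues inside it.
open BWord StarWord CriticalPair in
theorem criticalPair_of_subst_eq {Z : Type*} {Q₁ Q₂ : StarWord Z} {a₁ b₁ a₂ b₂ : BWord Z}
    (h : Q₁.subst (br a₁ * br b₁) = Q₂.subst (br a₂ * br b₂)) :
    CriticalPair Q₁ a₁ b₁ Q₂ a₂ b₂ ∨ CriticalPair Q₂ a₂ b₂ Q₁ a₁ b₁ := by
  induction Q₁ generalizing Q₂ with
  | star l₁ r₁ =>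
    cases Q₂ with
    | star l₂ r₂ =>
      rw [subst_star, subst_star, mul_assoc, mul_assoc l₂] at h
      rcases levi h with ⟨c, rfl, h'⟩ | ⟨c, rfl, h'⟩ <;> clear h <;> rename' h' => h
      · exact .inl (of_star_star h)
      · exact .inr (of_star_star h)
    | inside l₂ q₂ r₂ =>
      rw [subst_star, subst_inside, mul_assoc, mul_assoc l₂] at h
      rcases levi h with ⟨c, rfl, h'⟩ | ⟨c, rfl, h'⟩ <;> clear h <;> rename' h' => h
      · exact .inl (of_star_inside h)
      · exact of_inside_star h
  | inside l₁ q₁ r₁ ih =>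
    cases Q₂ with
    | star l₂ r₂ =>
      rw [subst_star, subst_inside, mul_assoc, mul_assoc l₂] at h
      rcases levi h with ⟨c, rfl, h'⟩ | ⟨c, rfl, h'⟩ <;> clear h <;> rename' h' => h
      · exact (of_inside_star h).symm
      · exact .inr (of_star_inside h)
    | inside l₂ q₂ r₂ =>
      rw [subst_inside, subst_inside, mul_assoc, mul_assoc l₂] at h
      rcases levi h with ⟨c, rfl, h'⟩ | ⟨c, rfl, h'⟩ <;> clear h <;> rename' h' => h
      · exact of_inside_inside ih h
      · exact (of_inside_inside (fun h => (ih h.symm).symm) h).symm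

/-! ### Monomial orders -/

namespace BPoly.IsMonomialOrder

open BWord

variable {Z : Type*} {lt : BWord Z → BWord Z → Prop} (h : IsMonomialOrder lt)
include h

theorem wf : WellFounded lt := h.isWellOrder.wf

theorem trans {u v w : BWord Z} (huv : lt u v) (hvw : lt v w) : lt u w :=
  by
  have := h.isWellOrder
  exact _root_.trans huv hvw

theorem irrefl (u : BWord Z) : ¬ lt u u := by
  have := h.isWellOrder
  exact _root_.irrefl u

theorem trichotomous (u v : BWord Z) : lt u v ∨ u = v ∨ lt v u := by
  have := h.isWellOrder
  exact trichotomous_of lt u v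

/-- Otherwise u > Q|_u > Q|_{Q|_u} > ⋯ would descend forever. -/
theorem not_subst_lt (Q : StarWord Z) (u : BWord Z) : ¬ lt (Q.subst u) u := by
  induction u using h.wf.induction with
  | _ u ih => exact fun hu => ih _ hu (h.subst_lt Q _ _ hu)

theorem lt_subst (Q : StarWord Z) {u : BWord Z} (hu : u ≠ Q.subst u) : lt u (Q.subst u) :=
  (h.trichotomous u (Q.subst u)).resolve_right fun h' =>
    h'.elim hu (h.not_subst_lt Q u)

theorem lt_of_subst_lt {Q : StarWord Z} {u v : BWord Z} (huv : lt (Q.subst u) (Q.subst v)) :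
    lt u v := by
  rcases h.trichotomous u v with h1 | rfl | h1
  · exact h1
  · exact (h.irrefl _ huv).elim
  · exact (h.irrefl _ (h.trans huv (h.subst_lt Q _ _ h1))).elim

theorem mul_right_lt {u v : BWord Z} (huv : lt u v) (r : BWord Z) : lt (u * r) (v * r) := by
  simpa [StarWord.subst_star] using h.subst_lt (.star 1 r) _ _ huv

theorem mul_left_lt {u v : BWord Z} (huv : lt u v) (l : BWord Z) : lt (l * u) (l * v) := by
  simpa [StarWord.subst_star] using h.subst_lt (.star l 1) _ _ huv

end BPoly.IsMonomialOrder

/-! ### Linear algebra of bracketed polynomials -/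

namespace BPoly

variable {k : Type*} [CommRing k] {Z : Type*} {V : Type*} [AddCommGroup V] [Module k V]

theorem mono_eq_single (w : BWord Z) : (mono w : BPoly k Z) = MonoidAlgebra.single w 1 := rfl

theorem mono_mul (u v : BWord Z) : (mono (u * v) : BPoly k Z) = mono u * mono v :=
  map_mul _ _ _

theorem mono_one : (mono 1 : BPoly k Z) = 1 := map_one _

theorem subst_mono (q : StarWord Z) (w : BWord Z) :
    subst q (mono w : BPoly k Z) = mono (q.subst w) :=
  MonoidAlgebra.mapDomainLinearMap_single ..

theorem br_mono (w : BWord Z) : br (mono w : BPoly k Z) = mono w.br :=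
  MonoidAlgebra.mapDomainLinearMap_single ..

/-- Linear maps that agree on monomials are equal. -/
theorem linearMap_ext {f g : BPoly k Z →ₗ[k] V} (h : ∀ w, f (mono w) = g (mono w)) : f = g :=
  MonoidAlgebra.lhom_ext' fun w => LinearMap.ext_ring (h w)

theorem linearMap_apply_eq (T : BPoly k Z →ₗ[k] V) (f : BPoly k Z) :
    T f = f.coeff.sum fun w c => c • T (mono w) := by
  conv_lhs => rw [← MonoidAlgebra.sum_coeff_single f]
  rw [Finsupp.sum, map_sum, Finsupp.sum]
  refine Finset.sum_congr rfl fun w _ => ?_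
  rw [← map_smul, mono_eq_single, MonoidAlgebra.smul_single, smul_eq_mul, mul_one]

/-- The linear extension of a function on words. -/
def lin (φ : BWord Z → V) : BPoly k Z →ₗ[k] V :=
  Finsupp.linearCombination k φ ∘ₗ (MonoidAlgebra.coeffLinearEquiv k).toLinearMap

theorem lin_mono (φ : BWord Z → V) (w : BWord Z) : lin φ (mono w : BPoly k Z) = φ w := by
  simp [lin, mono_eq_single]

theorem map_eq_zero_of_forall {T : BPoly k Z →ₗ[k] V} {f : BPoly k Z}
    (h : ∀ w, f.coeff w • T (mono w) = 0) : T f = 0 := by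
  rw [linearMap_apply_eq]
  exact Finset.sum_eq_zero fun w _ => h w

theorem mem_supp {f : BPoly k Z} {w : BWord Z} : w ∈ supp f ↔ f.coeff w ≠ 0 :=
  Finsupp.mem_support_iff

theorem coeff_subst (q : StarWord Z) (f : BPoly k Z) (w : BWord Z) :
    (subst q f).coeff (q.subst w) = f.coeff w := by
  rw [subst, MonoidAlgebra.coeff_mapDomainLinearMap]
  exact Finsupp.mapDomain_apply q.subst_injective _ _

theorem exists_of_mem_supp_subst {q : StarWord Z} {f : BPoly k Z} {w : BWord Z}
    (h : w ∈ supp (subst q f)) : ∃ n, n ∈ supp f ∧ w = q.subst n := by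
  classical
  rw [supp, subst, MonoidAlgebra.coeff_mapDomainLinearMap] at h
  obtain ⟨n, hn, rfl⟩ := Finset.mem_image.1 (Finsupp.mapDomain_support h)
  exact ⟨n, hn, rfl⟩

theorem br_eq_subst : (br : BPoly k Z →ₗ[k] _) = subst (.inside 1 (.star 1 1) 1) :=
  linearMap_ext fun w => by simp [br_mono, subst_mono, StarWord.subst]

theorem coeff_br (f : BPoly k Z) (w : BWord Z) : (br f).coeff w.br = f.coeff w := by
  have := coeff_subst (k := k) (.inside 1 (.star 1 1) 1) f w
  rwa [← br_eq_subst, StarWord.subst_inside, StarWord.subst_star, one_mul, mul_one, one_mul,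
    mul_one] at this

theorem exists_of_mem_supp_br {f : BPoly k Z} {w : BWord Z}
    (h : w ∈ supp (br f)) : ∃ n, n ∈ supp f ∧ w = n.br := by
  rw [br_eq_subst] at h
  simpa [StarWord.subst] using exists_of_mem_supp_subst h

theorem subst_comp (q p : StarWord Z) (f : BPoly k Z) :
    subst (q.comp p) f = subst q (subst p f) := by
  have : subst (q.comp p) = (subst q).comp (subst (k := k) p) :=
    linearMap_ext fun w => by simp [subst_mono, StarWord.subst_comp]
  rw [this, LinearMap.comp_apply]

theorem subst_star (l r : BWord Z) (f : BPoly k Z) :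
    subst (.star l r) f = mono l * f * mono r := by
  have : subst (.star l r) =
      (LinearMap.mulRight k (mono r)).comp (LinearMap.mulLeft k (mono l : BPoly k Z)) :=
    linearMap_ext fun w => by simp [subst_mono, StarWord.subst, mono_mul]
  rw [this, LinearMap.comp_apply, LinearMap.mulLeft_apply, LinearMap.mulRight_apply]

theorem subst_inside (l r : BWord Z) (q : StarWord Z) (f : BPoly k Z) :
    subst (.inside l q r) f = mono l * br (subst q f) * mono r := by
  have : subst (.inside l q r) =
      (LinearMap.mulRight k (mono r)).comp ((LinearMap.mulLeft k (mono l : BPoly k Z)).comp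
        (br.comp (subst q))) :=
    linearMap_ext fun w => by simp [subst_mono, StarWord.subst, mono_mul, br_mono]
  rw [this, LinearMap.comp_apply, LinearMap.comp_apply, LinearMap.comp_apply,
    LinearMap.mulLeft_apply, LinearMap.mulRight_apply]

end BPoly

/-! ### Evaluation of totally linear expressions -/

namespace BWord

variable {k : Type*} [CommRing k] {X : Type*} {R : Type*} [Ring R] [Algebra k R]

theorem eval_letter {M : Type*} [Monoid M] (P : M → M) (r : X → M) (z : X) (w : BWord X) :
    eval P r (letter z w) = r z * eval P r w := rfl

theorem eval_bracket {M : Type*} [Monoid M] (P : M → M) (r : X → M) (u w : BWord X) :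
    eval P r (bracket u w) = P (eval P r u) * eval P r w := rfl

theorem map_eval {M N : Type*} [Monoid M] [Monoid N] (P : M → M) (Q : N → N) (f : M →* N)
    (hf : ∀ a, f (P a) = Q (f a)) (r : X → M) (m : BWord X) :
    f (eval P r m) = eval Q (f ∘ r) m := by
  induction m with
  | nil => exact map_one f
  | letter z w ih => rw [eval_letter, eval_letter, map_mul, ih, Function.comp_apply]
  | bracket u w ihu ihw => rw [eval_bracket, eval_bracket, map_mul, hf, ihu, ihw]

variable [DecidableEq X]

theorem eval_update_of_count_eq_zero {M : Type*} [Monoid M] (P : M → M) (r : X → M) (z : X)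
    {m : BWord X} (hm : m.count z = 0) (a : M) :
    eval P (Function.update r z a) m = eval P r m := by
  induction m with
  | nil => rfl
  | letter z' w ih =>
    simp only [count, Nat.add_eq_zero_iff, ite_eq_right_iff, one_ne_zero, imp_false] at hm
    rw [eval_letter, eval_letter, ih hm.2, Function.update_of_ne hm.1]
  | bracket u w ihu ihw =>
    simp only [count, Nat.add_eq_zero_iff] at hm
    rw [eval_bracket, eval_bracket, ihu hm.1, ihw hm.2]

/-- The unique occurrence of z is reached through products by constants and applications of P, all
of which are linear. -/
theorem eval_update_of_count_eq_one (P : R →ₗ[k] R) (r : X → R) (z : X)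
    {m : BWord X} (hm : m.count z = 1) :
    ∃ T : R →ₗ[k] R, ∀ a, eval P (Function.update r z a) m = T a := by
  induction m with
  | nil => simp [count] at hm
  | letter z' w ih =>
    by_cases hz : z' = z
    · subst hz
      simp only [count, if_true] at hm
      refine ⟨LinearMap.mulRight k (eval P r w), fun a => ?_⟩
      rw [eval_letter, eval_update_of_count_eq_zero _ _ _ (by omega), Function.update_self,
        LinearMap.mulRight_apply]
    · simp only [count, if_neg hz, zero_add] at hm
      obtain ⟨T, hT⟩ := ih hm
      refine ⟨(LinearMap.mulLeft k (r z')).comp T, fun a => ?_⟩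
      rw [eval_letter, hT, Function.update_of_ne hz]
      rfl
  | bracket u w ihu ihw =>
    simp only [count] at hm
    rcases Nat.add_eq_one_iff.1 hm with ⟨hu, hw⟩ | ⟨hu, hw⟩
    · obtain ⟨T, hT⟩ := ihw hw
      refine ⟨(LinearMap.mulLeft k (P (eval P r u))).comp T, fun a => ?_⟩
      rw [eval_bracket, hT, eval_update_of_count_eq_zero _ _ _ hu]
      rfl
    · obtain ⟨T, hT⟩ := ihu hu
      refine ⟨(LinearMap.mulRight k (eval P r w)).comp (P.comp T), fun a => ?_⟩
      rw [eval_bracket, hT, eval_update_of_count_eq_zero _ _ _ hw]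
      rfl

theorem exists_starWord {Z : Type*} (r : X → BWord Z) (z : X) {m : BWord X}
    (hm : m.count z = 1) :
    ∃ q : StarWord Z, ∀ a, eval br (Function.update r z a) m = q.subst a := by
  induction m with
  | nil => simp [count] at hm
  | letter z' w ih =>
    by_cases hz : z' = z
    · subst hz
      simp only [count, if_true] at hm
      refine ⟨.star 1 (eval br r w), fun a => ?_⟩
      rw [eval_letter, eval_update_of_count_eq_zero _ _ _ (by omega), Function.update_self,
        StarWord.subst_star, one_mul]
    · simp only [count, if_neg hz, zero_add] at hm
      obtain ⟨q, hq⟩ := ih hm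
      refine ⟨q.mulLeft (r z'), fun a => ?_⟩
      rw [eval_letter, hq, Function.update_of_ne hz, StarWord.subst_mulLeft]
  | bracket u w ihu ihw =>
    simp only [count] at hm
    rcases Nat.add_eq_one_iff.1 hm with ⟨hu, hw⟩ | ⟨hu, hw⟩
    · obtain ⟨q, hq⟩ := ihw hw
      refine ⟨q.mulLeft (br (eval br r u)), fun a => ?_⟩
      rw [eval_bracket, hq, eval_update_of_count_eq_zero _ _ _ hu, StarWord.subst_mulLeft]
    · obtain ⟨q, hq⟩ := ihu hu
      refine ⟨.inside 1 q (eval br r w), fun a => ?_⟩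
      rw [eval_bracket, hq, eval_update_of_count_eq_zero _ _ _ hw, StarWord.subst_inside, one_mul]

end BWord

namespace BPoly

variable {k : Type*} [CommRing k] {Z : Type*}

section Eval

variable {R : Type*} [Ring R] [Algebra k R] {X : Type*}

theorem eval_apply (P : R →ₗ[k] R) (r : X → R) (f : BPoly k X) :
    eval P r f = f.coeff.sum fun m c => c • BWord.eval P r m :=
  MonoidAlgebra.lift_apply ..

theorem eval_mono (P : R →ₗ[k] R) (r : X → R) (w : BWord X) :
    eval P r (mono w) = BWord.eval P r w :=
  MonoidAlgebra.lift_of ..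

theorem eval_br (P : R →ₗ[k] R) (r : X → R) (f : BPoly k X) :
    eval P r (br f) = P (eval P r f) := by
  have : (eval P r).toLinearMap.comp br = P.comp (eval P r).toLinearMap :=
    linearMap_ext fun w => by
      simp only [LinearMap.comp_apply, br_mono, AlgHom.toLinearMap_apply, eval_mono]
      exact mul_one _
  exact LinearMap.congr_fun this f

/-- A morphism of operated algebras commutes with evaluations. -/
theorem map_eval {S : Type*} [Ring S] [Algebra k S] {P : R →ₗ[k] R} {Q : S →ₗ[k] S}
    (g : R →ₐ[k] S) (hg : ∀ a, g (P a) = Q (g a)) (r : X → R) (f : BPoly k X) :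
    g (eval P r f) = eval Q (g ∘ r) f := by
  classical
  have : g.toLinearMap.comp (eval P r).toLinearMap = (eval Q (g ∘ r)).toLinearMap :=
    linearMap_ext fun w => by
      simp only [LinearMap.comp_apply, AlgHom.toLinearMap_apply, eval_mono]
      exact BWord.map_eval P Q g hg r w
  exact LinearMap.congr_fun this f

variable {B : BPoly k (Fin 2)}

theorem isLinearMap_eval_update [DecidableEq X] {f : BPoly k X} (hf : IsTotallyLinear f)
    (P : R →ₗ[k] R) (r : X → R) (z : X) :
    IsLinearMap k fun a => eval P (Function.update r z a) f := by
  have key : ∀ m ∈ supp f, ∃ T : R →ₗ[k] R, ∀ a,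
      BWord.eval P (Function.update r z a) m = T a := fun m hm =>
    BWord.eval_update_of_count_eq_one P r z (hf m hm z)
  choose! T hT using key
  have : ∀ a, eval P (Function.update r z a) f = (f.coeff.sum fun m c => c • T m) a := by
    intro a
    rw [eval_apply, Finsupp.sum, Finsupp.sum, LinearMap.sum_apply]
    exact Finset.sum_congr rfl fun m hm => by rw [hT m hm, LinearMap.smul_apply]
  simp only [this]
  exact LinearMap.isLinear _

/-- For a totally linear `B`, the value `B(a, b)` is bilinear in `a` and `b`. -/
def bilin (hB : IsTotallyLinear B) (P : R →ₗ[k] R) : R →ₗ[k] R →ₗ[k] R :=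
  have h0 (b : R) : IsLinearMap k fun a => eval₂ B P a b := by
    convert isLinearMap_eval_update hB P ![0, b] 0 using 2 with a
    refine congrArg (fun r => eval P r B) ?_
    funext i
    fin_cases i <;> simp
  have h1 (a : R) : IsLinearMap k fun b => eval₂ B P a b := by
    convert isLinearMap_eval_update hB P ![a, 0] 1 using 2 with b
    refine congrArg (fun r => eval P r B) ?_
    funext i
    fin_cases i <;> simp
  LinearMap.mk₂ k (eval₂ B P) (fun a a' b => (h0 b).map_add a a')
    (fun c a b => (h0 b).map_smul c a) (fun a b b' => (h1 a).map_add b b')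
    (fun c a b => (h1 a).map_smul c b)

end Eval

variable {B : BPoly k (Fin 2)}

theorem eval_br_mono {X : Type*} (r : X → BWord Z) (m : BWord X) :
    BWord.eval br (fun x => (mono (r x) : BPoly k Z)) m = mono (BWord.eval BWord.br r m) := by
  classical
  exact (BWord.map_eval BWord.br br (MonoidAlgebra.of k (BWord Z))
    (fun w => (br_mono w).symm) r m).symm

/-- The value of a linear combination of contexts. -/
def starSubst (𝔅 : StarWord Z →₀ k) : BPoly k Z →ₗ[k] BPoly k Z :=
  𝔅.sum fun q c => c • subst q

theorem starSubst_apply (𝔅 : StarWord Z →₀ k) (f : BPoly k Z) :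
    starSubst 𝔅 f = 𝔅.sum fun q c => c • subst q f :=
  LinearMap.sum_apply ..

/-- Each monomial of f contributes one context, with ⋆ in place of its unique z. The combination 𝔅
is formal: distinct contexts stay apart even if their values at a particular word a coincide and
cancel. -/
theorem exists_starSubst {X : Type*} [DecidableEq X] {f : BPoly k X} (hf : IsTotallyLinear f)
    (r : X → BWord Z) (z : X) (q : StarWord Z) :
    ∃ 𝔅 : StarWord Z →₀ k, ∀ a : BWord Z,
      eval br (fun x => (mono (Function.update r z (q.subst a) x) : BPoly k Z)) f =
        starSubst 𝔅 (mono a) := by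
  have key : ∀ m ∈ supp f, ∃ p : StarWord Z, ∀ a,
      BWord.eval BWord.br (Function.update r z a) m = p.subst a := fun m hm =>
    BWord.exists_starWord r z (hf m hm z)
  have : Nonempty (StarWord Z) := ⟨q⟩
  choose! p hp using key
  refine ⟨f.coeff.sum fun m c => Finsupp.single ((p m).comp q) c, fun a => ?_⟩
  rw [eval_apply, starSubst_apply, Finsupp.sum_sum_index (by simp) (by simp [add_smul])]
  refine Finset.sum_congr rfl fun m hm => ?_
  simp only [eval_br_mono]
  rw [hp m hm, Finsupp.sum_single_index (by simp), subst_mono, StarWord.subst_comp]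

theorem exists_starSubst_left (hB : IsTotallyLinear B) (q : StarWord Z) (v : BWord Z) :
    ∃ 𝔅 : StarWord Z →₀ k, ∀ a : BWord Z,
      eval₂ B br (mono (q.subst a)) (mono v) = starSubst 𝔅 (mono a) := by
  obtain ⟨𝔅, h⟩ := exists_starSubst hB ![1, v] 0 q
  refine ⟨𝔅, fun a => ?_⟩
  rw [← h, eval₂]
  congr 2
  ext i : 1
  fin_cases i <;> simp

theorem exists_starSubst_right (hB : IsTotallyLinear B) (u : BWord Z) (q : StarWord Z) :
    ∃ 𝔅 : StarWord Z →₀ k, ∀ a : BWord Z,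
      eval₂ B br (mono u) (mono (q.subst a)) = starSubst 𝔅 (mono a) := by
  obtain ⟨𝔅, h⟩ := exists_starSubst hB ![u, 1] 1 q
  refine ⟨𝔅, fun a => ?_⟩
  rw [← h, eval₂]
  congr 2
  ext i : 1
  fin_cases i <;> simp

/-- The bracketed polynomial `⌊B(s, t)⌋`. -/
def red (B : BPoly k (Fin 2)) (s t : BWord Z) : BPoly k Z := br (eval₂ B br (mono s) (mono t))

/-- The bracketed polynomial `φ(s, t) = ⌊s⌋⌊t⌋ - ⌊B(s, t)⌋`. -/
def phiAt (B : BPoly k (Fin 2)) (s t : BWord Z) : BPoly k Z := mono (s.br * t.br) - red B s t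

/-- The span of all `q|_{φ(s, t)}`. -/
def phiSpan (B : BPoly k (Fin 2)) (Z : Type*) : Submodule k (BPoly k Z) :=
  Submodule.span k {f | ∃ Q s t, f = subst Q (phiAt B s t)}

theorem subst_phiAt_mem (B : BPoly k (Fin 2)) (Q : StarWord Z) (s t : BWord Z) :
    subst Q (phiAt B s t) ∈ phiSpan B Z :=
  Submodule.subset_span ⟨Q, s, t, rfl⟩

/-! ### Linear maps defined by rewriting rules -/

section Steps

variable {V : Type*} [AddCommGroup V] [Module k V]

/-- A form of Newman's diamond lemma: a locally confluent system of affine rules `X → r + c` with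
values in a module `V` is satisfied by a linear map to `V`. -/
theorem exists_linearMap_of_steps {lt : BWord Z → BWord Z → Prop} (wf : WellFounded lt)
    (step : BWord Z → BPoly k Z → V → Prop) (base : BWord Z → V)
    (hsupp : ∀ X r c, step X r c → ∀ m, lt m X ∨ ∀ v : V, r.coeff m • v = 0)
    (hconf : ∀ (X : BWord Z) (Φ : BPoly k Z →ₗ[k] V),
      (∀ Y r c, lt Y X → step Y r c → Φ (mono Y) = Φ r + c) →
      ∀ r c r' c', step X r c → step X r' c' → Φ (mono X) = Φ r + c → Φ (mono X) = Φ r' + c') :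
    ∃ Φ : BPoly k Z →ₗ[k] V, (∀ X r c, step X r c → Φ (mono X) = Φ r + c) ∧
      ∀ X, (∀ r c, ¬ step X r c) → Φ (mono X) = base X := by
  classical
  -- Recursion along one chosen rule per word. The default 0 is harmless: by `hsupp` the coefficient
  -- of a monomial that is not below X kills V.
  let F (X : BWord Z) (φ : ∀ Y, lt Y X → V) : V :=
    if h : ∃ rc : BPoly k Z × V, step X rc.1 rc.2 then
      (h.choose.1.coeff.sum fun m a => a • if hm : lt m X then φ m hm else 0) + h.choose.2
    else base X
  have hfix (X : BWord Z) : wf.fix F X = F X fun Y _ => wf.fix F Y := wf.fix_eq F X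
  have hchosen (X : BWord Z) (h : ∃ rc : BPoly k Z × V, step X rc.1 rc.2) :
      lin (wf.fix F) (mono X : BPoly k Z) = lin (wf.fix F) h.choose.1 + h.choose.2 := by
    rw [lin_mono, hfix, linearMap_apply_eq]
    simp only [F, dif_pos h]
    congr 1
    refine Finset.sum_congr rfl fun m _ => ?_
    rcases hsupp X _ _ h.choose_spec m with hm | hm
    · simp only [dif_pos hm, lin_mono]
    · simp only [hm]
  refine ⟨lin (wf.fix F), fun X => ?_, fun X hX => ?_⟩
  · induction X using wf.induction with
    | _ X ih =>
      intro r c hrc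
      have h : ∃ rc : BPoly k Z × V, step X rc.1 rc.2 := ⟨(r, c), hrc⟩
      -- The chosen rule holds by construction, and local confluence carries this over to any other
      -- rule at X.
      exact hconf X _ (fun Y r c hY => ih Y hY r c) _ _ _ _ h.choose_spec hrc (hchosen X h)
  · rw [lin_mono, hfix]
    exact dif_neg fun ⟨rc, h⟩ => hX _ _ h

end Steps

theorem red_lt {lt : BWord Z → BWord Z → Prop} (hcomp : IsCompatible B lt) {s t m : BWord Z}
    (hm : m ∈ supp (red B s t)) : lt m (s.br * t.br) := hcomp s t m hm

theorem iota_single (w : RBWord Z) (c : k) :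
    RBModule.iota (Finsupp.single w c) = c • (mono w.1 : BPoly k Z) := by
  simp [RBModule.iota]

/-- A normal form map that follows one chosen rewriting of each monomial. -/
theorem exists_normalForm {lt : BWord Z → BWord Z → Prop} (hlt : IsMonomialOrder lt)
    (hcomp : IsCompatible B lt) :
    ∃ N : BPoly k Z →ₗ[k] RBModule k Z, (∀ r, N (RBModule.iota r) = r) ∧
      (∀ f, f - RBModule.iota (N f) ∈ phiSpan B Z) ∧
      ∀ X : BWord Z, ¬ IsRBNF X → ∃ (Q : StarWord Z) (s t : BWord Z),
        X = Q.subst (s.br * t.br) ∧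
        N (subst Q (phiAt B s t)) = 0 := by
  classical
  have hch : ∀ X : BWord Z, ∃ (Q : StarWord Z) (s t : BWord Z),
      ¬ IsRBNF X → X = Q.subst (s.br * t.br) := by
    intro X
    by_cases hX : IsRBNF X
    · exact ⟨.star 1 1, 1, 1, fun h => (h hX).elim⟩
    · obtain ⟨Q, s, t, h⟩ := not_not.1 hX
      exact ⟨Q, s, t, fun _ => h⟩
  choose Q s t hQ using hch
  have hsub (X : BWord Z) (hX : ¬ IsRBNF X) (m : BWord Z)
      (hm : m ∈ supp (subst (Q X) (red B (s X) (t X)))) : lt m X := by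
    obtain ⟨n, hn, rfl⟩ := exists_of_mem_supp_subst hm
    conv_rhs => rw [hQ X hX]
    exact hlt.subst_lt _ _ _ (red_lt hcomp hn)
  obtain ⟨N, hN, hN'⟩ := exists_linearMap_of_steps (k := k) (V := RBModule k Z) hlt.wf
    (fun X r c => ¬ IsRBNF X ∧ r = subst (Q X) (red B (s X) (t X)) ∧ c = 0)
    (fun X => if h : IsRBNF X then Finsupp.single ⟨X, h⟩ 1 else 0)
    (by
      rintro X _ _ ⟨hX, rfl, rfl⟩ m
      by_cases hm : m ∈ supp (subst (Q X) (red B (s X) (t X)))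
      · exact .inl (hsub X hX m hm)
      · exact .inr fun v => by rw [not_not.1 (mt mem_supp.2 hm), zero_smul])
    -- Confluence is trivial here, as each word has at most one rule.
    (by rintro X Φ - _ _ _ _ ⟨-, rfl, rfl⟩ ⟨-, rfl, rfl⟩ h; exact h)
  have hnf (X : BWord Z) (h : IsRBNF X) : N (mono X) = Finsupp.single ⟨X, h⟩ 1 := by
    rw [hN' X fun r c h' => h'.1 h, dif_pos h]
  have hred (X : BWord Z) (h : ¬ IsRBNF X) :
      N (mono X) = N (subst (Q X) (red B (s X) (t X))) := by
    simpa using hN X _ _ ⟨h, rfl, rfl⟩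
  refine ⟨N, fun r => ?_, fun f => ?_, fun X hX => ⟨Q X, s X, t X, hQ X hX, ?_⟩⟩
  · induction r using Finsupp.induction_linear with
    | zero => simp
    | add f g hf hg => rw [map_add, map_add, hf, hg]
    | single w c => rw [iota_single, map_smul, hnf w.1 w.2]; simp
  · have hmono (X : BWord Z) : mono X - RBModule.iota (N (mono X)) ∈ phiSpan B Z := by
      induction X using hlt.wf.induction with
      | _ X ih =>
        by_cases hX : IsRBNF X
        · rw [hnf X hX, iota_single, one_smul, sub_self]
          exact zero_mem _
        · have key : ∀ f : BPoly k Z, (∀ m ∈ supp f, lt m X) →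
              f - RBModule.iota (N f) ∈ phiSpan B Z := by
            intro f hf
            have : f - RBModule.iota (N f) =
              (LinearMap.id - RBModule.iota.comp N : BPoly k Z →ₗ[k] BPoly k Z) f := rfl
            rw [this, linearMap_apply_eq]
            exact Submodule.sum_mem _ fun m hm =>
              Submodule.smul_mem _ _ (ih m (hf m hm))
          have h1 := key _ (hsub X hX)
          have h2 := subst_phiAt_mem B (Q X) (s X) (t X)
          rw [phiAt, map_sub, subst_mono, ← hQ X hX] at h2
          rw [hred X hX]
          convert add_mem h1 h2 using 1
          abel
    have : f - RBModule.iota (N f) =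
      (LinearMap.id - RBModule.iota.comp N : BPoly k Z →ₗ[k] BPoly k Z) f := rfl
    rw [this, linearMap_apply_eq]
    exact Submodule.sum_mem _ fun m _ => Submodule.smul_mem _ _ (hmono m)
  · rw [phiAt, map_sub, map_sub, subst_mono, ← hQ X hX, hred X hX, sub_self]

end BPoly

/-! ### Reductions under linear maps, and the correction lemma -/

namespace BPoly

open BWord

variable {k : Type*} [CommRing k] {Z : Type*} {B : BPoly k (Fin 2)}
  {V : Type*} [AddCommGroup V] [Module k V] {lt : BWord Z → BWord Z → Prop}

theorem rewrites_iff {f g : BPoly k Z} : Rewrites B f g ↔ ∃ (Q : StarWord Z) (s t : BWord Z),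
    Q.subst (s.br * t.br) ∈ supp f ∧
      g = f - f.coeff (Q.subst (s.br * t.br)) • subst Q (phiAt B s t) := by
  refine exists₃_congr fun Q s t => and_congr_right fun _ => ?_
  rw [phiAt, map_sub, subst_mono, smul_sub, red, sub_sub_eq_add_sub, add_sub_right_comm]

theorem eq_or_mem_supp_red {Q : StarWord Z} {s t m : BWord Z}
    (hm : (subst Q (phiAt B s t)).coeff m ≠ 0) :
    m = Q.subst (s.br * t.br) ∨ ∃ n ∈ supp (red B s t), m = Q.subst n := by
  classical
  by_contra! h
  rw [phiAt, map_sub, subst_mono, MonoidAlgebra.coeff_sub, Finsupp.sub_apply] at hm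
  apply hm
  rw [mono_eq_single, MonoidAlgebra.coeff_single, Finsupp.single_eq_of_ne h.1, zero_sub,
    neg_eq_zero]
  by_contra h'
  obtain ⟨n, hn, rfl⟩ := exists_of_mem_supp_subst (mem_supp.2 h')
  exact h.2 n hn rfl

theorem coeff_phiAt_lt (hcomp : IsCompatible B lt) {s t y : BWord Z}
    (hy : y ≠ s.br * t.br) (h : (phiAt B s t).coeff y ≠ 0) : lt y (s.br * t.br) := by
  have := eq_or_mem_supp_red (B := B) (Q := .star 1 1) (s := s) (t := t) (m := y)
  simp only [subst_star, mono_one, one_mul, mul_one, StarWord.subst_star] at this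
  rcases this h with h | ⟨n, hn, rfl⟩
  · exact (hy h).elim
  · exact red_lt hcomp hn

theorem coeff_phiAt_self (hlt : IsMonomialOrder lt) (hcomp : IsCompatible B lt) (s t : BWord Z) :
    (phiAt B s t).coeff (s.br * t.br) = 1 := by
  have : (red B s t).coeff (s.br * t.br) = 0 := by
    by_contra h
    exact hlt.irrefl _ (red_lt hcomp (mem_supp.2 h))
  rw [phiAt, MonoidAlgebra.coeff_sub, Finsupp.sub_apply, this, mono_eq_single,
    MonoidAlgebra.coeff_single, Finsupp.single_eq_same, sub_zero]

/-- A linear map takes the same value on `f` and on its reductions, if it respects the rewriting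
rules on a set `S` that contains the monomials of `f`, up to coefficients in an ideal `𝔪`. -/
theorem map_eq_of_reduces {Ψ : BPoly k Z →ₗ[k] V} {S : BWord Z → Prop} {𝔪 : Ideal k}
    (hS : ∀ (Q : StarWord Z) (s t : BWord Z), S (Q.subst (s.br * t.br)) →
      ∀ n ∈ supp (red B s t), S (Q.subst n))
    (hΨ : ∀ (Q : StarWord Z) (s t : BWord Z), S (Q.subst (s.br * t.br)) →
      Ψ (subst Q (phiAt B s t)) = 0)
    (h𝔪 : ∀ a ∈ 𝔪, ∀ (Q : StarWord Z) (s t : BWord Z), a • Ψ (subst Q (phiAt B s t)) = 0)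
    {f g : BPoly k Z} (h : Reduces B f g) (hf : ∀ m, S m ∨ f.coeff m ∈ 𝔪) : Ψ f = Ψ g := by
  induction h using Relation.ReflTransGen.head_induction_on with
  | refl => rfl
  | @head f f' hff' _ ih =>
    obtain ⟨Q, s, t, -, rfl⟩ := rewrites_iff.1 hff'
    rw [← ih, map_sub, map_smul]
    -- The reduction may act on words outside S, but only with a coefficient in 𝔪, and such a
    -- coefficient kills the change of Ψ. Both alternatives persist along the reduction: S is closed
    -- under the rules, and 𝔪 under multiples and differences.
    · rcases hf (Q.subst (s.br * t.br)) with h | h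
      · rw [hΨ _ _ _ h, smul_zero, sub_zero]
      · rw [h𝔪 _ h, sub_zero]
    · intro m
      by_cases hm : (subst Q (phiAt B s t)).coeff m = 0
      · simpa [hm] using hf m
      rcases hf (Q.subst (s.br * t.br)) with h | h
      · rcases eq_or_mem_supp_red hm with rfl | ⟨n, hn, rfl⟩
        · exact .inl h
        · exact .inl (hS _ _ _ h n hn)
      · refine (hf m).imp_right fun h' => ?_
        rw [MonoidAlgebra.coeff_sub, Finsupp.sub_apply, MonoidAlgebra.coeff_smul_apply]
        exact sub_mem h' (𝔪.mul_mem_right _ h)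

/-- L and R are the two one-hole views of a context with two holes; both sides are the value of Ψ on
that context filled with f and g, summed in either order. -/
theorem lin_subst_comm (Ψ : BPoly k Z →ₗ[k] V) {L R : BWord Z → StarWord Z}
    (h : ∀ x y, (L y).subst x = (R x).subst y) (f g : BPoly k Z) :
    lin (fun y => Ψ (subst (L y) f)) g = lin (fun x => Ψ (subst (R x) g)) f := by
  have h1 (f : BPoly k Z) (Q : StarWord Z) :
      Ψ (subst Q f) = f.coeff.sum fun x c => c • Ψ (mono (Q.subst x)) := by
    simpa [subst_mono] using linearMap_apply_eq (Ψ.comp (subst Q)) f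
  rw [linearMap_apply_eq, linearMap_apply_eq]
  simp only [lin_mono, h1, Finsupp.smul_sum]
  rw [Finsupp.sum_comm]
  exact Finset.sum_congr rfl fun x _ => Finset.sum_congr rfl fun y _ => by
    dsimp only; rw [h, smul_comm]

/-- A linear map takes on `f` the value given by the only term of `f` that matters. -/
theorem map_eq_smul_of_forall_ne {T : BPoly k Z →ₗ[k] V} {f : BPoly k Z} {x : BWord Z}
    (h : ∀ y ≠ x, f.coeff y • T (mono y) = 0) : T f = f.coeff x • T (mono x) := by
  rw [linearMap_apply_eq, Finsupp.sum]
  refine Finset.sum_eq_single x (fun y _ hy => h y hy) fun hx => ?_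
  rw [Finsupp.notMem_support_iff.1 hx, zero_smul]

/-- Filling two holes with p₁ and p₂ and expanding either factor first gives the same value. When
only the term x₂ of p₂ and the term x₁ of p₁ contribute, the two redexes at x₁ and x₂ are compared.
-/
theorem smul_map_subst_eq_of_disjoint {Ψ : BPoly k Z →ₗ[k] V} {L R : BWord Z → StarWord Z}
    (h : ∀ x y, (L y).subst x = (R x).subst y) {p₁ p₂ : BPoly k Z} {x₁ x₂ : BWord Z}
    (h₁ : ∀ y ≠ x₂, p₂.coeff y • Ψ (subst (L y) p₁) = 0)
    (h₂ : ∀ x ≠ x₁, p₁.coeff x • Ψ (subst (R x) p₂) = 0) :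
    p₂.coeff x₂ • Ψ (subst (L x₂) p₁) = p₁.coeff x₁ • Ψ (subst (R x₁) p₂) := by
  have := lin_subst_comm Ψ h p₁ p₂
  rwa [map_eq_smul_of_forall_ne (f := p₂) (x := x₂) (by simpa only [lin_mono] using h₁),
    map_eq_smul_of_forall_ne (f := p₁) (x := x₁) (by simpa only [lin_mono] using h₂), lin_mono,
    lin_mono] at this

/-- A system of rules `⌊a⌋⌊b⌋ → ⌊a⌋⌊b⌋ - u p`, whose overlaps are resolved, defines a correction
`Φ` with values in `M` of a linear map `F`, such that `F - Φ` is zero on all `q|_p`. -/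
theorem exists_correction (hlt : IsMonomialOrder lt) {M : Submodule k V} {F : BPoly k Z →ₗ[k] V}
    {S : BWord Z → Prop} {rule : BWord Z → BWord Z → BPoly k Z → Prop}
    (hlead : ∀ a b p, rule a b p → ∀ y ≠ a.br * b.br,
      lt y (a.br * b.br) ∨ p.coeff y ∈ M.annihilator)
    (hunit : ∀ a b p, rule a b p → ∃ u : k, ∀ m ∈ M, (u * p.coeff (a.br * b.br)) • m = m)
    (hF : ∀ a b p, rule a b p → ∀ Q, F (subst Q p) ∈ M)
    (hS : ∀ X Y, lt Y X → S X → S Y)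
    (hFS : ∀ a b p, rule a b p → ∀ Q : StarWord Z, S (Q.subst (a.br * b.br)) → F (subst Q p) = 0)
    (hfun : ∀ a b p p', rule a b p → rule a b p' → p = p')
    (hnest : ∀ a b p a' b' p', rule a b p → rule a' b' p' → ∀ q : StarWord Z,
      a ≠ q.subst (a'.br * b'.br) ∧ b ≠ q.subst (a'.br * b'.br))
    (hover : ∀ (a b c : BWord Z) (p p' : BPoly k Z), rule a b p → rule b c p' →
      ∀ (Q : StarWord Z) (Φ : BPoly k Z →ₗ[k] M),
        (∀ (a' b' : BWord Z) (p' : BPoly k Z), rule a' b' p' → ∀ Q' : StarWord Z,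
          lt (Q'.subst (a'.br * b'.br)) (Q.subst (a.br * b.br * c.br)) →
            F (subst Q' p') = Φ (subst Q' p')) →
        (F (subst Q (p * mono c.br)) = Φ (subst Q (p * mono c.br)) ↔
          F (subst Q (mono a.br * p')) = Φ (subst Q (mono a.br * p')))) :
    ∃ Φ : BPoly k Z →ₗ[k] M, (∀ X, S X → Φ (mono X) = 0) ∧
      ∀ a b p, rule a b p → ∀ Q, F (subst Q p) = Φ (subst Q p) := by
  -- The relation F = Φ on Q|_p, solved for the leading word of p: u inverts the leading coefficient
  -- on M, and u F(Q|_p) is the affine term.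
  let step (X : BWord Z) (r : BPoly k Z) (c : M) : Prop := ∃ a b p u Q, rule a b p ∧
    X = StarWord.subst Q (a.br * b.br) ∧ (∀ m ∈ M, (u * p.coeff (a.br * b.br)) • m = m) ∧
    r = subst Q (mono (a.br * b.br) - u • p) ∧ (c : V) = u • F (subst Q p)
  have hstep {Φ : BPoly k Z →ₗ[k] M} {a b : BWord Z} {p : BPoly k Z} {u : k} {Q : StarWord Z}
      {c : M} (hr : rule a b p) (hu : ∀ m ∈ M, (u * p.coeff (a.br * b.br)) • m = m)
      (hc : (c : V) = u • F (subst Q p)) :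
      Φ (mono (Q.subst (a.br * b.br))) = Φ (subst Q (mono (a.br * b.br) - u • p)) + c ↔
        F (subst Q p) = Φ (subst Q p) := by
    rw [map_sub, subst_mono, map_sub, map_smul, map_smul, eq_comm, sub_add, sub_eq_self,
      sub_eq_zero, ← Subtype.coe_inj, hc, Submodule.coe_smul, eq_comm]
    refine ⟨fun h => ?_, fun h => by rw [h]⟩
    -- Multiplication by the leading coefficient undoes u, because both values lie in M.
    have := congrArg (fun x => p.coeff (a.br * b.br) • x) h
    simp only [smul_smul] at this
    rwa [mul_comm, hu _ (hF _ _ _ hr Q), hu _ (Φ (subst Q p)).2] at this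
  have hsupp : ∀ X r c, step X r c → ∀ m, lt m X ∨ ∀ v : M, r.coeff m • v = 0 := by
    rintro _ _ c ⟨a, b, p, u, Q, hr, rfl, hu, rfl, hc⟩ m
    by_cases hm : m ∈ supp (subst Q (mono (a.br * b.br) - u • p))
    · obtain ⟨n, -, rfl⟩ := exists_of_mem_supp_subst hm
      rw [coeff_subst, MonoidAlgebra.coeff_sub, Finsupp.sub_apply, MonoidAlgebra.coeff_smul_apply,
        mono_eq_single, MonoidAlgebra.coeff_single]
      by_cases hn : n = a.br * b.br
      -- The leading word need not disappear from r, but its coefficient 1 - u · (leading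
      -- coefficient) acts on M as zero.
      · refine .inr fun v => Subtype.ext ?_
        rw [hn, Finsupp.single_eq_same, sub_smul, smul_eq_mul]
        simpa [sub_eq_zero] using (hu v v.2).symm
      · rcases hlead _ _ _ hr n hn with h | h
        · exact .inl (hlt.subst_lt _ _ _ h)
        · refine .inr fun v => Subtype.ext ?_
          rw [Finsupp.single_eq_of_ne hn, zero_sub, neg_smul, smul_assoc]
          have := Submodule.mem_annihilator.1 h v v.2
          simp [this]
    · exact .inr fun v => by rw [not_not.1 (mt mem_supp.2 hm), zero_smul]
  have hcrit (X : BWord Z) (Φ : BPoly k Z →ₗ[k] M)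
      (hX : ∀ a b p, rule a b p → ∀ Q : StarWord Z, lt (Q.subst (a.br * b.br)) X →
        F (subst Q p) = Φ (subst Q p)) (Q₁ a₁ b₁ p₁ Q₂ a₂ b₂ p₂) (hr₁ : rule a₁ b₁ p₁)
      (hr₂ : rule a₂ b₂ p₂) (hQ : X = Q₁.subst (a₁.br * b₁.br))
      (hcp : CriticalPair Q₁ a₁ b₁ Q₂ a₂ b₂) :
      F (subst Q₁ p₁) = Φ (subst Q₁ p₁) ↔ F (subst Q₂ p₂) = Φ (subst Q₂ p₂) := by
    cases hcp with
    | same => rw [hfun _ _ _ _ hr₁ hr₂]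
    | nestedLeft Q q => exact ((hnest _ _ _ _ _ _ hr₁ hr₂ q).1 rfl).elim
    | nestedRight Q q => exact ((hnest _ _ _ _ _ _ hr₁ hr₂ q).2 rfl).elim
    | overlap Q =>
      have := hover _ _ _ _ _ hr₁ hr₂ Q Φ (by
        intro a b p hr Q' hQ'
        refine hX a b p hr Q' ?_
        rwa [hQ, StarWord.subst_comp, StarWord.subst_star, one_mul])
      rwa [subst_comp, subst_comp, subst_star, subst_star, mono_one, one_mul, mul_one]
    | disjoint L R h =>
      obtain ⟨u₁, hu₁⟩ := hunit _ _ _ hr₁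
      obtain ⟨u₂, hu₂⟩ := hunit _ _ _ hr₂
      -- Ψ is the defect. On all but the leading terms it vanishes by `hX`, or is killed by a
      -- coefficient that annihilates M; so the two defects differ by factors that are invertible on
      -- M.
      let Ψ : BPoly k Z →ₗ[k] V := F - M.subtype.comp Φ
      have hΨ (f : BPoly k Z) : Ψ f = F f - Φ f := rfl
      have hΨM {a b : BWord Z} {p : BPoly k Z} (hr : rule a b p) (Q : StarWord Z) :
          Ψ (subst Q p) ∈ M := sub_mem (hF _ _ _ hr Q) (Φ _).2
      rw [← sub_eq_zero, ← hΨ, ← sub_eq_zero (a := F (subst (R _) p₂)), ← hΨ]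
      have key := smul_map_subst_eq_of_disjoint (Ψ := Ψ) h (p₁ := p₁) (p₂ := p₂)
        (x₁ := a₁.br * b₁.br) (x₂ := a₂.br * b₂.br)
        (by
          intro y hy
          rcases hlead _ _ _ hr₂ y hy with h' | h'
          · rw [hΨ, hX _ _ _ hr₁, sub_self, smul_zero]
            rw [hQ, h, h]
            exact hlt.subst_lt _ _ _ h'
          · exact Submodule.mem_annihilator.1 h' _ (hΨM hr₁ _))
        (by
          intro x hx
          rcases hlead _ _ _ hr₁ x hx with h' | h'
          · rw [hΨ, hX _ _ _ hr₂, sub_self, smul_zero]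
            rw [hQ, ← h]
            exact hlt.subst_lt _ _ _ h'
          · exact Submodule.mem_annihilator.1 h' _ (hΨM hr₂ _))
      constructor
      · intro h0
        rw [← hu₁ _ (hΨM hr₂ _), mul_smul, ← key, h0, smul_zero, smul_zero]
      · intro h0
        rw [← hu₂ _ (hΨM hr₁ _), mul_smul, key, h0, smul_zero, smul_zero]
  obtain ⟨Φ, hΦ, hΦ0⟩ := exists_linearMap_of_steps (k := k) (V := M) hlt.wf step (fun _ => 0) hsupp
    (by
      rintro X Φ hX _ c _ c' ⟨a₀, b₀, p, u, Q, hr, rfl, hu, rfl, hc⟩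
        ⟨a', b', p', u', Q', hr', hQ', hu', rfl, hc'⟩ h
      rw [hstep hr hu hc] at h
      rw [hQ', hstep hr' hu' hc']
      have hX' : ∀ a b p, rule a b p → ∀ Q₁ : StarWord Z,
          lt (Q₁.subst (a.br * b.br)) (Q.subst (a₀.br * b₀.br)) → F (subst Q₁ p) = Φ (subst Q₁ p) := by
        intro a b p hr Q hlt'
        obtain ⟨u, hu⟩ := hunit a b p hr
        exact (hstep hr hu (c := ⟨_, M.smul_mem u (hF _ _ _ hr Q)⟩) rfl).1
          (hX _ _ _ hlt' ⟨a, b, p, u, Q, hr, rfl, hu, rfl, rfl⟩)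
      rcases criticalPair_of_subst_eq hQ' with hcp | hcp
      · exact (hcrit _ Φ hX' _ _ _ _ _ _ _ _ hr hr' rfl hcp).1 h
      · exact (hcrit _ Φ hX' _ _ _ _ _ _ _ _ hr' hr hQ' hcp).2 h)
  refine ⟨Φ, fun X => ?_, fun a b p hr Q => ?_⟩
  · induction X using hlt.wf.induction with
    | _ X ih =>
      intro hSX
      -- On S every affine term is zero and the base value is zero, so Φ vanishes there by
      -- induction.
      by_cases hX : ∃ r c, step X r c
      · obtain ⟨r, c, h⟩ := hX
        have hc : c = 0 := by
          obtain ⟨a, b, p, u, Q, hr, rfl, hu, rfl, hc⟩ := h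
          rw [hFS _ _ _ hr Q hSX, smul_zero] at hc
          exact Subtype.ext hc
        rw [hΦ _ _ _ h, hc, add_zero]
        refine map_eq_zero_of_forall fun m => ?_
        rcases hsupp _ _ _ h m with hm | hm
        · rw [ih m hm (hS _ _ hm hSX), smul_zero]
        · exact hm _
      · exact hΦ0 X fun r c h => hX ⟨r, c, h⟩
  · obtain ⟨u, hu⟩ := hunit a b p hr
    exact (hstep hr hu (c := ⟨_, M.smul_mem u (hF _ _ _ hr Q)⟩) rfl).1
      (hΦ _ _ _ ⟨a, b, p, u, Q, hr, rfl, hu, rfl, rfl⟩)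

end BPoly

/-! ### The commutator of ⌊B(s, s)⌋ and ⌊s⌋ -/

namespace BPoly

open BWord

variable {k : Type*} [CommRing k] {Z : Type*} {B : BPoly k (Fin 2)}
  {V : Type*} [AddCommGroup V] [Module k V] {lt : BWord Z → BWord Z → Prop}

theorem coeff_mul_mono (f : BPoly k Z) (v w : BWord Z) :
    (f * mono w).coeff (v * w) = f.coeff v := by
  have := coeff_subst (.star 1 w) f v
  rwa [subst_star, StarWord.subst_star, mono_one, one_mul, one_mul] at this

theorem coeff_mono_mul (f : BPoly k Z) (v w : BWord Z) :
    (mono w * f).coeff (w * v) = f.coeff v := by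
  have := coeff_subst (.star w 1) f v
  rwa [subst_star, StarWord.subst_star, mono_one, mul_one, mul_one] at this

theorem subst_mul_mono (Q : StarWord Z) (f : BPoly k Z) (w : BWord Z) :
    subst Q (f * mono w) = subst (Q.comp (.star 1 w)) f := by
  rw [subst_comp, subst_star, mono_one, one_mul]

theorem subst_mono_mul (Q : StarWord Z) (f : BPoly k Z) (w : BWord Z) :
    subst Q (mono w * f) = subst (Q.comp (.star w 1)) f := by
  rw [subst_comp, subst_star, mono_one, mul_one]

theorem subst_mem_phiSpan {f : BPoly k Z} (hf : f ∈ phiSpan B Z) (Q : StarWord Z) :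
    subst Q f ∈ phiSpan B Z := by
  induction hf using Submodule.span_induction with
  | mem x h =>
    obtain ⟨Q', s, t, rfl⟩ := h
    rw [← subst_comp]
    exact subst_phiAt_mem B _ s t
  | zero => simp
  | add x y _ _ hx hy => rw [map_add]; exact add_mem hx hy
  | smul c x _ hx => rw [map_smul]; exact Submodule.smul_mem _ _ hx

theorem phiAt_mem (B : BPoly k (Fin 2)) (s t : BWord Z) : phiAt B s t ∈ phiSpan B Z :=
  Submodule.subset_span ⟨.star 1 1, s, t, by rw [subst_star, mono_one, one_mul, mul_one]⟩

theorem mul_mono_mem_phiSpan {f : BPoly k Z} (hf : f ∈ phiSpan B Z) (w : BWord Z) :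
    f * mono w ∈ phiSpan B Z := by
  simpa [subst_star, mono_one] using subst_mem_phiSpan hf (.star 1 w)

theorem mono_mul_mem_phiSpan {f : BPoly k Z} (hf : f ∈ phiSpan B Z) (w : BWord Z) :
    mono w * f ∈ phiSpan B Z := by
  simpa [subst_star, mono_one] using subst_mem_phiSpan hf (.star w 1)

/-- The commutator of `⌊B(s, s)⌋` and `⌊s⌋`, up to sign the S-polynomial of `⌊s⌋⌊s⌋⌊s⌋`. -/
def commAt (B : BPoly k (Fin 2)) (s : BWord Z) : BPoly k Z :=
  red B s s * mono s.br - mono s.br * red B s s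

theorem phiAt_mul_sub (B : BPoly k (Fin 2)) (s : BWord Z) :
    phiAt B s s * mono s.br - mono s.br * phiAt B s s = -commAt B s := by
  rw [phiAt, commAt, mono_mul]
  noncomm_ring

theorem commAt_mem (B : BPoly k (Fin 2)) (s : BWord Z) : commAt B s ∈ phiSpan B Z := by
  rw [← neg_mem_iff, ← phiAt_mul_sub]
  exact sub_mem (mul_mono_mem_phiSpan (phiAt_mem B s s) _)
    (mono_mul_mem_phiSpan (phiAt_mem B s s) _)

/-- With e = ⌊s⌋, g = ⌊B(s,s)⌋, φ = e² - g and z = [g, e], this is the identity ez + ze = [g, e²] =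
[g, φ]. It resolves the overlaps between the rule for φ and the rule for z. -/
theorem commAt_syzygy (B : BPoly k (Fin 2)) (s : BWord Z) :
    mono s.br * commAt B s + phiAt B s s * red B s s + commAt B s * mono s.br
      - red B s s * phiAt B s s = 0 := by
  rw [phiAt, commAt, mono_mul]
  noncomm_ring

/-- For n ≠ s the word ⌊n⌋⌊s⌋ cannot occur in ⌊s⌋⌊B(s,s)⌋, so there is no cancellation. -/
theorem coeff_commAt_left {s n : BWord Z} (h : n ≠ s) :
    (commAt B s).coeff (n.br * s.br) = (red B s s).coeff n.br := by
  rw [commAt, MonoidAlgebra.coeff_sub, Finsupp.sub_apply, coeff_mul_mono, sub_eq_self]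
  by_contra hne
  obtain ⟨m, -, hm⟩ := mem_supp_mono_mul (mem_supp.2 hne)
  exact h (br_mul_inj.1 hm).1

theorem coeff_commAt_right {s n : BWord Z} (h : n ≠ s) :
    (commAt B s).coeff (s.br * n.br) = -(red B s s).coeff n.br := by
  rw [commAt, MonoidAlgebra.coeff_sub, Finsupp.sub_apply, coeff_mono_mul, sub_eq_neg_self]
  by_contra hne
  obtain ⟨m, hm', hm⟩ := mem_supp_mul_mono (mem_supp.2 hne)
  obtain ⟨m, -, rfl⟩ := exists_of_mem_supp_br hm'
  rw [br_mul_inj, br_inj] at hm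
  exact h hm.2

/-- The word ⌊s⌋ of ⌊B(s,s)⌋ commutes with ⌊s⌋, so only words ⌊n⌋ with n ≠ s contribute. -/
theorem exists_of_coeff_commAt_ne_zero {s y : BWord Z} (h : (commAt B s).coeff y ≠ 0) :
    ∃ n, n ≠ s ∧ n.br ∈ supp (red B s s) ∧ (y = n.br * s.br ∨ y = s.br * n.br) := by
  have hy : y ≠ s.br * s.br := by
    rintro rfl
    rw [commAt, MonoidAlgebra.coeff_sub, Finsupp.sub_apply, coeff_mono_mul, coeff_mul_mono,
      sub_self] at h
    exact h rfl
  by_cases h1 : y ∈ supp (red B s s * mono s.br)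
  · obtain ⟨m, hm, rfl⟩ := mem_supp_mul_mono h1
    obtain ⟨n, -, rfl⟩ := exists_of_mem_supp_br hm
    exact ⟨n, by rintro rfl; exact hy rfl, hm, .inl rfl⟩
  · rw [commAt, MonoidAlgebra.coeff_sub, Finsupp.sub_apply, not_not.1 (mt mem_supp.2 h1), zero_sub,
      neg_ne_zero, ← mem_supp] at h
    obtain ⟨m, hm, rfl⟩ := mem_supp_mono_mul h
    obtain ⟨n, -, rfl⟩ := exists_of_mem_supp_br hm
    exact ⟨n, by rintro rfl; exact hy rfl, hm, .inr rfl⟩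

/-- A linear map that respects the rewriting rules below `w`, and modulo `𝔪` all rewriting rules,
vanishes on `q|_z` for the commutator `z`, if `q|_z` is below `w` modulo `𝔪`. -/
theorem map_subst_commAt_eq_zero (hlt : IsMonomialOrder lt) (hcomp : IsCompatible B lt)
    (hB : IsTotallyLinear B) {s : BWord Z}
    (hassoc : Reduces B (eval₂ B br (eval₂ B br (mono s) (mono s)) (mono s)
        - eval₂ B br (mono s) (eval₂ B br (mono s) (mono s)) : BPoly k Z) 0)
    {N : BPoly k Z →ₗ[k] V} {w : BWord Z} {𝔪 : Ideal k}
    (hN : ∀ (Q : StarWord Z) (s t : BWord Z), lt (Q.subst (s.br * t.br)) w →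
      N (subst Q (phiAt B s t)) = 0)
    (h𝔪 : ∀ a ∈ 𝔪, ∀ (Q : StarWord Z) (s t : BWord Z), a • N (subst Q (phiAt B s t)) = 0)
    {Q : StarWord Z} (hz : ∀ y, (commAt B s).coeff y ∈ 𝔪 ∨ lt (Q.subst y) w) :
    N (subst Q (commAt B s)) = 0 := by
  set b : BPoly k Z := eval₂ B br (mono s) (mono s) with hb
  have hcoeff (n : BWord Z) : (red B s s).coeff n.br = b.coeff n := coeff_br b n
  have hn (n : BWord Z) (hne : n ≠ s) : b.coeff n ∈ 𝔪 ∨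
      lt (Q.subst (n.br * s.br)) w ∧ lt (Q.subst (s.br * n.br)) w := by
    have h1 := hz (n.br * s.br)
    have h2 := hz (s.br * n.br)
    rw [coeff_commAt_left hne, hcoeff] at h1
    rw [coeff_commAt_right hne, hcoeff, neg_mem_iff] at h2
    rcases h1 with h1 | h1
    · exact .inl h1
    · exact h2.imp_right fun h2 => ⟨h1, h2⟩
  -- U(b), with b = B(s,s), is the element B(B(s,s),s) - B(s,B(s,s)) of condition (4). Since U(s) =
  -- 0, the word s of b, about which `hz` says nothing, plays no role.
  let U : BPoly k Z →ₗ[k] BPoly k Z := (bilin hB br).flip (mono s) - bilin hB br (mono s)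
  have hU (f : BPoly k Z) : U f = eval₂ B br f (mono s) - eval₂ B br (mono s) f := rfl
  have hUs : U (mono s) = 0 := by rw [hU, sub_self]
  -- replace each commutator `[⌊n⌋, ⌊s⌋]` by the bracket of `B(n, s) - B(s, n)`
  have h1 : N (subst Q (commAt B s)) = N (subst Q (br (U b))) := by
    let T : BPoly k Z →ₗ[k] V := N.comp ((subst Q).comp
      ((LinearMap.mulRight k (mono s.br)).comp br - (LinearMap.mulLeft k (mono s.br)).comp br
        - br.comp U))
    have hT (f : BPoly k Z) :
        T f = N (subst Q (br f * mono s.br - mono s.br * br f - br (U f))) := rfl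
    have : T b = 0 := by
      refine map_eq_zero_of_forall fun n => ?_
      by_cases hne : n = s
      · rw [hT, hne, hUs, map_zero, sub_zero, br_mono, sub_self, map_zero, map_zero, smul_zero]
      have hTn : T (mono n) = N (subst Q (phiAt B n s)) - N (subst Q (phiAt B s n)) := by
        rw [hT, hU, phiAt, phiAt, br_mono, mono_mul, mono_mul, red, red]
        simp only [map_sub]
        abel
      rw [hTn]
      rcases hn n hne with h | ⟨h1, h2⟩
      · rw [smul_sub, h𝔪 _ h, h𝔪 _ h, sub_zero]
      · rw [hN _ _ _ h1, hN _ _ _ h2, sub_zero, smul_zero]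
    rw [hT, map_sub, map_sub, sub_eq_zero] at this
    exact this
  have hins (Q' : StarWord Z) (f : BPoly k Z) :
      N.comp ((subst Q).comp br) (subst Q' f) = N (subst (Q.comp (.inside 1 Q' 1)) f) := by
    rw [subst_comp, subst_inside, mono_one, one_mul, mul_one]
    rfl
  have hins' (Q' : StarWord Z) (x : BWord Z) :
      (Q.comp (.inside 1 Q' 1)).subst x = Q.subst (Q'.subst x).br := by
    rw [StarWord.subst_comp, StarWord.subst_inside, one_mul, mul_one]
  rw [h1]
  have := map_eq_of_reduces (Ψ := N.comp ((subst Q).comp br)) (𝔪 := 𝔪)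
    (S := fun m => lt (Q.subst m.br) w)
    (by
      intro Q' s t h n hn
      rw [← hins'] at h ⊢
      exact hlt.trans (hlt.subst_lt _ _ _ (red_lt hcomp hn)) h)
    (by
      intro Q' s t h
      rw [← hins'] at h
      rw [hins, hN _ _ _ h])
    (by
      intro a ha Q' s t
      rw [hins, h𝔪 a ha])
    hassoc
    (by
      intro m
      by_cases hm : lt (Q.subst m.br) w
      · exact .inl hm
      refine .inr ?_
      -- Expand U(b) over the words n of b. If the coefficient of n is not in 𝔪, then ⌊n⌋⌊s⌋ and
      -- ⌊s⌋⌊n⌋ lie below w in the context Q, and by compatibility so does ⌊m⌋ for every m in U(n),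
      -- against the choice of m.
      change (U b).coeff m ∈ 𝔪
      rw [linearMap_apply_eq U b, Finsupp.sum, MonoidAlgebra.coeff_sum, Finsupp.finsetSum_apply]
      refine sum_mem fun n _ => ?_
      rw [MonoidAlgebra.coeff_smul_apply]
      by_cases hne : n = s
      · rw [hne, hUs]
        simp
      rcases hn n hne with h | ⟨h1, h2⟩
      · exact 𝔪.mul_mem_right _ h
      · have : (U (mono n)).coeff m = 0 := by
          have h3 : (eval₂ B br (mono n) (mono s) : BPoly k Z).coeff m = 0 := by
            by_contra h
            rw [← coeff_br] at h
            exact hm (hlt.trans (hlt.subst_lt Q _ _ (red_lt hcomp (mem_supp.2 h))) h1)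
          have h4 : (eval₂ B br (mono s) (mono n) : BPoly k Z).coeff m = 0 := by
            by_contra h
            rw [← coeff_br] at h
            exact hm (hlt.trans (hlt.subst_lt Q _ _ (red_lt hcomp (mem_supp.2 h))) h2)
          rw [hU, MonoidAlgebra.coeff_sub, Finsupp.sub_apply, h3, h4, sub_zero]
        rw [this, smul_zero]
        exact zero_mem _)
  rw [map_zero] at this
  exact this

theorem exists_of_mem_supp_starSubst {𝔅 : StarWord Z →₀ k} {a y : BWord Z}
    (h : y ∈ supp (starSubst 𝔅 (mono a))) : ∃ q ∈ 𝔅.support, y = q.subst a := by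
  by_contra! hne
  rw [mem_supp, starSubst_apply, Finsupp.sum, MonoidAlgebra.coeff_sum, Finsupp.finsetSum_apply] at h
  refine h (Finset.sum_eq_zero fun q hq => ?_)
  rw [MonoidAlgebra.coeff_smul_apply, subst_mono, mono_eq_single, MonoidAlgebra.coeff_single,
    Finsupp.single_eq_of_ne (hne q hq), smul_zero]

/-- By total linearity every word of B(s,s) has the form q|_s, and such a word is s or larger. -/
theorem br_lt_of_mem_supp_red (hlt : IsMonomialOrder lt) (hB : IsTotallyLinear B) {s n : BWord Z}
    (hn : n.br ∈ supp (red B s s)) (hne : n ≠ s) : lt s.br n.br := by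
  obtain ⟨m, hm, h⟩ := exists_of_mem_supp_br hn
  rw [br_inj] at h
  subst h
  obtain ⟨𝔅, h𝔅⟩ := exists_starSubst_left hB (.star 1 1) s
  have := h𝔅 s
  simp only [StarWord.subst_star, one_mul, mul_one] at this
  rw [this] at hm
  obtain ⟨q, -, rfl⟩ := exists_of_mem_supp_starSubst hm
  simpa [StarWord.subst] using
    hlt.subst_lt (.inside 1 (.star 1 1) 1) _ _ (hlt.lt_subst q hne.symm)

theorem IsMonomialOrder.exists_max (hlt : IsMonomialOrder lt) (s : Finset (BWord Z))
    (hs : s.Nonempty) : ∃ m ∈ s, ∀ y ∈ s, y ≠ m → lt y m := by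
  classical
  induction hs using Finset.Nonempty.cons_induction with
  | singleton a => exact ⟨a, by simp, by simp⟩
  | cons a s ha hs ih =>
    obtain ⟨m, hm, h⟩ := ih
    rcases hlt.trichotomous a m with h' | rfl | h'
    · refine ⟨m, by simp [hm], fun y hy hne => ?_⟩
      rcases Finset.mem_cons.1 hy with rfl | hy
      exacts [h', h y hy hne]
    · exact (ha hm).elim
    · refine ⟨a, by simp, fun y hy hne => ?_⟩
      rcases Finset.mem_cons.1 hy with rfl | hy
      · exact (hne rfl).elim
      by_cases hym : y = m
      exacts [hym ▸ h', hlt.trans (h y hy hym) h']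

end BPoly

namespace BWord

variable {Z : Type*}

/-- A word has fewer symbols than any word that properly contains it, so a redex does not sit inside
its own argument. -/
theorem ne_subst_left (a b : BWord Z) (q : StarWord Z) : a ≠ q.subst (a.br * b.br) := fun h => by
  have := q.size_le_size_subst (a.br * b.br)
  rw [← h, size_mul, size_br] at this
  omega

theorem ne_subst_right (a b : BWord Z) (q : StarWord Z) : b ≠ q.subst (a.br * b.br) := fun h => by
  have := q.size_le_size_subst (a.br * b.br)
  rw [← h, size_mul, size_br, size_br] at this
  omega

end BWord

/-! ### Corrections for a single rule ⌊s⌋⌊t⌋ -/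

namespace BPoly

open BWord

variable {k : Type*} [CommRing k] {Z : Type*} {B : BPoly k (Fin 2)}
  {V : Type*} [AddCommGroup V] [Module k V] {lt : BWord Z → BWord Z → Prop}

section Overlap

variable {Ψ : BPoly k Z →ₗ[k] V} {M : Submodule k V} {Q : StarWord Z} {s ν X : BWord Z}

/-- Expand the factor ⌊B(s,s)⌋: a word below ν places the redex ⌊s⌋⌊s⌋ in a word below X, where Ψ
respects the rule, and the remaining coefficients other than that of ν kill M. -/
theorem map_subst_phiAt_mul_red (hΨM : ∀ f ∈ phiSpan B Z, Ψ f ∈ M)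
    (hd : ∀ Q' : StarWord Z, lt (Q'.subst (s.br * s.br)) X → Ψ (subst Q' (phiAt B s s)) = 0)
    (hg : ∀ y ≠ ν, (red B s s).coeff y ∈ M.annihilator ∨ lt y ν)
    (hX : ∀ y, lt y ν → lt (Q.subst (s.br * s.br * y)) X) :
    Ψ (subst Q (phiAt B s s * red B s s)) =
      (red B s s).coeff ν • Ψ (subst Q (phiAt B s s * mono ν)) := by
  refine map_eq_smul_of_forall_ne
    (T := Ψ.comp ((subst Q).comp (LinearMap.mulLeft k (phiAt B s s)))) fun y hy => ?_
  rw [LinearMap.comp_apply, LinearMap.comp_apply, LinearMap.mulLeft_apply]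
  rcases hg y hy with h | h
  · exact Submodule.mem_annihilator.1 h _
      (hΨM _ (subst_mem_phiSpan (mul_mono_mem_phiSpan (phiAt_mem B s s) _) _))
  · rw [subst_mul_mono, hd, smul_zero]
    rw [StarWord.subst_comp, StarWord.subst_star, one_mul]
    exact hX y h

theorem map_subst_red_mul_phiAt (hΨM : ∀ f ∈ phiSpan B Z, Ψ f ∈ M)
    (hd : ∀ Q' : StarWord Z, lt (Q'.subst (s.br * s.br)) X → Ψ (subst Q' (phiAt B s s)) = 0)
    (hg : ∀ y ≠ ν, (red B s s).coeff y ∈ M.annihilator ∨ lt y ν)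
    (hX : ∀ y, lt y ν → lt (Q.subst (y * (s.br * s.br))) X) :
    Ψ (subst Q (red B s s * phiAt B s s)) =
      (red B s s).coeff ν • Ψ (subst Q (mono ν * phiAt B s s)) := by
  refine map_eq_smul_of_forall_ne
    (T := Ψ.comp ((subst Q).comp (LinearMap.mulRight k (phiAt B s s)))) fun y hy => ?_
  rw [LinearMap.comp_apply, LinearMap.comp_apply, LinearMap.mulRight_apply]
  rcases hg y hy with h | h
  · exact Submodule.mem_annihilator.1 h _
      (hΨM _ (subst_mem_phiSpan (mono_mul_mem_phiSpan (phiAt_mem B s s) _) _))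
  · rw [subst_mono_mul, hd, smul_zero]
    rw [StarWord.subst_comp, StarWord.subst_star, mul_one]
    exact hX y h

theorem map_subst_commAt_syzygy (Ψ : BPoly k Z →ₗ[k] V) (Q : StarWord Z) (s : BWord Z) :
    Ψ (subst Q (mono s.br * commAt B s)) + Ψ (subst Q (phiAt B s s * red B s s))
      + Ψ (subst Q (commAt B s * mono s.br)) - Ψ (subst Q (red B s s * phiAt B s s)) = 0 := by
  rw [← map_add, ← map_add, ← map_add, ← map_add, ← map_sub, ← map_sub, commAt_syzygy, map_zero,
    map_zero]

/-- The overlap `⌊s⌋⌊s⌋ν`, where `⌊s⌋ν` is the leading monomial of the commutator. -/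
theorem map_subst_overlap_left (hlt : IsMonomialOrder lt)
    (hΨM : ∀ f ∈ phiSpan B Z, Ψ f ∈ M)
    (hX : X = Q.subst (s.br * s.br * ν))
    (hd : ∀ Q' : StarWord Z, lt (Q'.subst (s.br * s.br)) X → Ψ (subst Q' (phiAt B s s)) = 0)
    (hz : ∀ Q' : StarWord Z, lt (Q'.subst (s.br * ν)) X → Ψ (subst Q' (commAt B s)) = 0)
    (hν : lt (ν * s.br) (s.br * ν))
    (hg : ∀ y ≠ ν, (red B s s).coeff y ∈ M.annihilator ∨ lt y ν) :
    Ψ (subst Q (mono s.br * commAt B s)) =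
      -((red B s s).coeff ν • Ψ (subst Q (phiAt B s s * mono ν))) := by
  have h1 : lt (s.br * ν * s.br) (s.br * s.br * ν) := by
    rw [mul_assoc, mul_assoc]
    exact hlt.mul_left_lt hν _
  have h2 : lt (ν * (s.br * s.br)) (s.br * s.br * ν) := by
    rw [← mul_assoc]
    exact hlt.trans (hlt.mul_right_lt hν _) h1
  -- With g = ⌊B(s,s)⌋ and z the commutator, the four terms have leading words ⌊s⌋⌊s⌋ν for ⌊s⌋z and
  -- φg, ⌊s⌋ν⌊s⌋ for z⌊s⌋, and ν⌊s⌋⌊s⌋ for gφ. The last two are below X, so their terms drop out.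
  have key := map_subst_commAt_syzygy (B := B) Ψ Q s
  rw [map_subst_phiAt_mul_red hΨM hd hg, map_subst_red_mul_phiAt hΨM hd hg,
    subst_mul_mono Q (commAt B s), hz, subst_mono_mul Q (phiAt B s s) ν, hd, smul_zero, sub_zero,
    add_zero] at key
  · exact eq_neg_of_add_eq_zero_left key
  · rw [StarWord.subst_comp, StarWord.subst_star, mul_one, hX]
    exact hlt.subst_lt _ _ _ h2
  · rw [StarWord.subst_comp, StarWord.subst_star, one_mul, hX]
    exact hlt.subst_lt _ _ _ h1
  · intro y hy
    rw [hX]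
    exact hlt.subst_lt _ _ _ (hlt.trans (hlt.mul_right_lt hy _) h2)
  · intro y hy
    rw [hX]
    exact hlt.subst_lt _ _ _ (hlt.mul_left_lt hy _)

/-- The overlap `ν⌊s⌋⌊s⌋`, where `ν⌊s⌋` is the leading monomial of the commutator. -/
theorem map_subst_overlap_right (hlt : IsMonomialOrder lt)
    (hΨM : ∀ f ∈ phiSpan B Z, Ψ f ∈ M)
    (hX : X = Q.subst (ν * s.br * s.br))
    (hd : ∀ Q' : StarWord Z, lt (Q'.subst (s.br * s.br)) X → Ψ (subst Q' (phiAt B s s)) = 0)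
    (hz : ∀ Q' : StarWord Z, lt (Q'.subst (ν * s.br)) X → Ψ (subst Q' (commAt B s)) = 0)
    (hν : lt (s.br * ν) (ν * s.br))
    (hg : ∀ y ≠ ν, (red B s s).coeff y ∈ M.annihilator ∨ lt y ν) :
    Ψ (subst Q (commAt B s * mono s.br)) =
      (red B s s).coeff ν • Ψ (subst Q (mono ν * phiAt B s s)) := by
  have h1 : lt (s.br * (ν * s.br)) (ν * s.br * s.br) := by
    rw [← mul_assoc]
    exact hlt.mul_right_lt hν _
  have h2 : lt (s.br * s.br * ν) (ν * s.br * s.br) := by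
    rw [mul_assoc]
    exact hlt.trans (hlt.mul_left_lt hν _) h1
  have key := map_subst_commAt_syzygy (B := B) Ψ Q s
  rw [map_subst_phiAt_mul_red hΨM hd hg, map_subst_red_mul_phiAt hΨM hd hg,
    subst_mono_mul Q (commAt B s), hz, subst_mul_mono Q (phiAt B s s) ν, hd, smul_zero, zero_add,
    zero_add] at key
  · exact sub_eq_zero.1 key
  · rw [StarWord.subst_comp, StarWord.subst_star, one_mul, hX]
    exact hlt.subst_lt _ _ _ h2
  · rw [StarWord.subst_comp, StarWord.subst_star, mul_one, hX]
    exact hlt.subst_lt _ _ _ h1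
  · intro y hy
    rw [hX, mul_assoc]
    exact hlt.subst_lt _ _ _ (hlt.mul_right_lt hy _)
  · intro y hy
    rw [hX]
    exact hlt.subst_lt _ _ _ (hlt.trans (hlt.mul_left_lt hy _) h2)

end Overlap

section Correction

variable {N : BPoly k Z →ₗ[k] V} {M : Submodule k V} {w : BWord Z}

/-- The case of `exists_phiAt_correction` in which there are no overlaps to consider. -/
theorem exists_phiAt_correction_of_forall (hlt : IsMonomialOrder lt) (hcomp : IsCompatible B lt)
    (hNM : ∀ f ∈ phiSpan B Z, N f ∈ M)
    (hN : ∀ (Q : StarWord Z) (s t : BWord Z), lt (Q.subst (s.br * t.br)) w →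
      N (subst Q (phiAt B s t)) = 0)
    (Q₁ : StarWord Z) (s t : BWord Z)
    (hz : s = t → (∀ Q, N (subst Q (commAt B s)) = 0) ∧
      ∀ y, (commAt B s).coeff y ∈ M.annihilator) :
    ∃ Φ : BPoly k Z →ₗ[k] M, (∀ X, lt (Q₁.subst X) w → Φ (mono X) = 0) ∧
      ∀ Q, N (subst Q₁ (subst Q (phiAt B s t))) = Φ (subst Q (phiAt B s t)) := by
  obtain ⟨Φ, h1, h2⟩ := exists_correction hlt (F := N.comp (subst Q₁)) (M := M)
    (S := fun X => lt (Q₁.subst X) w) (rule := fun a b p => s = a ∧ t = b ∧ p = phiAt B s t)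
    (by
      rintro _ _ _ ⟨rfl, rfl, rfl⟩ y hy
      by_cases h : (phiAt B s t).coeff y = 0
      · exact .inr (h ▸ zero_mem _)
      · exact .inl (coeff_phiAt_lt hcomp hy h))
    (by
      rintro _ _ _ ⟨rfl, rfl, rfl⟩
      exact ⟨1, fun m _ => by rw [coeff_phiAt_self hlt hcomp, one_mul, one_smul]⟩)
    (by
      rintro _ _ _ ⟨rfl, rfl, rfl⟩ Q
      exact hNM _ (subst_mem_phiSpan (subst_phiAt_mem B Q s t) _))
    (fun X Y h hX => hlt.trans (hlt.subst_lt _ _ _ h) hX)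
    (by
      rintro _ _ _ ⟨rfl, rfl, rfl⟩ Q h
      rw [LinearMap.comp_apply, ← subst_comp]
      exact hN _ _ _ (by rwa [StarWord.subst_comp]))
    (by rintro _ _ _ _ ⟨rfl, rfl, rfl⟩ ⟨-, -, rfl⟩; rfl)
    (by
      rintro _ _ _ _ _ _ ⟨rfl, rfl, rfl⟩ ⟨rfl, rfl, rfl⟩ q
      exact ⟨ne_subst_left _ _ _, ne_subst_right _ _ _⟩)
    (by
      rintro _ _ _ _ _ ⟨rfl, rfl, rfl⟩ ⟨rfl, rfl, rfl⟩ Q Φ -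
      -- An overlap forces s = t. The two sides differ by the commutator, which both N and Φ send to
      -- 0.
      obtain ⟨hz1, hz2⟩ := hz rfl
      rw [sub_eq_iff_eq_add.1 (phiAt_mul_sub B _), map_add, map_add, map_add, map_neg, map_neg,
        map_neg, LinearMap.comp_apply, ← subst_comp, hz1, neg_zero, zero_add]
      have : Φ (subst Q (commAt B s)) = 0 := by
        refine map_eq_zero_of_forall (T := Φ.comp (subst Q)) fun y => Subtype.ext ?_
        exact Submodule.mem_annihilator.1 (hz2 y) _ (Φ _).2
      rw [this, neg_zero, zero_add])
  exact ⟨Φ, h1, fun Q => h2 s t _ ⟨rfl, rfl, rfl⟩ Q⟩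

/-- The case of `exists_phiAt_correction` in which the commutator has to be adjoined, with
leading monomial `⌊a⌋⌊b⌋`. -/
theorem exists_phiAt_correction_of_lead (hlt : IsMonomialOrder lt) (hcomp : IsCompatible B lt)
    (hB : IsTotallyLinear B) {s a b : BWord Z}
    (hassoc : Reduces B (eval₂ B br (eval₂ B br (mono s) (mono s)) (mono s)
        - eval₂ B br (mono s) (eval₂ B br (mono s) (mono s)) : BPoly k Z) 0)
    (hNM : ∀ f ∈ phiSpan B Z, N f ∈ M)
    (hunit : ∀ y : k, y ∈ M.annihilator ∨ ∃ c : k, ∀ m ∈ M, (c * y) • m = m)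
    (hN : ∀ (Q : StarWord Z) (s t : BWord Z), lt (Q.subst (s.br * t.br)) w →
      N (subst Q (phiAt B s t)) = 0)
    (Q₁ : StarWord Z)
    (hab : (commAt B s).coeff (a.br * b.br) ∉ M.annihilator)
    (hmax : ∀ y ≠ a.br * b.br, (commAt B s).coeff y ∈ M.annihilator ∨ lt y (a.br * b.br)) :
    ∃ Φ : BPoly k Z →ₗ[k] M, (∀ X, lt (Q₁.subst X) w → Φ (mono X) = 0) ∧
      ∀ Q, N (subst Q₁ (subst Q (phiAt B s s))) = Φ (subst Q (phiAt B s s)) := by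
  obtain ⟨n, hns, hn, hpos⟩ :=
    exists_of_coeff_commAt_ne_zero (B := B) (fun h => hab (h ▸ zero_mem _))
  have hcomm : n.br * s.br ≠ s.br * n.br := fun h => hns (br_mul_inj.1 h).1
  have hlt_e : lt s.br n.br := br_lt_of_mem_supp_red hlt hB hn hns
  have hne : lt n.br (s.br * s.br) := red_lt hcomp hn
  have hgn : (red B s s).coeff n.br ∉ M.annihilator := by
    rcases hpos with h | h
    · rwa [h, coeff_commAt_left hns] at hab
    · rwa [h, coeff_commAt_right hns, neg_mem_iff] at hab
  -- Since ⌊n⌋ is read off from the leading word of the commutator, cancelling ⌊s⌋ compares it with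
  -- the other words of ⌊B(s,s)⌋. The commutator does not see ⌊s⌋ itself, which lies below ⌊n⌋ by
  -- `hlt_e`.
  have hg : ∀ y ≠ n.br, (red B s s).coeff y ∈ M.annihilator ∨ lt y n.br := by
    intro y hy
    by_cases h0 : (red B s s).coeff y = 0
    · exact .inl (h0 ▸ zero_mem _)
    obtain ⟨m, -, rfl⟩ := exists_of_mem_supp_br (mem_supp.2 h0)
    by_cases hm : m = s
    · exact .inr (hm ▸ hlt_e)
    have hmn : m ≠ n := fun h => hy (by rw [h])
    rcases hpos with h | h
    · refine (hmax (m.br * s.br) (by rw [h, Ne, br_mul_inj]; tauto)).imp (fun h' => ?_) fun h' => ?_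
      · rwa [coeff_commAt_left hm] at h'
      · exact hlt.lt_of_subst_lt (Q := .star 1 s.br) (by simpa [StarWord.subst_star, h] using h')
    · refine (hmax (s.br * m.br) (by rw [h, Ne, br_mul_inj, br_inj]; tauto)).imp
        (fun h' => ?_) fun h' => ?_
      · rwa [coeff_commAt_right hm, neg_mem_iff] at h'
      · exact hlt.lt_of_subst_lt (Q := .star s.br 1) (by simpa [StarWord.subst_star, h] using h')
  have hlead_lt : lt (a.br * b.br) (s.br * s.br * s.br) := by
    rcases hpos with h | h
    · exact h ▸ hlt.mul_right_lt hne _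
    · rw [h, mul_assoc]
      exact hlt.mul_left_lt hne _
  -- If n contained ⌊s⌋⌊s⌋, then ⌊n⌋ could not lie below ⌊s⌋⌊s⌋.
  have hnn (q : StarWord Z) : n ≠ q.subst (s.br * s.br) := by
    intro h
    refine hlt.not_subst_lt (.inside 1 q 1) (s.br * s.br) ?_
    rwa [StarWord.subst_inside, one_mul, mul_one, ← h]
  have hab' : (n = a ∧ s = b) ∨ (s = a ∧ n = b) := by
    simpa only [br_mul_inj, br_inj, eq_comm] using hpos
  have hnf (q : StarWord Z) : a ≠ q.subst (s.br * s.br) ∧ b ≠ q.subst (s.br * s.br) := by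
    rcases hab' with ⟨rfl, rfl⟩ | ⟨rfl, rfl⟩
    exacts [⟨hnn q, ne_subst_left _ _ q⟩, ⟨ne_subst_left _ _ q, hnn q⟩]
  have hsab (q : StarWord Z) : s ≠ q.subst (a.br * b.br) := by
    rcases hab' with ⟨rfl, rfl⟩ | ⟨rfl, rfl⟩
    exacts [ne_subst_right _ _ q, ne_subst_left _ _ q]
  obtain ⟨c, hc⟩ := (hunit _).resolve_left hab
  obtain ⟨c', hc'⟩ := (hunit _).resolve_left hgn
  -- Two rules: φ(s,s), led by ⌊s⌋⌊s⌋, and the commutator, led modulo the annihilator of M by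
  -- ⌊a⌋⌊b⌋, which is ⌊n⌋⌊s⌋ or ⌊s⌋⌊n⌋.
  obtain ⟨Φ, h1, h2⟩ := exists_correction hlt (F := N.comp (subst Q₁)) (M := M)
    (S := fun X => lt (Q₁.subst X) w)
    (rule := fun x y p => (s = x ∧ s = y ∧ p = phiAt B s s) ∨ (a = x ∧ b = y ∧ p = commAt B s))
    (by
      rintro _ _ _ (⟨rfl, rfl, rfl⟩ | ⟨rfl, rfl, rfl⟩) y hy
      · by_cases h : (phiAt B s s).coeff y = 0
        · exact .inr (h ▸ zero_mem _)
        · exact .inl (coeff_phiAt_lt hcomp hy h)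
      · exact (hmax y hy).symm)
    (by
      rintro _ _ _ (⟨rfl, rfl, rfl⟩ | ⟨rfl, rfl, rfl⟩)
      · exact ⟨1, fun m _ => by rw [coeff_phiAt_self hlt hcomp, one_mul, one_smul]⟩
      · exact ⟨c, hc⟩)
    (by
      rintro _ _ _ (⟨rfl, rfl, rfl⟩ | ⟨rfl, rfl, rfl⟩) Q
      · exact hNM _ (subst_mem_phiSpan (subst_phiAt_mem B Q s s) _)
      · exact hNM _ (subst_mem_phiSpan (subst_mem_phiSpan (commAt_mem B s) Q) _))
    (fun X Y h hX => hlt.trans (hlt.subst_lt _ _ _ h) hX)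
    (by
      rintro _ _ _ (⟨rfl, rfl, rfl⟩ | ⟨rfl, rfl, rfl⟩) Q h
      · rw [LinearMap.comp_apply, ← subst_comp]
        exact hN _ _ _ (by rwa [StarWord.subst_comp])
      · rw [LinearMap.comp_apply, ← subst_comp]
        refine map_subst_commAt_eq_zero hlt hcomp hB hassoc hN (𝔪 := M.annihilator)
          (fun r hr Q s t => Submodule.mem_annihilator.1 hr _ (hNM _ (subst_phiAt_mem B Q s t)))
          fun y => ?_
        rw [StarWord.subst_comp]
        by_cases hy : y = a.br * b.br
        · exact .inr (hy ▸ h)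
        · exact (hmax y hy).imp_right fun h' =>
            hlt.trans (hlt.subst_lt _ _ _ (hlt.subst_lt _ _ _ h')) h)
    (by
      have : ¬ (a = s ∧ b = s) := by
        rintro ⟨rfl, rfl⟩
        rcases hab' with ⟨h, -⟩ | ⟨-, h⟩ <;> exact hns h
      rintro x y _ _ (⟨hx, hy, rfl⟩ | ⟨hx, hy, rfl⟩) (⟨hx', hy', rfl⟩ | ⟨hx', hy', rfl⟩)
      · rfl
      · exact (this ⟨hx'.trans hx.symm, hy'.trans hy.symm⟩).elim
      · exact (this ⟨hx.trans hx'.symm, hy.trans hy'.symm⟩).elim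
      · rfl)
    (by
      rintro _ _ _ _ _ _ (⟨rfl, rfl, -⟩ | ⟨rfl, rfl, -⟩) (⟨rfl, rfl, -⟩ | ⟨rfl, rfl, -⟩) q
      · exact ⟨ne_subst_left _ _ _, ne_subst_right _ _ _⟩
      · exact ⟨hsab q, hsab q⟩
      · exact hnf q
      · exact ⟨ne_subst_left _ _ _, ne_subst_right _ _ _⟩)
    (by
      intro x y x' p p' hr hr' Q Φ hX
      let Ψ : BPoly k Z →ₗ[k] V := N.comp (subst Q₁) - M.subtype.comp Φ
      have hΨ (f : BPoly k Z) : Ψ f = N.comp (subst Q₁) f - Φ f := rfl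
      have hΨM : ∀ f ∈ phiSpan B Z, Ψ f ∈ M := fun f hf =>
        sub_mem (hNM _ (subst_mem_phiSpan hf _)) (Φ f).2
      have hd : ∀ Q' : StarWord Z, lt (Q'.subst (s.br * s.br))
          (Q.subst (x.br * y.br * x'.br)) → Ψ (subst Q' (phiAt B s s)) = 0 := fun Q' h => by
        rw [hΨ, hX s s _ (.inl ⟨rfl, rfl, rfl⟩) Q' h, sub_self]
      have hz : ∀ Q' : StarWord Z, lt (Q'.subst (a.br * b.br))
          (Q.subst (x.br * y.br * x'.br)) → Ψ (subst Q' (commAt B s)) = 0 := fun Q' h => by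
        rw [hΨ, hX a b _ (.inr ⟨rfl, rfl, rfl⟩) Q' h, sub_self]
      rw [← sub_eq_zero, ← hΨ, ← sub_eq_zero (a := N.comp (subst Q₁) (subst Q (mono x.br * p'))),
        ← hΨ]
      have hunit' {f : BPoly k Z} (hf : f ∈ phiSpan B Z) :
          (red B s s).coeff n.br • Ψ f = 0 ↔ Ψ f = 0 := by
        refine ⟨fun h => ?_, fun h => by rw [h, smul_zero]⟩
        rw [← hc' _ (hΨM f hf), mul_smul, h, smul_zero]
      -- The two sides of the overlap ⌊s⌋⌊s⌋⌊s⌋ differ by the commutator, whose leading word is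
      -- lower. The overlap ⌊s⌋⌊s⌋⌊n⌋ occurs only if ⌊s⌋⌊n⌋ leads, and ⌊n⌋⌊s⌋⌊s⌋ only if ⌊n⌋⌊s⌋
      -- leads; the syzygy resolves both. The commutator does not overlap with itself, as n ≠ s.
      rcases hr with ⟨rfl, rfl, rfl⟩ | ⟨rfl, rfl, rfl⟩
      · rcases hr' with ⟨-, rfl, rfl⟩ | ⟨hy, rfl, rfl⟩
        · rw [sub_eq_iff_eq_add.1 (phiAt_mul_sub B _), map_add, map_add, map_neg, map_neg,
            hz Q (hlt.subst_lt _ _ _ hlead_lt), neg_zero, zero_add]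
        · obtain ⟨rfl, rfl⟩ := hab'.resolve_left fun h => hns (h.1.trans hy)
          have hν : lt (n.br * s.br) (s.br * n.br) := by
            refine (hmax _ hcomm).resolve_left fun h => hgn ?_
            rwa [coeff_commAt_left hns] at h
          rw [map_subst_overlap_left hlt hΨM rfl hd hz hν hg, neg_eq_zero, hunit'
            (subst_mem_phiSpan (mul_mono_mem_phiSpan (phiAt_mem B s s) _) _)]
      · rcases hr' with ⟨hy, rfl, rfl⟩ | ⟨hy, rfl, rfl⟩
        · obtain ⟨rfl, rfl⟩ := hab'.resolve_right fun h => hns (h.2.trans hy.symm)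
          have hν : lt (s.br * n.br) (n.br * s.br) := by
            refine (hmax _ hcomm.symm).resolve_left fun h => hgn ?_
            rwa [coeff_commAt_right hns, neg_mem_iff] at h
          rw [map_subst_overlap_right hlt hΨM rfl hd hz hν hg, hunit'
            (subst_mem_phiSpan (mono_mul_mem_phiSpan (phiAt_mem B s s) _) _)]
        · rcases hab' with ⟨h, h'⟩ | ⟨h, h'⟩
          · exact (hns (h.trans (hy.trans h'.symm))).elim
          · exact (hns (h'.trans (hy.symm.trans h.symm))).elim)
  exact ⟨Φ, h1, fun Q => h2 s s _ (.inl ⟨rfl, rfl, rfl⟩) Q⟩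

/-- If a linear map `N` with values in `M` on `phiSpan B Z` respects the rewriting rules below `w`,
then `X ↦ N (Q₁|_X)` has a correction that vanishes below `w` and respects the rule for
`⌊s⌋⌊t⌋` everywhere. -/
theorem exists_phiAt_correction (hlt : IsMonomialOrder lt) (hcomp : IsCompatible B lt)
    (hB : IsTotallyLinear B)
    (hassoc : ∀ s : BWord Z, Reduces B (eval₂ B br (eval₂ B br (mono s) (mono s)) (mono s)
        - eval₂ B br (mono s) (eval₂ B br (mono s) (mono s)) : BPoly k Z) 0)
    (hNM : ∀ f ∈ phiSpan B Z, N f ∈ M)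
    (hunit : ∀ y : k, y ∈ M.annihilator ∨ ∃ c : k, ∀ m ∈ M, (c * y) • m = m)
    (hN : ∀ (Q : StarWord Z) (s t : BWord Z), lt (Q.subst (s.br * t.br)) w →
      N (subst Q (phiAt B s t)) = 0)
    (Q₁ : StarWord Z) (s t : BWord Z) :
    ∃ Φ : BPoly k Z →ₗ[k] M, (∀ X, lt (Q₁.subst X) w → Φ (mono X) = 0) ∧
      ∀ Q, N (subst Q₁ (subst Q (phiAt B s t))) = Φ (subst Q (phiAt B s t)) := by
  classical
  -- Leading monomials are taken modulo the annihilator of M. If the whole commutator acts on M as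
  -- zero, it need not be adjoined.
  by_cases hst : s = t ∧ ∃ y, (commAt B s).coeff y ∉ M.annihilator
  · obtain ⟨rfl, y, hy⟩ := hst
    have hsupp {y : BWord Z} (h : (commAt B s).coeff y ∉ M.annihilator) :
        y ∈ (supp (commAt B s)).filter fun y => (commAt B s).coeff y ∉ M.annihilator :=
      Finset.mem_filter.2 ⟨mem_supp.2 fun h0 => h (h0 ▸ zero_mem _), h⟩
    obtain ⟨m, hm, hmax⟩ := hlt.exists_max _ ⟨y, hsupp hy⟩
    obtain ⟨hm0, hm⟩ := Finset.mem_filter.1 hm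
    have hmax' : ∀ y ≠ m, (commAt B s).coeff y ∈ M.annihilator ∨ lt y m := fun y hy =>
      or_iff_not_imp_left.2 fun h => hmax y (hsupp h) hy
    obtain ⟨n, -, -, rfl | rfl⟩ := exists_of_coeff_commAt_ne_zero (mem_supp.1 hm0)
    · exact exists_phiAt_correction_of_lead hlt hcomp hB (hassoc s) hNM hunit hN Q₁ hm hmax'
    · exact exists_phiAt_correction_of_lead hlt hcomp hB (hassoc s) hNM hunit hN Q₁ hm hmax'
  · refine exists_phiAt_correction_of_forall hlt hcomp hNM hN Q₁ s t fun h => ?_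
    have h' : ∀ y, (commAt B s).coeff y ∈ M.annihilator := by
      by_contra! hne
      exact hst ⟨h, hne⟩
    exact ⟨fun Q => map_subst_commAt_eq_zero hlt hcomp hB (hassoc s) hN (𝔪 := M.annihilator)
      (fun r hr Q s t => Submodule.mem_annihilator.1 hr _ (hNM _ (subst_phiAt_mem B Q s t)))
      fun y => .inl (h' y), h'⟩

end Correction

end BPoly

/-! ### Resolution of the critical pairs -/

namespace BPoly

open BWord

variable {k : Type*} [CommRing k] {Z : Type*} {B : BPoly k (Fin 2)}
  {V : Type*} [AddCommGroup V] [Module k V] {lt : BWord Z → BWord Z → Prop}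
  {N : BPoly k Z →ₗ[k] V} {M : Submodule k V} {w : BWord Z}

theorem exists_of_mem_supp_map {U : BPoly k Z →ₗ[k] BPoly k Z} {f : BPoly k Z} {m : BWord Z}
    (h : m ∈ supp (U f)) : ∃ n ∈ supp f, m ∈ supp (U (mono n)) := by
  by_contra! hne
  rw [mem_supp, linearMap_apply_eq U f, Finsupp.sum, MonoidAlgebra.coeff_sum,
    Finsupp.finsetSum_apply] at h
  refine h (Finset.sum_eq_zero fun n hn => ?_)
  rw [MonoidAlgebra.coeff_smul_apply, not_not.1 (mt mem_supp.2 (hne n hn)), smul_zero]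

theorem map_eq_of_forall_mem_supp {T T' : BPoly k Z →ₗ[k] V} {f : BPoly k Z}
    (h : ∀ n ∈ supp f, T (mono n) = T' (mono n)) : T f = T' f := by
  rw [linearMap_apply_eq, linearMap_apply_eq T']
  exact Finset.sum_congr rfl fun n hn => by
    dsimp only; rw [h n hn]

theorem exists_of_mem_supp_eval₂_left (hB : IsTotallyLinear B) {f : BPoly k Z} {c m : BWord Z}
    (h : m ∈ supp (eval₂ B br f (mono c))) :
    ∃ n ∈ supp f, m ∈ supp (eval₂ B br (mono n) (mono c) : BPoly k Z) :=
  exists_of_mem_supp_map (U := (bilin hB br).flip (mono c)) h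

theorem exists_of_mem_supp_eval₂_right (hB : IsTotallyLinear B) {f : BPoly k Z} {c m : BWord Z}
    (h : m ∈ supp (eval₂ B br (mono c) f)) :
    ∃ n ∈ supp f, m ∈ supp (eval₂ B br (mono c) (mono n) : BPoly k Z) :=
  exists_of_mem_supp_map (U := bilin hB br (mono c)) h

theorem mem_supp_red_of_mem_supp {s t m : BWord Z}
    (h : m ∈ supp (eval₂ B br (mono s) (mono t) : BPoly k Z)) : m.br ∈ supp (red B s t) := by
  rw [mem_supp] at h ⊢
  rwa [red, coeff_br]

theorem map_subst_mono_eq_red {Q : StarWord Z} {s t : BWord Z}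
    (h : N (subst Q (phiAt B s t)) = 0) :
    N (subst Q (mono (s.br * t.br))) = N (subst Q (red B s t)) := by
  rwa [phiAt, map_sub, map_sub, sub_eq_zero] at h

theorem map_subst_br_mul_mono (hB : IsTotallyLinear B)
    (hN : ∀ (Q : StarWord Z) (s t : BWord Z), lt (Q.subst (s.br * t.br)) w →
      N (subst Q (phiAt B s t)) = 0) {Q : StarWord Z} {f : BPoly k Z} {c : BWord Z}
    (hf : ∀ n ∈ supp f, lt (Q.subst (n.br * c.br)) w) :
    N (subst Q (br f * mono c.br)) = N (subst Q (br (eval₂ B br f (mono c)))) := by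
  refine map_eq_of_forall_mem_supp
    (T := N.comp ((subst Q).comp ((LinearMap.mulRight k (mono c.br)).comp br)))
    (T' := N.comp ((subst Q).comp (br.comp ((bilin hB br).flip (mono c))))) fun n hn => ?_
  have := map_subst_mono_eq_red (hN Q n c (hf n hn))
  rw [mono_mul, ← br_mono n] at this
  exact this

theorem map_subst_mono_mul_br (hB : IsTotallyLinear B)
    (hN : ∀ (Q : StarWord Z) (s t : BWord Z), lt (Q.subst (s.br * t.br)) w →
      N (subst Q (phiAt B s t)) = 0) {Q : StarWord Z} {f : BPoly k Z} {c : BWord Z}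
    (hf : ∀ n ∈ supp f, lt (Q.subst (c.br * n.br)) w) :
    N (subst Q (mono c.br * br f)) = N (subst Q (br (eval₂ B br (mono c) f))) := by
  refine map_eq_of_forall_mem_supp
    (T := N.comp ((subst Q).comp ((LinearMap.mulLeft k (mono c.br)).comp br)))
    (T' := N.comp ((subst Q).comp (br.comp (bilin hB br (mono c))))) fun n hn => ?_
  have := map_subst_mono_eq_red (hN Q c n (hf n hn))
  rw [mono_mul, ← br_mono n] at this
  exact this

/-- Both rewritings of ⌊a⌋⌊b⌋⌊c⌋ lie below w, so N rewrites them once more, to ⌊B(B(a,b),c)⌋ and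
⌊B(a,B(b,c))⌋. Their difference reduces to 0 through words that stay below w. -/
theorem map_overlap_iff (hlt : IsMonomialOrder lt) (hcomp : IsCompatible B lt)
    (hB : IsTotallyLinear B) {a b c : BWord Z}
    (hassoc : Reduces B (eval₂ B br (eval₂ B br (mono a) (mono b)) (mono c)
        - eval₂ B br (mono a) (eval₂ B br (mono b) (mono c)) : BPoly k Z) 0)
    (hN : ∀ (Q : StarWord Z) (s t : BWord Z), lt (Q.subst (s.br * t.br)) w →
      N (subst Q (phiAt B s t)) = 0) {Q : StarWord Z} (hw : w = Q.subst (a.br * b.br * c.br)) :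
    N (subst Q (phiAt B a b * mono c.br)) = 0 ↔ N (subst Q (mono a.br * phiAt B b c)) = 0 := by
  have hl {n : BWord Z} (hn : n ∈ supp (eval₂ B br (mono a) (mono b) : BPoly k Z)) :
      lt (n.br * c.br) (a.br * b.br * c.br) :=
    hlt.mul_right_lt (red_lt hcomp (mem_supp_red_of_mem_supp hn)) _
  have hr {n : BWord Z} (hn : n ∈ supp (eval₂ B br (mono b) (mono c) : BPoly k Z)) :
      lt (a.br * n.br) (a.br * b.br * c.br) := by
    rw [mul_assoc]
    exact hlt.mul_left_lt (red_lt hcomp (mem_supp_red_of_mem_supp hn)) _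
  have key : N (subst Q (red B a b * mono c.br)) = N (subst Q (mono a.br * red B b c)) := by
    rw [red, red, map_subst_br_mul_mono hB hN fun n hn => hw ▸ hlt.subst_lt _ _ _ (hl hn),
      map_subst_mono_mul_br hB hN fun n hn => hw ▸ hlt.subst_lt _ _ _ (hr hn), ← sub_eq_zero,
      ← map_sub, ← map_sub, ← map_sub]
    have hins' (Q' : StarWord Z) (x : BWord Z) :
        (Q.comp (.inside 1 Q' 1)).subst x = Q.subst (Q'.subst x).br := by
      rw [StarWord.subst_comp, StarWord.subst_inside, one_mul, mul_one]
    have := map_eq_of_reduces (Ψ := N.comp ((subst Q).comp br)) (𝔪 := ⊥)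
      (S := fun m => lt (Q.subst m.br) w)
      (by
        intro Q' s t h n hn
        rw [← hins'] at h ⊢
        exact hlt.trans (hlt.subst_lt _ _ _ (red_lt hcomp hn)) h)
      (by
        intro Q' s t h
        rw [← hins'] at h
        have := hN _ _ _ h
        rwa [subst_comp, subst_inside, mono_one, one_mul, mul_one] at this)
      (by
        intro a ha Q' s t
        rw [Submodule.mem_bot] at ha
        rw [ha, zero_smul])
      hassoc
      (by
        intro m
        by_cases hm : lt (Q.subst m.br) w
        · exact .inl hm
        refine .inr ?_
        rw [Submodule.mem_bot, MonoidAlgebra.coeff_sub, Finsupp.sub_apply]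
        by_contra hne
        apply hm
        rw [hw]
        refine hlt.subst_lt _ _ _ ?_
        by_cases h : m ∈ supp (eval₂ B br (eval₂ B br (mono a) (mono b)) (mono c) : BPoly k Z)
        · obtain ⟨n, hn, hm⟩ := exists_of_mem_supp_eval₂_left hB h
          exact hlt.trans (red_lt hcomp (mem_supp_red_of_mem_supp hm)) (hl hn)
        · rw [not_not.1 (mt mem_supp.2 h), zero_sub, neg_eq_zero, ← Ne, ← mem_supp] at hne
          obtain ⟨n, hn, hm⟩ := exists_of_mem_supp_eval₂_right hB hne
          exact hlt.trans (red_lt hcomp (mem_supp_red_of_mem_supp hm)) (hr hn))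
    rw [map_zero] at this
    exact this
  rw [phiAt, phiAt, sub_mul, mul_sub, ← mono_mul, ← mono_mul, map_sub, map_sub, map_sub, map_sub,
    key, mul_assoc]

/-- The hypothesis bounds the surviving monomials of each 𝔅(y), not the individual words q|_y with q
in 𝔅. The correction Φ agrees with N on every q|_{φ(s,t)}, so the sum may be regrouped by the words
y of φ(s,t), and Φ vanishes on each 𝔅(y). -/
theorem map_subst_starSubst_phiAt (hlt : IsMonomialOrder lt) (hcomp : IsCompatible B lt)
    (hB : IsTotallyLinear B)
    (hassoc : ∀ s : BWord Z, Reduces B (eval₂ B br (eval₂ B br (mono s) (mono s)) (mono s)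
        - eval₂ B br (mono s) (eval₂ B br (mono s) (mono s)) : BPoly k Z) 0)
    (hNM : ∀ f ∈ phiSpan B Z, N f ∈ M)
    (hunit : ∀ y : k, y ∈ M.annihilator ∨ ∃ c : k, ∀ m ∈ M, (c * y) • m = m)
    (hN : ∀ (Q : StarWord Z) (s t : BWord Z), lt (Q.subst (s.br * t.br)) w →
      N (subst Q (phiAt B s t)) = 0)
    {Q : StarWord Z} {s t : BWord Z} {𝔅 : StarWord Z →₀ k}
    (h𝔅 : ∀ y, y = s.br * t.br ∨ lt y (s.br * t.br) →
      ∀ m ∈ supp (starSubst 𝔅 (mono y)), lt (Q.subst m) w) :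
    N (subst Q (starSubst 𝔅 (phiAt B s t))) = 0 := by
  obtain ⟨Φ, h1, h2⟩ := exists_phiAt_correction hlt hcomp hB hassoc hNM hunit hN Q s t
  have h3 : N (subst Q (starSubst 𝔅 (phiAt B s t))) = Φ (starSubst 𝔅 (phiAt B s t)) := by
    rw [starSubst_apply, Finsupp.sum, map_sum, map_sum, map_sum, Submodule.coe_sum]
    refine Finset.sum_congr rfl fun q _ => ?_
    rw [map_smul, map_smul, map_smul, h2, Submodule.coe_smul]
  rw [h3, ZeroMemClass.coe_eq_zero]
  refine map_eq_zero_of_forall (T := Φ.comp (starSubst 𝔅)) fun y => ?_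
  by_cases h0 : (phiAt B s t).coeff y = 0
  · rw [h0, zero_smul]
  have hy : y = s.br * t.br ∨ lt y (s.br * t.br) :=
    or_iff_not_imp_left.2 fun hne => coeff_phiAt_lt hcomp hne h0
  rw [LinearMap.comp_apply, map_eq_of_forall_mem_supp (T' := 0), LinearMap.zero_apply, smul_zero]
  exact fun m hm => h1 m (h𝔅 y hy m hm)

/-- In a nested pair, both redexes lead to Q|_{⌊B(q|_{⌊B(a₂,b₂)⌋}, b₁)⌋}, or to its mirror image;
that N sees no difference is the content of `key`. -/
theorem map_criticalPair_iff (hlt : IsMonomialOrder lt) (hcomp : IsCompatible B lt)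
    (hB : IsTotallyLinear B)
    (hassoc : ∀ u v w : BWord Z, Reduces B (eval₂ B br (eval₂ B br (mono u) (mono v)) (mono w)
        - eval₂ B br (mono u) (eval₂ B br (mono v) (mono w)) : BPoly k Z) 0)
    (hNM : ∀ f ∈ phiSpan B Z, N f ∈ M)
    (hunit : ∀ y : k, y ∈ M.annihilator ∨ ∃ c : k, ∀ m ∈ M, (c * y) • m = m)
    (hN : ∀ (Q : StarWord Z) (s t : BWord Z), lt (Q.subst (s.br * t.br)) w →
      N (subst Q (phiAt B s t)) = 0)
    {Q₁ Q₂ : StarWord Z} {a₁ b₁ a₂ b₂ : BWord Z} (h : CriticalPair Q₁ a₁ b₁ Q₂ a₂ b₂)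
    (hw : w = Q₁.subst (a₁.br * b₁.br)) :
    N (subst Q₁ (phiAt B a₁ b₁)) = 0 ↔ N (subst Q₂ (phiAt B a₂ b₂)) = 0 := by
  have hsubst (Q : StarWord Z) (x : BWord Z) :
      (Q.comp (.inside 1 (.star 1 1) 1)).subst x = Q.subst x.br := by
    simp [StarWord.subst_comp, StarWord.subst]
  have hsubst' (Q : StarWord Z) (f : BPoly k Z) :
      subst (Q.comp (.inside 1 (.star 1 1) 1)) f = subst Q (br f) := by
    rw [subst_comp, ← br_eq_subst]
  cases h with
  | same => rfl
  | disjoint L R h =>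
    have := smul_map_subst_eq_of_disjoint (Ψ := N) h (p₁ := phiAt B a₁ b₁) (p₂ := phiAt B a₂ b₂)
      (x₁ := a₁.br * b₁.br) (x₂ := a₂.br * b₂.br)
      (by
        intro y hy
        by_cases h0 : (phiAt B a₂ b₂).coeff y = 0
        · rw [h0, zero_smul]
        rw [hN, smul_zero]
        rw [hw, h, h]
        exact hlt.subst_lt _ _ _ (coeff_phiAt_lt hcomp hy h0))
      (by
        intro x hx
        by_cases h0 : (phiAt B a₁ b₁).coeff x = 0
        · rw [h0, zero_smul]
        rw [hN, smul_zero]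
        rw [hw, ← h]
        exact hlt.subst_lt _ _ _ (coeff_phiAt_lt hcomp hx h0))
    rw [coeff_phiAt_self hlt hcomp, coeff_phiAt_self hlt hcomp, one_smul, one_smul] at this
    rw [this]
  | overlap Q =>
    have := map_overlap_iff hlt hcomp hB (hassoc a₁ b₁ b₂) hN (Q := Q)
      (by rw [hw, StarWord.subst_comp, StarWord.subst_star, one_mul])
    rwa [subst_mul_mono, subst_mono_mul] at this
  | nestedLeft Q q =>
    obtain ⟨𝔅, h𝔅⟩ := exists_starSubst_left hB q b₁
    have h𝔅' (f : BPoly k Z) : eval₂ B br (subst q f) (mono b₁) = starSubst 𝔅 f := by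
      have : ((bilin hB br).flip (mono b₁)).comp (subst q) = starSubst 𝔅 :=
        linearMap_ext fun a => by
          rw [← h𝔅, LinearMap.comp_apply, subst_mono]
          rfl
      exact LinearMap.congr_fun this f
    have hlt' {y : BWord Z} (hy : lt y (a₂.br * b₂.br)) :
        lt (Q₁.subst ((q.subst y).br * b₁.br)) w := by
      rw [hw]
      simpa [StarWord.subst_inside] using
        hlt.subst_lt Q₁ _ _ (hlt.subst_lt (.inside 1 q b₁.br) _ _ hy)
    -- Here 𝔅(y) = B(q|_y, b₁). By compatibility its surviving words, bracketed, are below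
    -- ⌊q|_y⌋⌊b₁⌋, which in the context Q₁ is at most w.
    have key : N (subst Q₁ (br (starSubst 𝔅 (phiAt B a₂ b₂)))) = 0 := by
      rw [← hsubst']
      refine map_subst_starSubst_phiAt hlt hcomp hB (fun s => hassoc s s s) hNM hunit hN
        fun y hy m hm => ?_
      rw [← h𝔅] at hm
      have h1 := hlt.subst_lt Q₁ _ _ (red_lt hcomp (mem_supp_red_of_mem_supp hm))
      rw [hsubst]
      rcases hy with rfl | hy
      · rwa [hw]
      · exact hlt.trans h1 (hlt' hy)
    have h1 : N (subst Q₁ (br (subst q (red B a₂ b₂)) * mono b₁.br)) =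
        N (subst Q₁ (br (starSubst 𝔅 (red B a₂ b₂)))) := by
      rw [map_subst_br_mul_mono hB hN, h𝔅']
      intro n hn
      obtain ⟨n, hn', rfl⟩ := exists_of_mem_supp_subst hn
      exact hlt' (red_lt hcomp hn')
    rw [subst_comp, subst_inside, mono_one, one_mul]
    rw [phiAt, map_sub, map_sub, map_sub, map_sub, sub_eq_zero] at key
    rw [phiAt, phiAt, map_sub, map_sub, map_sub (subst q), map_sub br, sub_mul, map_sub, map_sub,
      h1, ← key, ← h𝔅, red, subst_mono q, br_mono, ← mono_mul]
  | nestedRight Q q =>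
    obtain ⟨𝔅, h𝔅⟩ := exists_starSubst_right hB a₁ q
    have h𝔅' (f : BPoly k Z) : eval₂ B br (mono a₁) (subst q f) = starSubst 𝔅 f := by
      have : (bilin hB br (mono a₁)).comp (subst q) = starSubst 𝔅 :=
        linearMap_ext fun a => by
          rw [← h𝔅, LinearMap.comp_apply, subst_mono]
          rfl
      exact LinearMap.congr_fun this f
    have hlt' {y : BWord Z} (hy : lt y (a₂.br * b₂.br)) :
        lt (Q₁.subst (a₁.br * (q.subst y).br)) w := by
      rw [hw]
      simpa [StarWord.subst_inside] using
        hlt.subst_lt Q₁ _ _ (hlt.subst_lt (.inside a₁.br q 1) _ _ hy)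
    have key : N (subst Q₁ (br (starSubst 𝔅 (phiAt B a₂ b₂)))) = 0 := by
      rw [← hsubst']
      refine map_subst_starSubst_phiAt hlt hcomp hB (fun s => hassoc s s s) hNM hunit hN
        fun y hy m hm => ?_
      rw [← h𝔅] at hm
      have h1 := hlt.subst_lt Q₁ _ _ (red_lt hcomp (mem_supp_red_of_mem_supp hm))
      rw [hsubst]
      rcases hy with rfl | hy
      · rwa [hw]
      · exact hlt.trans h1 (hlt' hy)
    have h1 : N (subst Q₁ (mono a₁.br * br (subst q (red B a₂ b₂)))) =
        N (subst Q₁ (br (starSubst 𝔅 (red B a₂ b₂)))) := by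
      rw [map_subst_mono_mul_br hB hN, h𝔅']
      intro n hn
      obtain ⟨n, hn', rfl⟩ := exists_of_mem_supp_subst hn
      exact hlt' (red_lt hcomp hn')
    rw [subst_comp, subst_inside, mono_one, mul_one]
    rw [phiAt, map_sub, map_sub, map_sub, map_sub, sub_eq_zero] at key
    rw [phiAt, phiAt, map_sub, map_sub, map_sub (subst q), map_sub br, mul_sub, map_sub, map_sub,
      h1, ← key, ← h𝔅, red, subst_mono q, br_mono, ← mono_mul]

/-- The normal form map respects all rewriting rules, if every scalar acts on the ambiguities `M`
as zero or invertibly. -/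
theorem map_subst_phiAt_eq_zero (hlt : IsMonomialOrder lt) (hcomp : IsCompatible B lt)
    (hB : IsTotallyLinear B)
    (hassoc : ∀ u v w : BWord Z, Reduces B (eval₂ B br (eval₂ B br (mono u) (mono v)) (mono w)
        - eval₂ B br (mono u) (eval₂ B br (mono v) (mono w)) : BPoly k Z) 0)
    (hNM : ∀ f ∈ phiSpan B Z, N f ∈ M)
    (hunit : ∀ y : k, y ∈ M.annihilator ∨ ∃ c : k, ∀ m ∈ M, (c * y) • m = m)
    (hchosen : ∀ X : BWord Z, ¬ IsRBNF X → ∃ (Q : StarWord Z) (s t : BWord Z),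
        X = Q.subst (s.br * t.br) ∧ N (subst Q (phiAt B s t)) = 0)
    (Q : StarWord Z) (s t : BWord Z) : N (subst Q (phiAt B s t)) = 0 := by
  obtain ⟨X, hX⟩ : ∃ X, X = Q.subst (s.br * t.br) := ⟨_, rfl⟩
  induction X using hlt.wf.induction generalizing Q s t with
  | _ X ih =>
    -- One redex of X is respected by the choice of N; every other redex is compared with it.
    obtain ⟨Q₀, s₀, t₀, h₀, hN₀⟩ := hchosen X (not_not.2 ⟨Q, s, t, hX⟩)
    have hN (Q : StarWord Z) (s t : BWord Z) (h : lt (Q.subst (s.br * t.br)) X) :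
        N (subst Q (phiAt B s t)) = 0 := ih _ h Q s t rfl
    rcases criticalPair_of_subst_eq (h₀.symm.trans hX) with hcp | hcp
    · exact (map_criticalPair_iff hlt hcomp hB hassoc hNM hunit hN hcp h₀).1 hN₀
    · exact (map_criticalPair_iff hlt hcomp hB hassoc hNM hunit hN hcp hX).2 hN₀

end BPoly

/-! ### Change of coefficients and Noetherian induction -/

namespace BPoly

open BWord

section MapCoeff

variable {k k' : Type*} [CommRing k] [CommRing k'] (f : k →+* k') {Z : Type*}

/-- Change of the coefficients of a bracketed polynomial. -/
abbrev mapCoeff : BPoly k Z →+* BPoly k' Z := MonoidAlgebra.mapRingHom (BWord Z) f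

theorem mapCoeff_mono (w : BWord Z) : mapCoeff f (mono w) = mono w := by
  simp [mono_eq_single]

theorem mapCoeff_smul (c : k) (p : BPoly k Z) : mapCoeff f (c • p) = f c • mapCoeff f p := by
  ext w
  simp

theorem mapCoeff_injective {f : k →+* k'} (hf : Function.Injective f) :
    Function.Injective (mapCoeff f : BPoly k Z →+* BPoly k' Z) :=
  MonoidAlgebra.map_injective f.toAddMonoidHom hf

theorem induction_mono {motive : BPoly k Z → Prop} (p : BPoly k Z) (zero : motive 0)
    (add : ∀ p q, motive p → motive q → motive (p + q))
    (smul : ∀ (c : k) w, motive (c • mono w)) : motive p := by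
  induction p using MonoidAlgebra.induction_linear with
  | zero => exact zero
  | add p q hp hq => exact add p q hp hq
  | single w c => simpa [mono_eq_single] using smul c w

theorem mapCoeff_subst (q : StarWord Z) (p : BPoly k Z) :
    mapCoeff f (subst q p) = subst q (mapCoeff f p) := by
  induction p using induction_mono with
  | zero => simp
  | add p p' hp hp' => simp only [map_add, hp, hp']
  | smul c w => simp only [map_smul, mapCoeff_smul, subst_mono, mapCoeff_mono]

theorem mapCoeff_br (p : BPoly k Z) : mapCoeff f (br p) = br (mapCoeff f p) := by
  rw [br_eq_subst, br_eq_subst, mapCoeff_subst]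

theorem mapCoeff_eval₂ (B : BPoly k (Fin 2)) (p q : BPoly k Z) :
    mapCoeff f (eval₂ B br p q) = eval₂ (mapCoeff f B) br (mapCoeff f p) (mapCoeff f q) := by
  have hr : mapCoeff f ∘ ![p, q] = ![mapCoeff f p, mapCoeff f q] := by
    funext i
    fin_cases i <;> rfl
  induction B using induction_mono with
  | zero => simp [eval₂]
  | add B B' h h' => simp only [eval₂, map_add] at h h' ⊢; rw [h, h']
  | smul c w =>
    simp only [eval₂, map_smul, mapCoeff_smul, mapCoeff_mono, eval_mono]
    have := BWord.map_eval br br (mapCoeff f : BPoly k Z →+* BPoly k' Z).toMonoidHom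
      (mapCoeff_br f) ![p, q] w
    rw [← hr]
    exact congrArg _ this

theorem mapCoeff_red (B : BPoly k (Fin 2)) (s t : BWord Z) :
    mapCoeff f (red B s t) = red (mapCoeff f B) s t := by
  rw [red, mapCoeff_br, mapCoeff_eval₂, mapCoeff_mono, mapCoeff_mono, red]

theorem mapCoeff_phiAt (B : BPoly k (Fin 2)) (s t : BWord Z) :
    mapCoeff f (phiAt B s t) = phiAt (mapCoeff f B) s t := by
  rw [phiAt, map_sub, mapCoeff_mono, mapCoeff_red, phiAt]

theorem supp_mapCoeff_subset (p : BPoly k Z) : supp (mapCoeff f p) ⊆ supp p := fun w hw => by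
  rw [mem_supp, MonoidAlgebra.coeff_mapRingHom] at hw
  exact mem_supp.2 fun h => hw (by rw [h, map_zero])

theorem supp_mapCoeff {f : k →+* k'} (hf : Function.Injective f) (p : BPoly k Z) :
    supp (mapCoeff f p) = supp p := by
  ext w
  rw [mem_supp, mem_supp, MonoidAlgebra.coeff_mapRingHom, map_ne_zero_iff f hf]

theorem mapCoeff_rewrite (B : BPoly k (Fin 2)) (p : BPoly k Z) (Q : StarWord Z) (X s t : BWord Z) :
    mapCoeff f (p - p.coeff X • subst Q (phiAt B s t)) =
      mapCoeff f p - (mapCoeff f p).coeff X • subst Q (phiAt (mapCoeff f B) s t) := by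
  rw [map_sub, mapCoeff_smul, mapCoeff_subst, mapCoeff_phiAt, MonoidAlgebra.coeff_mapRingHom]

/-- A step whose coefficient dies under f becomes void; every other step remains a step. -/
theorem Reduces.mapCoeff {B : BPoly k (Fin 2)} {p q : BPoly k Z} (h : Reduces B p q) :
    Reduces (mapCoeff f B) (mapCoeff f p) (mapCoeff f q) := by
  induction h with
  | refl => exact .refl
  | @tail q q' _ h ih =>
    obtain ⟨Q, s, t, -, rfl⟩ := rewrites_iff.1 h
    rw [mapCoeff_rewrite]
    by_cases h0 : (BPoly.mapCoeff f q).coeff (Q.subst (s.br * t.br)) = 0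
    · rwa [h0, zero_smul, sub_zero]
    · exact ih.tail (rewrites_iff.2 ⟨Q, s, t, mem_supp.2 h0, rfl⟩)

/-- Rewriting by an expression defined over k never leaves the polynomials over k, and injectivity
preserves supports, so every step lifts. -/
theorem Reduces.of_mapCoeff {f : k →+* k'} (hf : Function.Injective f) {B : BPoly k (Fin 2)}
    {p : BPoly k Z} {q : BPoly k' Z} (h : Reduces (BPoly.mapCoeff f B) (BPoly.mapCoeff f p) q) :
    ∃ q', q = BPoly.mapCoeff f q' ∧ Reduces B p q' := by
  induction h with
  | refl => exact ⟨p, rfl, .refl⟩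
  | tail _ h ih =>
    obtain ⟨q, rfl, hq⟩ := ih
    obtain ⟨Q, s, t, hm, rfl⟩ := rewrites_iff.1 h
    rw [supp_mapCoeff hf] at hm
    exact ⟨_, (mapCoeff_rewrite f B q Q _ s t).symm,
      hq.tail (rewrites_iff.2 ⟨Q, s, t, hm, rfl⟩)⟩

end MapCoeff

variable {Z : Type*} {lt : BWord Z → BWord Z → Prop}

/-- The conditions on `B` that make all critical pairs on `𝔐(Z)` resolvable. -/
structure IsResolvable {k : Type*} [CommRing k] (B : BPoly k (Fin 2))
    (lt : BWord Z → BWord Z → Prop) : Prop where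
  totallyLinear : IsTotallyLinear B
  compatible : IsCompatible B lt
  assoc : ∀ u v w : BWord Z, Reduces B
    (eval₂ B br (eval₂ B br (mono u) (mono v)) (mono w)
      - eval₂ B br (mono u) (eval₂ B br (mono v) (mono w)) : BPoly k Z) 0

/-- There is a normal form map that respects all rewriting rules. -/
def HasNormalForm {k : Type*} [CommRing k] (B : BPoly k (Fin 2)) (Z : Type*) : Prop :=
  ∃ N : BPoly k Z →ₗ[k] RBModule k Z, (∀ r, N (RBModule.iota r) = r) ∧
    ∀ (Q : StarWord Z) (s t : BWord Z), N (subst Q (phiAt B s t)) = 0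

section MapCoeff

variable {k k' : Type*} [CommRing k] [CommRing k'] {B : BPoly k (Fin 2)}

theorem mapCoeff_assoc (f : k →+* k') (u v w : BWord Z) :
    mapCoeff f (eval₂ B br (eval₂ B br (mono u) (mono v)) (mono w)
      - eval₂ B br (mono u) (eval₂ B br (mono v) (mono w))) =
    eval₂ (mapCoeff f B) br (eval₂ (mapCoeff f B) br (mono u) (mono v)) (mono w)
      - eval₂ (mapCoeff f B) br (mono u) (eval₂ (mapCoeff f B) br (mono v) (mono w)) := by
  simp only [map_sub, mapCoeff_eval₂, mapCoeff_mono]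

theorem IsResolvable.mapCoeff (h : IsResolvable B lt) (f : k →+* k') :
    IsResolvable (mapCoeff f B) lt where
  totallyLinear m hm := h.totallyLinear m (supp_mapCoeff_subset f B hm)
  compatible u v m hm := by
    change m ∈ supp (red _ u v) at hm
    rw [← mapCoeff_red] at hm
    exact h.compatible u v m (supp_mapCoeff_subset f _ hm)
  assoc u v w := by
    rw [← mapCoeff_assoc, ← map_zero (BPoly.mapCoeff f)]
    exact (h.assoc u v w).mapCoeff f

theorem IsResolvable.of_mapCoeff {f : k →+* k'} (hf : Function.Injective f)
    (h : IsResolvable (BPoly.mapCoeff f B) lt) : IsResolvable B lt where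
  totallyLinear m hm := h.totallyLinear m (by rwa [supp_mapCoeff hf])
  compatible u v m hm := by
    refine h.compatible u v m ?_
    change m ∈ supp (red _ u v)
    rwa [← mapCoeff_red, supp_mapCoeff hf]
  assoc u v w := by
    have := h.assoc u v w
    rw [← mapCoeff_assoc] at this
    obtain ⟨q, hq, hred⟩ := Reduces.of_mapCoeff hf this
    rwa [(map_eq_zero_iff _ (mapCoeff_injective hf)).1 hq.symm] at hred

theorem mapCoeff_iota (f : k →+* k') (r : RBModule k Z) :
    mapCoeff f (RBModule.iota r) = RBModule.iota (r.mapRange f f.map_zero) := by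
  induction r using Finsupp.induction_linear with
  | zero => simp
  | add r r' h h' => rw [map_add, map_add, h, h', Finsupp.mapRange_add (map_add f), map_add]
  | single w c =>
    rw [Finsupp.mapRange_single, iota_single, iota_single, mapCoeff_smul, mapCoeff_mono]

/-- Normal forms of words are computed over k and extended k'-linearly, which is why no assumption
on f is needed. -/
theorem HasNormalForm.mapCoeff (h : HasNormalForm B Z) (f : k →+* k') :
    HasNormalForm (mapCoeff f B) Z := by
  obtain ⟨N, hN1, hN2⟩ := h
  let N' : BPoly k' Z →ₗ[k'] RBModule k' Z :=
    lin fun w => (N (mono w)).mapRange f f.map_zero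
  have hN' (p : BPoly k Z) : N' (BPoly.mapCoeff f p) = (N p).mapRange f f.map_zero := by
    induction p using induction_mono with
    | zero => simp
    | add p q hp hq => rw [map_add, map_add, hp, hq, map_add, Finsupp.mapRange_add (map_add f)]
    | smul c w =>
      rw [mapCoeff_smul, map_smul, mapCoeff_mono, lin_mono, map_smul]
      ext i
      simp
  refine ⟨N', fun r => ?_, fun Q s t => ?_⟩
  · have : N'.comp RBModule.iota = LinearMap.id := by
      refine Finsupp.lhom_ext' fun w => LinearMap.ext_ring ?_
      have h1 := hN' (RBModule.iota (Finsupp.single w 1))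
      rw [mapCoeff_iota, hN1, Finsupp.mapRange_single, map_one] at h1
      exact h1
    exact LinearMap.congr_fun this r
  · rw [← mapCoeff_phiAt, ← mapCoeff_subst, hN', hN2, Finsupp.mapRange_zero]

end MapCoeff

universe u

/-- Normal forms exist if they exist after a reduction of the coefficients modulo some ideal
contained in `(x)`, for all `x ≠ 0`. -/
theorem HasNormalForm.of_reductions {k : Type u} [CommRing k] {B : BPoly k (Fin 2)}
    (hlt : IsMonomialOrder lt) (h : IsResolvable B lt)
    (hred : ∀ x : k, x ≠ 0 → ∃ (k' : Type u) (_ : CommRing k') (f : k →+* k'),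
      RingHom.ker f ≤ Ideal.span {x} ∧ HasNormalForm (BPoly.mapCoeff f B) Z) :
    HasNormalForm B Z := by
  obtain ⟨N, hN1, hN2, hN3⟩ := exists_normalForm (k := k) (B := B) hlt h.compatible
  -- The ambiguities: normal forms that represent zero. The aim is to make every scalar zero or
  -- invertible on M.
  let M : Submodule k (RBModule k Z) := (phiSpan B Z).comap RBModule.iota
  have hNM : ∀ f ∈ phiSpan B Z, N f ∈ M := fun f hf => by
    change RBModule.iota (N f) ∈ phiSpan B Z
    simpa using sub_mem hf (hN2 f)
  have hcoeff : ∀ r ∈ M, ∀ x : k, x ≠ 0 → ∀ w, r w ∈ Ideal.span {x} := by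
    intro r hr x hx w
    obtain ⟨k', _, f, hf, N', hN'1, hN'2⟩ := hred x hx
    have key : ∀ p ∈ phiSpan B Z, N' (BPoly.mapCoeff f p) = 0 := by
      intro p hp
      induction hp using Submodule.span_induction with
      | mem p h =>
        obtain ⟨Q, s, t, rfl⟩ := h
        rw [mapCoeff_subst, mapCoeff_phiAt, hN'2]
      | zero => simp
      | add p q _ _ hp hq => rw [map_add, map_add, hp, hq, add_zero]
      | smul c p _ hp => rw [mapCoeff_smul, map_smul, hp, smul_zero]
    have := key _ hr
    rw [mapCoeff_iota, hN'1] at this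
    -- Over k' there are no ambiguities, so the coefficients of r lie in the kernel of f, hence in
    -- (x).
    exact hf (RingHom.mem_ker.2 (by simpa using DFunLike.congr_fun this w))
  have hunit : ∀ y : k, y ∈ M.annihilator ∨ ∃ c : k, ∀ m ∈ M, (c * y) • m = m := by
    intro y
    by_cases hM : ∀ r ∈ M, ∀ w, r w = 0
    · exact .inl (Submodule.mem_annihilator.2 fun r hr => by
        ext w
        simp [hM r hr w])
    push Not at hM
    -- Every coefficient of M is a multiple of the nonzero element d = r₀(w₀). If yd = 0, then y
    -- kills M. Otherwise d also lies in (yd), say d = cyd, and cy acts on M as the identity.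
    obtain ⟨r₀, hr₀, w₀, h₀⟩ := hM
    by_cases hy : y * r₀ w₀ = 0
    · refine .inl (Submodule.mem_annihilator.2 fun r hr => ?_)
      ext w
      obtain ⟨a, ha⟩ := Ideal.mem_span_singleton'.1 (hcoeff r hr _ h₀ w)
      rw [Finsupp.smul_apply, ← ha, smul_eq_mul, mul_left_comm, hy, mul_zero, Finsupp.zero_apply]
    · obtain ⟨c, hc⟩ := Ideal.mem_span_singleton'.1 (hcoeff r₀ hr₀ _ hy w₀)
      refine .inr ⟨c, fun r hr => ?_⟩
      ext w
      obtain ⟨a, ha⟩ := Ideal.mem_span_singleton'.1 (hcoeff r hr _ h₀ w)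
      rw [Finsupp.smul_apply, ← ha, smul_eq_mul, mul_left_comm, mul_assoc, hc]
  exact ⟨N, hN1, map_subst_phiAt_eq_zero hlt h.compatible h.totallyLinear h.assoc hNM hunit hN3⟩

theorem HasNormalForm.of_isNoetherianRing {k : Type u} [CommRing k] [IsNoetherianRing k]
    {B : BPoly k (Fin 2)} (hlt : IsMonomialOrder lt) (h : IsResolvable B lt) :
    HasNormalForm B Z := by
  -- Noetherian induction: for y outside I, the quotient of k/I by the class of y is k/(I + (y)),
  -- where normal forms exist by the induction hypothesis.
  have key : ∀ I : Ideal k, HasNormalForm (BPoly.mapCoeff (Ideal.Quotient.mk I) B) Z := by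
    intro I
    induction I using WellFoundedGT.induction with
    | _ I ih =>
      refine .of_reductions hlt (h.mapCoeff _) fun x hx => ?_
      obtain ⟨y, rfl⟩ := Ideal.Quotient.mk_surjective x
      have hle : I ≤ I ⊔ Ideal.span {y} := le_sup_left
      have hlt' : I < I ⊔ Ideal.span {y} := by
        refine lt_of_le_of_ne hle fun h => hx (Ideal.Quotient.eq_zero_iff_mem.2 ?_)
        rw [h]
        exact Ideal.mem_sup_right (Ideal.mem_span_singleton_self y)
      refine ⟨_, inferInstance, Ideal.Quotient.factor hle, fun z hz => ?_, ?_⟩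
      · obtain ⟨z, rfl⟩ := Ideal.Quotient.mk_surjective z
        rw [RingHom.mem_ker, Ideal.Quotient.factor_mk, Ideal.Quotient.eq_zero_iff_mem,
          Submodule.mem_sup] at hz
        obtain ⟨i, hi, j, hj, rfl⟩ := hz
        rw [map_add, Ideal.Quotient.eq_zero_iff_mem.2 hi, zero_add]
        obtain ⟨a, rfl⟩ := Ideal.mem_span_singleton'.1 hj
        rw [map_mul]
        exact Ideal.mem_span_singleton'.2 ⟨_, rfl⟩
      · have := ih _ hlt'
        rwa [← Ideal.Quotient.factor_comp_mk hle, BPoly.mapCoeff, MonoidAlgebra.mapRingHom_comp,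
          RingHom.comp_apply] at this
  refine .of_reductions hlt h fun x hx => ⟨_, inferInstance, Ideal.Quotient.mk ⊥, ?_, key ⊥⟩
  rw [Ideal.mk_ker]
  exact bot_le

theorem hasNormalForm {k : Type u} [CommRing k] {B : BPoly k (Fin 2)} (hlt : IsMonomialOrder lt)
    (h : IsResolvable B lt) : HasNormalForm B Z := by
  classical
  -- The subring generated by the finitely many coefficients of B is Noetherian, and B is defined
  -- over it.
  let k₀ := Algebra.adjoin ℤ (((supp B).image B.coeff : Finset k) : Set k)
  have : Algebra.FiniteType ℤ k₀ :=
    (Subalgebra.fg_iff_finiteType _).1 (Subalgebra.fg_adjoin_finset _)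
  have : IsNoetherianRing k₀ := Algebra.FiniteType.isNoetherianRing ℤ k₀
  have hmem (m : BWord (Fin 2)) : B.coeff m ∈ k₀ := by
    by_cases hm : m ∈ supp B
    · exact Algebra.subset_adjoin (Finset.mem_coe.2 (Finset.mem_image_of_mem _ hm))
    · rw [not_not.1 (mt mem_supp.2 hm)]
      exact zero_mem _
  obtain ⟨B₀, hB₀⟩ : ∃ B₀ : BPoly k₀ (Fin 2),
      BPoly.mapCoeff (algebraMap k₀ k) B₀ = B := by
    refine ⟨∑ m ∈ supp B, MonoidAlgebra.single m ⟨B.coeff m, hmem m⟩, ?_⟩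
    rw [map_sum]
    simp only [MonoidAlgebra.mapRingHom_single]
    exact MonoidAlgebra.sum_coeff_single B
  have hinj : Function.Injective (algebraMap k₀ k) := Subtype.val_injective
  rw [← hB₀] at h ⊢
  exact (HasNormalForm.of_isNoetherianRing hlt (h.of_mapCoeff hinj)).mapCoeff _

end BPoly

/-! ### The operated ideal, the product ⋄ and freeness -/

namespace BPoly

open BWord

variable {k : Type*} [CommRing k] {Z : Type*} {B : BPoly k (Fin 2)}

section PhiAlgebra

variable {R : Type*} [Ring R] [Algebra k R]

theorem eval_phi (P : R →ₗ[k] R) (r : Fin 2 → R) :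
    eval P r (phi B) = P (r 0) * P (r 1) - P (eval P r B) := by
  rw [phi, map_sub, map_mul, eval_br, eval_br, eval_br, eval_mono, eval_mono]
  congr 3 <;> exact mul_one _

theorem br_mem_phiSpan {f : BPoly k Z} (hf : f ∈ phiSpan B Z) : br f ∈ phiSpan B Z := by
  rw [br_eq_subst]
  exact subst_mem_phiSpan hf _

theorem mul_mem_phiSpan_left (g : BPoly k Z) {f : BPoly k Z} (hf : f ∈ phiSpan B Z) :
    g * f ∈ phiSpan B Z := by
  induction g using induction_mono with
  | zero => simp
  | add g g' h h' => rw [add_mul]; exact add_mem h h'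
  | smul c w => rw [smul_mul_assoc]; exact Submodule.smul_mem _ _ (mono_mul_mem_phiSpan hf w)

theorem mul_mem_phiSpan_right (g : BPoly k Z) {f : BPoly k Z} (hf : f ∈ phiSpan B Z) :
    f * g ∈ phiSpan B Z := by
  induction g using induction_mono with
  | zero => simp
  | add g g' h h' => rw [mul_add]; exact add_mem h h'
  | smul c w => rw [mul_smul_comm]; exact Submodule.smul_mem _ _ (mul_mono_mem_phiSpan hf w)

/-- φ is bilinear because B is totally linear, so its values at polynomials are combinations of its
values at words. -/
theorem eval_phi_mem_phiSpan (hB : IsTotallyLinear B) (r : Fin 2 → BPoly k Z) :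
    eval br r (phi B) ∈ phiSpan B Z := by
  have key : ∀ a b : BPoly k Z, br a * br b - br (bilin hB br a b) ∈ phiSpan B Z := by
    intro a b
    induction a using induction_mono with
    | zero => simp
    | add a a' h h' =>
      rw [map_add, map_add, LinearMap.add_apply, map_add, add_mul, add_sub_add_comm]
      exact add_mem h h'
    | smul c s =>
      rw [map_smul, map_smul, LinearMap.smul_apply, map_smul, smul_mul_assoc, ← smul_sub]
      refine Submodule.smul_mem _ _ ?_
      induction b using induction_mono with
      | zero => simp
      | add b b' h h' =>
        rw [map_add, map_add, map_add, mul_add, add_sub_add_comm]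
        exact add_mem h h'
      | smul c t =>
        rw [map_smul, map_smul, map_smul, mul_smul_comm, ← smul_sub, br_mono, br_mono, ← mono_mul]
        exact Submodule.smul_mem _ _ (phiAt_mem B s t)
  have hr : r = ![r 0, r 1] := by
    funext i
    fin_cases i <;> rfl
  rw [eval_phi]
  conv => enter [2, 2]; rw [hr]
  exact key (r 0) (r 1)

theorem phiAt_eq_eval (s t : BWord Z) : phiAt B s t = eval br ![mono s, mono t] (phi B) := by
  rw [eval_phi]
  simp only [Matrix.cons_val_zero, Matrix.cons_val_one, br_mono, ← mono_mul]
  rfl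

/-- Contexts are composed of products and brackets, so the span of all q|_{φ(s,t)} is already a
two-sided ideal closed under brackets. -/
theorem mem_operatedIdeal_iff (hB : IsTotallyLinear B) {f : BPoly k Z} :
    f ∈ operatedIdeal (phiValues (phi B) Z) ↔ f ∈ phiSpan B Z := by
  simp only [operatedIdeal, Submodule.mem_sInf]
  constructor
  · intro h
    refine h { (phiSpan B Z).toAddSubmonoid with
      smul_mem' := fun g f hf => mul_mem_phiSpan_left g hf } ⟨⟨fun g hf => ?_⟩, fun f hf => ?_, ?_⟩
    · exact mul_mem_phiSpan_right g hf
    · exact br_mem_phiSpan hf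
    · rintro _ ⟨r, rfl⟩
      exact eval_phi_mem_phiSpan hB r
  · rintro hf I ⟨hI, hbr, hS⟩
    have hsub (Q : StarWord Z) {g : BPoly k Z} (hg : g ∈ I) : subst Q g ∈ I := by
      induction Q with
      | star l r =>
        rw [subst_star]
        exact Ideal.mul_mem_right _ I (Ideal.mul_mem_left I _ hg)
      | inside l q r ih =>
        rw [subst_inside]
        exact Ideal.mul_mem_right _ I (Ideal.mul_mem_left I _ (hbr _ ih))
    induction hf using Submodule.span_induction with
    | mem f h =>
      obtain ⟨Q, s, t, rfl⟩ := h
      rw [phiAt_eq_eval]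
      exact hsub Q (hS ⟨_, rfl⟩)
    | zero => exact zero_mem _
    | add f g _ _ hf hg => exact add_mem hf hg
    | smul c f _ hf =>
      rw [← one_mul f, ← smul_mul_assoc]
      exact Ideal.mul_mem_left I _ hf

theorem eval_eq_zero_of_mem_phiSpan {P : R →ₗ[k] R} (hR : IsPhiAlgebra (phi B) R P) (r : Z → R)
    {f : BPoly k Z} (hf : f ∈ phiSpan B Z) : eval P r f = 0 := by
  have hsub (Q : StarWord Z) {g : BPoly k Z} (hg : eval P r g = 0) : eval P r (subst Q g) = 0 := by
    induction Q with
    | star l r => rw [subst_star, map_mul, map_mul, hg, mul_zero, zero_mul]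
    | inside l q r ih => rw [subst_inside, map_mul, map_mul, eval_br, ih, map_zero, mul_zero, zero_mul]
  induction hf using Submodule.span_induction with
  | mem f h =>
    obtain ⟨Q, s, t, rfl⟩ := h
    refine hsub Q ?_
    rw [phiAt_eq_eval, map_eval (eval P r) (eval_br P r)]
    exact hR _
  | zero => exact map_zero _
  | add f g _ _ hf hg => rw [map_add, hf, hg, add_zero]
  | smul c f _ hf => rw [map_smul, hf, smul_zero]

/-- A morphism of operated algebras from `k⟪Z⟫` is determined by its values on `Z`. -/
theorem algHom_eq_eval {P : R →ₗ[k] R} {r : Z → R} (g : BPoly k Z →ₐ[k] R)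
    (hg : ∀ f, g (br f) = P (g f)) (hr : ∀ z, g (mono (BWord.of z)) = r z) : g = eval P r := by
  have key : ∀ w : BWord Z, g (mono w) = BWord.eval P r w := by
    intro w
    induction w with
    | nil => exact map_one g
    | letter z w ih =>
      rw [BWord.eval_letter, ← ih, ← hr, ← map_mul, ← mono_mul]
      rfl
    | bracket u w ihu ihw =>
      rw [BWord.eval_bracket, ← ihu, ← ihw, ← hg, ← map_mul, br_mono, ← mono_mul]
      rfl
  have : g.toLinearMap = (eval P r).toLinearMap := linearMap_ext fun w => by
    rw [AlgHom.toLinearMap_apply, AlgHom.toLinearMap_apply, key, eval_mono]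
  exact AlgHom.toLinearMap_injective this

/-- An operated algebra that is a quotient of `k⟪Z⟫` by `phiSpan B Z` is a free `φ`-algebra. -/
theorem isFreePhiAlgebra_of_ker_eq (hB : IsTotallyLinear B) {P : R →ₗ[k] R} {i : Z → R}
    (π : BPoly k Z →ₐ[k] R) (σ : R →ₗ[k] BPoly k Z) (hσ : ∀ a, π (σ a) = a)
    (hπ : ∀ f, π (br f) = P (π f)) (hi : ∀ z, π (mono (BWord.of z)) = i z)
    (hker : ∀ f, π f = 0 ↔ f ∈ phiSpan B Z) : IsFreePhiAlgebra.{uR} (phi B) R P i := by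
  refine ⟨fun r => ?_, ?_⟩
  · have hr : r = π ∘ (σ ∘ r) := funext fun j => (hσ _).symm
    rw [hr, ← map_eval π hπ, hker]
    exact eval_phi_mem_phiSpan hB _
  · intro S _ _ Q hS f
    -- Evaluation in a φ-algebra factors through π, so the linear section σ induces an algebra map
    -- although σ need not be multiplicative.
    have hE {g h : BPoly k Z} (hgh : π g = π h) : eval Q f g = eval Q f h := by
      rw [← sub_eq_zero, ← map_sub] at hgh ⊢
      exact eval_eq_zero_of_mem_phiSpan hS f ((hker _).1 hgh)
    let G : R →ₐ[k] S := AlgHom.ofLinearMap ((eval Q f).toLinearMap.comp σ)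
      (by
        change eval Q f (σ 1) = 1
        rw [← map_one (eval Q f)]
        exact hE (by rw [hσ, map_one]))
      (by
        intro a b
        change eval Q f (σ (a * b)) = eval Q f (σ a) * eval Q f (σ b)
        rw [← map_mul]
        exact hE (by rw [hσ, map_mul, hσ, hσ]))
    have hG (g : BPoly k Z) : G (π g) = eval Q f g := hE (hσ _)
    refine ⟨G, ⟨fun a => ?_, fun z => ?_⟩, fun g' hg' => ?_⟩
    · obtain ⟨g, rfl⟩ : ∃ g, π g = a := ⟨_, hσ a⟩
      rw [← hπ, hG, hG, eval_br]
    · rw [← hi, hG, eval_mono]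
      exact mul_one _
    · have := algHom_eq_eval (g'.comp π) (P := Q) (r := f)
        (fun h => by rw [AlgHom.comp_apply, AlgHom.comp_apply, hπ, hg'.1])
        (fun z => by rw [AlgHom.comp_apply, hi, hg'.2])
      ext a
      obtain ⟨g, rfl⟩ : ∃ g, π g = a := ⟨_, hσ a⟩
      rw [hG, ← this, AlgHom.comp_apply]

end PhiAlgebra

section Diamond

variable {N : BPoly k Z →ₗ[k] RBModule k Z}

theorem iota_op (r : RBModule k Z) : RBModule.iota (RBModule.op r) = br (RBModule.iota r) := by
  have : RBModule.iota.comp RBModule.op = (br (k := k) (Z := Z)).comp RBModule.iota := by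
    refine Finsupp.lhom_ext' fun w => LinearMap.ext_ring ?_
    simp only [LinearMap.comp_apply, Finsupp.lsingle_apply, RBModule.op, Finsupp.lmapDomain_apply,
      Finsupp.mapDomain_single, iota_single, one_smul, br_mono]
    rfl
  exact LinearMap.congr_fun this r

/-- The product ⋄ differs from concatenation only at a junction ⌊p⌋⌊q⌋. There the difference is
φ(p,q) plus the bracket of B(p,q) - ιN(B(p,q)), both in the span. -/
theorem mono_mul_sub_diamondWord_mem (hN : ∀ f, f - RBModule.iota (N f) ∈ phiSpan B Z)
    (v : BWord Z) : ∀ u : BWord Z, mono (u * v) - diamondWord B N u v ∈ phiSpan B Z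
  | .nil => by
    rw [diamondWord, nil_mul, sub_self]
    exact zero_mem _
  | .letter z u => by
    rw [diamondWord, letter_mul, show letter z (u * v) = BWord.of z * (u * v) from rfl, mono_mul,
      ← mul_sub]
    exact mono_mul_mem_phiSpan (mono_mul_sub_diamondWord_mem hN v u) _
  | .bracket p .nil => by
    cases v with
    | nil =>
      rw [diamondWord]
      · rw [show bracket p nil = p.br from rfl, sub_self]
        exact zero_mem _
      · rintro _ _ ⟨⟩
    | letter z v =>
      rw [diamondWord]
      · rw [show bracket p nil = p.br from rfl, sub_self]
        exact zero_mem _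
      · rintro _ _ ⟨⟩
    | bracket q v' =>
      rw [diamondWord, iota_op, show bracket p nil * bracket q v' = p.br * q.br * v' from rfl,
        mono_mul, ← sub_mul]
      refine mul_mono_mem_phiSpan ?_ _
      convert add_mem (phiAt_mem B p q) (br_mem_phiSpan (hN (eval₂ B br (mono p) (mono q)))) using 1
      rw [phiAt, red, map_sub, sub_add_sub_cancel]
  | .bracket p (.letter z u) => by
    rw [diamondWord, show bracket p (letter z u) * v = p.br * (letter z u * v) from rfl, mono_mul,
      ← mul_sub]
    exact mono_mul_mem_phiSpan (mono_mul_sub_diamondWord_mem hN v _) _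
  | .bracket p (.bracket p' u) => by
    rw [diamondWord, show bracket p (bracket p' u) * v = p.br * (bracket p' u * v) from rfl,
      mono_mul, ← mul_sub]
    exact mono_mul_mem_phiSpan (mono_mul_sub_diamondWord_mem hN v _) _

theorem diamond_apply (hN1 : ∀ r, N (RBModule.iota r) = r)
    (hN2 : ∀ f, f - RBModule.iota (N f) ∈ phiSpan B Z) (hN3 : ∀ f ∈ phiSpan B Z, N f = 0)
    (a b : RBModule k Z) : diamond B N a b = N (RBModule.iota a * RBModule.iota b) := by
  have : diamond B N = ((LinearMap.mul k (BPoly k Z)).compl₁₂ RBModule.iota RBModule.iota).compr₂ N := by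
    refine Finsupp.lhom_ext' fun u => LinearMap.ext_ring (Finsupp.lhom_ext' fun v =>
      LinearMap.ext_ring ?_)
    simp only [diamond, LinearMap.comp_apply, Finsupp.lsingle_apply, LinearMap.compr₂_apply,
      LinearMap.compl₁₂_apply, LinearMap.mul_apply', Finsupp.linearCombination_single, one_smul,
      iota_single, ← mono_mul]
    rw [← hN1 (diamondBasis B N u v), iota_diamondBasis, eq_comm, ← sub_eq_zero, ← map_sub]
    exact hN3 _ (mono_mul_sub_diamondWord_mem hN2 _ _)
  rw [this]
  rfl

/-- N is a surjection with kernel `phiSpan` and section ι. It is multiplicative for ⋄, since a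
factor may be replaced by its normal form modulo the ideal, so k·ℜ(Z) with ⋄ is a model of the
quotient. -/
theorem isFreePhiAlgebraStructure_diamond (hB : IsTotallyLinear B)
    (hN1 : ∀ r, N (RBModule.iota r) = r)
    (hN2 : ∀ f, f - RBModule.iota (N f) ∈ phiSpan B Z) (hN3 : ∀ f ∈ phiSpan B Z, N f = 0) :
    IsFreePhiAlgebraStructure.{uR} (phi B) (diamond B N) (Finsupp.single (RBWord.one Z) 1)
      RBModule.op (fun z : Z => Finsupp.single (RBWord.of z) 1) := by
  have hmul := diamond_apply hN1 hN2 hN3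
  have hcongr {f g : BPoly k Z} (h : f - g ∈ phiSpan B Z) : N f = N g := by
    rw [← sub_eq_zero, ← map_sub, hN3 _ h]
  have hleft (f g : BPoly k Z) : N (RBModule.iota (N f) * g) = N (f * g) := by
    refine (hcongr ?_).symm
    rw [← sub_mul]
    exact mul_mem_phiSpan_right g (hN2 f)
  have hright (f g : BPoly k Z) : N (g * RBModule.iota (N f)) = N (g * f) := by
    refine (hcongr ?_).symm
    rw [← mul_sub]
    exact mul_mem_phiSpan_left g (hN2 f)
  have hN (f g : BPoly k Z) : N (f * g) = diamond B N (N f) (N g) := by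
    rw [hmul, hleft, hright]
  have hmono (w : RBWord Z) : N (mono w.1) = Finsupp.single w 1 := by
    rw [← hN1 (Finsupp.single w 1), iota_single, one_smul]
  have hone : RBModule.iota (Finsupp.single (RBWord.one Z) (1 : k)) = 1 := by
    rw [iota_single, one_smul]
    exact mono_one
  have h : IsUnitalAssoc (diamond B N) (Finsupp.single (RBWord.one Z) 1) :=
    { assoc := fun a b c => by rw [hmul, hmul, hmul, hmul, hleft, hright, mul_assoc]
      one_mul := fun a => by rw [hmul, hone, one_mul, hN1]
      mul_one := fun a => by rw [hmul, hone, mul_one, hN1] }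
  refine ⟨h, ?_⟩
  let := h.toRing
  let := h.toAlgebra
  exact isFreePhiAlgebra_of_ker_eq hB
    (AlgHom.ofLinearMap N (hmono (RBWord.one Z)) hN) RBModule.iota hN1
    (fun f => by
      change N (br f) = RBModule.op (N f)
      rw [← hN1 (RBModule.op (N f)), iota_op]
      refine hcongr ?_
      rw [← map_sub]
      exact br_mem_phiSpan (hN2 f))
    (fun z => hmono (RBWord.of z))
    (fun f => ⟨fun hf => by
      have := hN2 f
      rwa [show N f = 0 from hf, map_zero, sub_zero] at this, hN3 f⟩)

end Diamond

end BPoly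

end

/-! ### Conclusion of the proof -/

theorem mainTheorem2 {k : Type uk} [CommRing k] {Z : Type uZ}
    (B : BPoly k (Fin 2)) (hB : BPoly.IsRotaBaxterType.{uZ, uk} B)
    (lt : BWord Z → BWord Z → Prop) (hlt : BPoly.IsMonomialOrder lt)
    (hcomp : BPoly.IsCompatible B lt) :
    (∃ b : Module.Basis (RBWord Z) k (PhiQuotient (BPoly.phi B) Z),
      ∀ w : RBWord Z, b w = PhiQuotient.eta (BPoly.phi B) Z (BPoly.mono w.1)) ∧
    ∃ hbij : Function.Bijective
        ((PhiQuotient.eta (BPoly.phi B) Z).toLinearMap ∘ₗ (RBModule.iota (k := k) (Z := Z))),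
      let α : PhiQuotient (BPoly.phi B) Z →ₗ[k] RBModule k Z :=
        (LinearEquiv.ofBijective _ hbij).symm
      let Red : BPoly k Z →ₗ[k] RBModule k Z := α ∘ₗ (PhiQuotient.eta (BPoly.phi B) Z).toLinearMap
      IsFreePhiAlgebraStructure.{uR, uk, 0, uZ, max uZ uk} (BPoly.phi B) (diamond B Red)
        (Finsupp.single (RBWord.one Z) 1) RBModule.op
        (fun z : Z => Finsupp.single (RBWord.of z) 1) := by
  obtain ⟨N, hN1, hN⟩ := BPoly.hasNormalForm (Z := Z) hlt ⟨hB.totallyLinear, hcomp, hB.assoc Z⟩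
  have hN3 : ∀ f ∈ BPoly.phiSpan B Z, N f = 0 := by
    intro f hf
    induction hf using Submodule.span_induction with
    | mem f h => obtain ⟨Q, s, t, rfl⟩ := h; exact hN Q s t
    | zero => exact map_zero _
    | add f g _ _ hf hg => rw [map_add, hf, hg, add_zero]
    | smul c f _ hf => rw [map_smul, hf, smul_zero]
  have hN2 : ∀ f, f - RBModule.iota (N f) ∈ BPoly.phiSpan B Z := by
    intro f
    -- After the change of rings N is only known to kill the ideal and fix normal forms. This forces
    -- it to agree with the map N' that rewrites over k itself, for which f - ι(N' f) lies in the
    -- span.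
    obtain ⟨N', -, hN', -⟩ := BPoly.exists_normalForm (k := k) hlt hcomp
    have h := hN3 _ (hN' f)
    rw [map_sub, hN1, sub_eq_zero] at h
    rw [h]
    exact hN' f
  have heta (f g : BPoly k Z) : PhiQuotient.eta (BPoly.phi B) Z f = PhiQuotient.eta (BPoly.phi B) Z g ↔
      f - g ∈ BPoly.phiSpan B Z := by
    rw [← BPoly.mem_operatedIdeal_iff hB.totallyLinear]
    exact Ideal.Quotient.eq
  have hbij : Function.Bijective
      ((PhiQuotient.eta (BPoly.phi B) Z).toLinearMap ∘ₗ (RBModule.iota (k := k) (Z := Z))) := by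
    refine ⟨fun r r' h => ?_, fun x => ?_⟩
    · have := hN3 _ ((heta _ _).1 h)
      rwa [map_sub, hN1, hN1, sub_eq_zero] at this
    · obtain ⟨f, rfl⟩ := Ideal.Quotient.mk_surjective x
      exact ⟨N f, ((heta _ _).2 (hN2 f)).symm⟩
  refine ⟨⟨Finsupp.basisSingleOne.map (LinearEquiv.ofBijective _ hbij), fun w => ?_⟩, hbij, ?_⟩
  · rw [Module.Basis.map_apply, Finsupp.coe_basisSingleOne, LinearEquiv.ofBijective_apply,
      LinearMap.comp_apply, BPoly.iota_single, one_smul]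
    rfl
  · intro α Red
    have hRed : Red = N := by
      -- N f is the normal form with the same class as f.
      refine LinearMap.ext fun f => (LinearEquiv.ofBijective _ hbij).symm_apply_eq.2 ?_
      exact (heta _ _).2 (hN2 f)
    rw [hRed]
    exact BPoly.isFreePhiAlgebraStructure_diamond hB.totallyLinear hN1 hN2 hN3
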